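/- Let $R$ be a field of characteristic $0$ (for example $\mathbb R$). Let $\Lambda_0=\Lambda_{0,nov}$ be the Novikov ring of formal sums $\sum_i a_iT^{\lambda_i}e^{q_i}$ with $a_i\in R$, $\lambda_i\in\mathbb R_{\ge 0}$, $q_i\in\mathbb Z$ and only finitely many nonzero terms with $\lambda_i\le E$ for every $E$; here $\deg T=0$, $\deg e=2$, and $F^\lambda$ denotes the energy filtration by the exponent of $T$. For a $\mathbb Z$-graded $R$-vector space $\overline C$ let $C=\overline C\,\widehat\otimes_R\Lambda_0$ be the completed free graded $\Lambda_0$-module on it, write $|x|'=|x|-1$ for the degree in $C[1]$, and let $\widehat BC$ be the energy completion of $\bigoplus_{k\ge 0}C[1]^{\otimes k}$. A filtered $A_\infty$-algebra structure on $C$ is a family of $\Lambda_0$-multilinear maps $m_k$ ($k\ge 0$) from $C[1]^{\otimes k}$ to $C[1]$ of degree $1$, with $m_k(F^{\lambda_1}C,\dots,F^{\lambda_k}C)\subseteq F^{\lambda_1+\dots+\lambda_k}C$, with $m_0(1)\in F^{\lambda'}C$ for some $\lambda'>0$, which modulo positive energy are induced from maps $\overline m_k:\overline C[1]^{\otimes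 k}\to\overline C[1]$, and such that the coderivation $$\widehat d(x_1\otimes\dots\otimes x_n)=\sum_{k,i}(-1)^{|x_1|'+\dots+|x_i|'}x_1\otimes\dots\otimes x_i\otimes m_k(x_{i+1},\dots,x_{i+k})\otimes\dots\otimes x_n$$ of $\widehat BC$ satisfies $\widehat d\circ\widehat d=0$. A filtered $A_\infty$-homomorphism $f:C_1\to C_2$ is a family of $\Lambda_0$-multilinear maps $f_k$ ($k\ge 0$) from $C_1[1]^{\otimes k}$ to $C_2[1]$ of degree $0$ satisfying the same energy and reduction conditions (in particular $f_0(1)\in F^{\lambda'}C_2$ for some $\lambda'>0$), such that the map $\widehat f:\widehat BC_1\to\widehat BC_2$, $$\widehat f(x_1\otimes\dots\otimes x_k)=\sum_{N\ge 0}\ \sum_{k_1+\dots+k_N=k}f_{k_1}(x_1,\dots)\otimes\dots\otimes f_{k_N}(\dots,x_k),$$ satisfies $\widehat d\circ\widehat f=\widehat f\circ\widehat d$. Such a family $(\varphi_k)$ ($=(m_k)$ or $(f_k)$) is called gapped if there are a submonoid $G\subset\mathbb R_{\ge 0}\times 2\mathbb Z$ whose projection to $\mathbb R_{\ge 0}$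 has finitely many elements in each bounded interval, with $G\cap(\{0\}\times 2\mathbb Z)=\{(0,0)\}$ and $G\cap(\{\lambda\}\times 2\mathbb Z)$ finite for all $\lambda$, and $R$-multilinear maps $\varphi_{k,\beta}$ on $\overline C$ with $\varphi_k=\sum_{\beta=(\lambda,\mu)\in G}T^{\lambda}e^{\mu/2}\varphi_{k,\beta}$. Let $\widehat B^{cyc}C$, respectively $\widehat EC$, be the part of $\widehat BC$ whose component in each tensor length $k$ is fixed by the cyclic permutation $x_1\otimes\dots\otimes x_k\mapsto\pm x_2\otimes\dots\otimes x_k\otimes x_1$, respectively by all permutations in $S_k$, acting with Koszul signs with respect to the degrees $|\cdot|'$. Let $C_1,C_2$ be gapped filtered $A_\infty$-algebras over $\Lambda_0$ and let $f:C_1\to C_2$ be a gapped filtered $A_\infty$-homomorphism such that $\overline f_1$ induces an isomorphism $H(\overline C_1,\overline m_1)\to H(\overline C_2,\overline m_1)$ on $\overline m_1$-cohomology. Then $\widehat B^{cyc}C_i$ and $\widehat EC_i$ are subcomplexes of $(\widehat BC_i,\widehat d)$ that are respected by $\widehat f$, and $\widehat f$ induces isomorphisms $$H(\widehat BC_1,\widehat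 d)\cong H(\widehat BC_2,\widehat d),\qquad H(\widehat B^{cyc}C_1,\widehat d)\cong H(\widehat B^{cyc}C_2,\widehat d),\qquad H(\widehat EC_1,\widehat d)\cong H(\widehat EC_2,\widehat d),$$ both of the total cohomologies, as $\Lambda_0$-modules, and in each degree $p\in\mathbb Z$. -/

import Mathlib

open scoped NNReal TensorProduct DirectSum

noncomputable section

/-! ## Novikov series -/

/-- Exponents: `(l, q)` stands for the monomial `T ^ l * e ^ q`. -/
abbrev NovExp : Type := ℝ≥0 × ℤ

/-- Formal sums `∑ T ^ lᵢ e ^ qᵢ vᵢ` with `vᵢ ∈ M`, `lᵢ ≥ 0` and only finitely many nonzero terms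
of energy `lᵢ ≤ E`, for every `E`. -/
def novSubmodule (R M : Type*) [CommRing R] [AddCommGroup M] [Module R M] :
    Submodule R (NovExp → M) where
  carrier := {x | ∀ E : ℝ≥0, {g : NovExp | g.1 ≤ E ∧ x g ≠ 0}.Finite}
  zero_mem' := fun E => by simp
  add_mem' := by
    intro x y hx hy E
    refine ((hx E).union (hy E)).subset ?_
    rintro g ⟨hg, h⟩
    by_cases h1 : x g = 0
    · right
      refine ⟨hg, fun h2 => h ?_⟩
      simp [h1, h2]
    · exact Or.inl ⟨hg, h1⟩
  smul_mem' := by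
    intro c x hx E
    refine (hx E).subset ?_
    rintro g ⟨hg, h⟩
    refine ⟨hg, fun h2 => h ?_⟩
    simp [h2]

/-- The energy completion of `M ⊗[R] Λ₀`, where `Λ₀ = Λ_{0,nov}` is the Novikov ring over `R`. -/
def Nov (R M : Type*) [CommRing R] [AddCommGroup M] [Module R M] : Type _ :=
  ↥(novSubmodule R M)

namespace Nov

section Basic

variable {R M N P : Type*} [CommRing R] [AddCommGroup M] [Module R M]
  [AddCommGroup N] [Module R N] [AddCommGroup P] [Module R P]

instance : AddCommGroup (Nov R M) := inferInstanceAs (AddCommGroup ↥(novSubmodule R M))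

instance : Module R (Nov R M) := inferInstanceAs (Module R ↥(novSubmodule R M))

/-- The coefficient of `T ^ l e ^ q`, for `g = (l, q)`. -/
def coeff (x : Nov R M) (g : NovExp) : M := x.1 g

theorem finite_coeff (x : Nov R M) (E : ℝ≥0) :
    {g : NovExp | g.1 ≤ E ∧ x.coeff g ≠ 0}.Finite := x.2 E

@[ext] theorem ext {x y : Nov R M} (h : ∀ g, x.coeff g = y.coeff g) : x = y :=
  Subtype.ext (funext h)

@[simp] theorem coeff_zero (g : NovExp) : (0 : Nov R M).coeff g = 0 := rfl

@[simp] theorem coeff_add (x y : Nov R M) (g : NovExp) :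
    (x + y).coeff g = x.coeff g + y.coeff g := rfl

@[simp] theorem coeff_smul (r : R) (x : Nov R M) (g : NovExp) :
    (r • x).coeff g = r • x.coeff g := rfl

/-- The finite set of exponents of energy at most `E` that occur in `x`. -/
def supp (x : Nov R M) (E : ℝ≥0) : Finset NovExp := (x.finite_coeff E).toFinset

@[simp] theorem mem_supp {x : Nov R M} {E : ℝ≥0} {g : NovExp} :
    g ∈ x.supp E ↔ g.1 ≤ E ∧ x.coeff g ≠ 0 := by simp [supp]

/-- The series `v T ^ 0 e ^ 0`. -/
def const : M →ₗ[R] Nov R M where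
  toFun v := ⟨fun g => if g = 0 then v else 0, fun E => by
    refine (Set.finite_singleton (0 : NovExp)).subset ?_
    rintro g ⟨-, h⟩
    by_contra hg
    exact h (if_neg hg)⟩
  map_add' v w := by
    ext g
    change (if g = 0 then v + w else 0) = (if g = 0 then v else 0) + (if g = 0 then w else 0)
    split_ifs <;> simp
  map_smul' r v := by
    ext g
    change (if g = 0 then r • v else 0) = r • (if g = 0 then v else 0)
    split_ifs <;> simp

theorem coeff_const (v : M) (g : NovExp) :
    (const v : Nov R M).coeff g = if g = 0 then v else 0 := rfl

/-- Apply an `R`-linear map to all coefficients. -/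
def map (h : M →ₗ[R] N) : Nov R M →ₗ[R] Nov R N where
  toFun x := ⟨fun g => h (x.coeff g), fun E => by
    refine (x.finite_coeff E).subset ?_
    rintro g ⟨hg, h'⟩
    refine ⟨hg, fun h2 => h' ?_⟩
    simp [h2]⟩
  map_add' x y := by
    ext g
    exact h.map_add _ _
  map_smul' r x := by
    ext g
    exact h.map_smul _ _

@[simp] theorem coeff_map (h : M →ₗ[R] N) (x : Nov R M) (g : NovExp) :
    (map h x).coeff g = h (x.coeff g) := rfl

/-- The coefficient at `g` of `∑ₐ T ^ a.1 e ^ a.2 φ (xₐ)`. -/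
def liftCoeff (φ : M →ₗ[R] Nov R N) (x : Nov R M) (g : NovExp) : N :=
  ∑ a ∈ x.supp g.1, (φ (x.coeff a)).coeff (g - a)

theorem liftCoeff_eq (φ : M →ₗ[R] Nov R N) (x : Nov R M) (g : NovExp) (S : Finset NovExp)
    (hS : x.supp g.1 ⊆ S) :
    liftCoeff φ x g =
      ∑ a ∈ S, if a.1 ≤ g.1 then (φ (x.coeff a)).coeff (g - a) else 0 := by
  rw [liftCoeff, ← Finset.sum_subset hS]
  · refine Finset.sum_congr rfl fun a ha => ?_
    rw [if_pos (mem_supp.1 ha).1]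
  · intro a _ ha
    split_ifs with h
    · have : x.coeff a = 0 := by
        by_contra h'
        exact ha (mem_supp.2 ⟨h, h'⟩)
      simp [this]
    · rfl

/-- A finite set that contains all exponents of energy at most `E` of `lift φ x`. -/
def liftSupp (φ : M →ₗ[R] Nov R N) (x : Nov R M) (E : ℝ≥0) : Finset NovExp :=
  (x.supp E).biUnion fun a => ((φ (x.coeff a)).supp E).image fun b => a + b

theorem mem_liftSupp (φ : M →ₗ[R] Nov R N) (x : Nov R M) (E : ℝ≥0) (g : NovExp)
    (hg : g.1 ≤ E) (h : liftCoeff φ x g ≠ 0) : g ∈ liftSupp φ x E := by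
  obtain ⟨a, ha, h'⟩ := Finset.exists_ne_zero_of_sum_ne_zero h
  rw [mem_supp] at ha
  refine Finset.mem_biUnion.2 ⟨a, mem_supp.2 ⟨ha.1.trans hg, ha.2⟩, ?_⟩
  refine Finset.mem_image.2 ⟨g - a, mem_supp.2 ⟨tsub_le_self.trans hg, h'⟩, ?_⟩
  exact Prod.ext (add_tsub_cancel_of_le ha.1) (add_sub_cancel _ _)

/-- The unique `Λ₀`-linear, energy-continuous extension of an `R`-linear map `M → Nov R N`
to a map `Nov R M → Nov R N`; here as an `R`-linear map. -/
def liftR (φ : M →ₗ[R] Nov R N) : Nov R M →ₗ[R] Nov R N where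
  toFun x := ⟨liftCoeff φ x, fun E =>
    (liftSupp φ x E).finite_toSet.subset fun g hg => mem_liftSupp φ x E g hg.1 hg.2⟩
  map_add' x y := by
    ext g
    change liftCoeff φ (x + y) g = liftCoeff φ x g + liftCoeff φ y g
    rw [liftCoeff_eq φ (x + y) g (x.supp g.1 ∪ y.supp g.1),
      liftCoeff_eq φ x g _ Finset.subset_union_left,
      liftCoeff_eq φ y g _ Finset.subset_union_right, ← Finset.sum_add_distrib]
    · refine Finset.sum_congr rfl fun a _ => ?_
      split_ifs <;> simp
    · intro a ha
      rw [mem_supp] at ha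
      by_cases h : x.coeff a = 0
      · refine Finset.mem_union_right _ (mem_supp.2 ⟨ha.1, fun h' => ha.2 ?_⟩)
        simp [h, h']
      · exact Finset.mem_union_left _ (mem_supp.2 ⟨ha.1, h⟩)
  map_smul' r x := by
    ext g
    change liftCoeff φ (r • x) g = r • liftCoeff φ x g
    rw [liftCoeff_eq φ (r • x) g (x.supp g.1), liftCoeff, Finset.smul_sum]
    · refine Finset.sum_congr rfl fun a ha => ?_
      rw [if_pos (mem_supp.1 ha).1]
      simp
    · intro a ha
      rw [mem_supp] at ha ⊢
      refine ⟨ha.1, fun h => ha.2 ?_⟩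
      simp [h]

theorem coeff_liftR (φ : M →ₗ[R] Nov R N) (x : Nov R M) (g : NovExp) :
    (liftR φ x).coeff g = ∑ a ∈ x.supp g.1, (φ (x.coeff a)).coeff (g - a) := rfl

theorem coeff_liftR_eq (φ : M →ₗ[R] Nov R N) (x : Nov R M) (g : NovExp) (S : Finset NovExp)
    (hS : x.supp g.1 ⊆ S) :
    (liftR φ x).coeff g =
      ∑ a ∈ S, if a.1 ≤ g.1 then (φ (x.coeff a)).coeff (g - a) else 0 :=
  liftCoeff_eq φ x g S hS

theorem liftR_const (φ : M →ₗ[R] Nov R N) (v : M) : liftR φ (const v) = φ v := by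
  ext g
  rw [coeff_liftR_eq φ _ g {0}]
  · simp [coeff_const]
  · intro a ha
    rw [mem_supp, coeff_const] at ha
    by_contra h
    exact ha.2 (if_neg (by simpa using h))

theorem liftR_liftR (ψ : N →ₗ[R] Nov R P) (φ : M →ₗ[R] Nov R N) (x : Nov R M) :
    liftR ψ (liftR φ x) = liftR (liftR ψ ∘ₗ φ) x := by
  ext g
  rw [coeff_liftR_eq ψ _ g (liftSupp φ x g.1)
    (fun a ha => mem_liftSupp φ x g.1 a (mem_supp.1 ha).1 (by exact (mem_supp.1 ha).2)),
    coeff_liftR]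
  have hL : ∀ c ∈ liftSupp φ x g.1,
      (if c.1 ≤ g.1 then (ψ ((liftR φ x).coeff c)).coeff (g - c) else 0) =
      ∑ a ∈ x.supp g.1, if a.1 ≤ c.1 ∧ c.1 ≤ g.1 then
        (ψ ((φ (x.coeff a)).coeff (c - a))).coeff (g - c) else 0 := by
    intro c _
    split_ifs with hc
    · rw [coeff_liftR_eq φ x c (x.supp g.1)
        (fun a ha => mem_supp.2 ⟨(mem_supp.1 ha).1.trans hc, (mem_supp.1 ha).2⟩)]
      let ev : Nov R P →+ P :=
        { toFun := fun y => y.coeff (g - c), map_zero' := rfl, map_add' := fun _ _ => rfl }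
      change ev (ψ _) = _
      rw [map_sum, map_sum]
      refine Finset.sum_congr rfl fun a _ => ?_
      by_cases h : a.1 ≤ c.1
      · rw [if_pos h, if_pos ⟨h, hc⟩]
        rfl
      · rw [if_neg h, if_neg fun h' => h h'.1, map_zero, map_zero]
    · simp [hc]
  rw [Finset.sum_congr rfl hL, Finset.sum_comm]
  refine Finset.sum_congr rfl fun a ha => ?_
  have hag := (mem_supp.1 ha).1
  rw [LinearMap.comp_apply, coeff_liftR]
  symm
  refine Finset.sum_bij_ne_zero (fun b _ _ => a + b) ?_ ?_ ?_ ?_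
  · intro b hb _
    rw [mem_supp] at hb
    exact Finset.mem_biUnion.2 ⟨a, ha, Finset.mem_image.2
      ⟨b, mem_supp.2 ⟨hb.1.trans tsub_le_self, hb.2⟩, rfl⟩⟩
  · intro b _ _ b' _ _ h
    exact add_left_cancel h
  · intro c _ hc'
    have hc : a.1 ≤ c.1 ∧ c.1 ≤ g.1 := by
      by_contra h
      exact hc' (if_neg h)
    rw [if_pos hc] at hc'
    have hac : a + (c - a) = c := Prod.ext (add_tsub_cancel_of_le hc.1) (add_sub_cancel _ _)
    have hga : g - a - (c - a) = g - c := by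
      refine Prod.ext ?_ ?_
      · exact tsub_tsub_tsub_cancel_right hc.1
      · exact sub_sub_sub_cancel_right _ _ _
    refine ⟨c - a, mem_supp.2 ⟨tsub_le_tsub_right hc.2 _, fun h => hc' (by simp [h])⟩, ?_, hac⟩
    rw [hga]
    exact hc'
  · intro b hb _
    rw [mem_supp] at hb
    have h1 : a.1 ≤ (a + b).1 ∧ (a + b).1 ≤ g.1 :=
      ⟨le_self_add, (add_le_add_right hb.1 _).trans (add_tsub_cancel_of_le hag).le⟩
    have h2 : a + b - a = b := Prod.ext (add_tsub_cancel_left _ _) (add_sub_cancel_left _ _)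
    have h3 : g - (a + b) = g - a - b :=
      Prod.ext (tsub_add_eq_tsub_tsub _ _ _) (sub_add_eq_sub_sub _ _ _)
    rw [if_pos h1, h2, h3]

/-- The convolution `(T ^ a m) * (T ^ b n) = T ^ (a + b) μ(m, n)` defined by a bilinear map `μ`. -/
def conv (μ : M →ₗ[R] N →ₗ[R] P) : Nov R M →ₗ[R] Nov R N →ₗ[R] Nov R P :=
  LinearMap.mk₂ R
    (fun x y => liftR
      ({ toFun := fun v => map (μ v) y
         map_add' := fun v w => by ext g; simp
         map_smul' := fun r v => by ext g; simp } : M →ₗ[R] Nov R P) x)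
    (fun x x' y => map_add _ x x') (fun r x y => map_smul _ r x)
    (fun x y y' => by
      ext g
      simp only [coeff_add, coeff_liftR, ← Finset.sum_add_distrib]
      refine Finset.sum_congr rfl fun a _ => ?_
      simp)
    (fun r x y => by
      ext g
      simp only [coeff_smul, coeff_liftR, Finset.smul_sum]
      refine Finset.sum_congr rfl fun a _ => ?_
      simp)

theorem coeff_conv (μ : M →ₗ[R] N →ₗ[R] P) (x : Nov R M) (y : Nov R N) (g : NovExp) :
    (conv μ x y).coeff g = ∑ a ∈ x.supp g.1, μ (x.coeff a) (y.coeff (g - a)) := rfl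

theorem coeff_conv_symm (μ : M →ₗ[R] N →ₗ[R] P) (x : Nov R M) (y : Nov R N) (g : NovExp) :
    (conv μ x y).coeff g = ∑ a ∈ x.supp g.1, ∑ b ∈ y.supp g.1,
      if a + b = g then μ (x.coeff a) (y.coeff b) else 0 := by
  rw [coeff_conv]
  refine Finset.sum_congr rfl fun a ha => ?_
  have hag := (mem_supp.1 ha).1
  have h1 : ∀ b : NovExp, a + b = g ↔ b = g - a := by
    intro b
    constructor
    · rintro rfl
      exact Prod.ext (add_tsub_cancel_left _ _).symm (add_sub_cancel_left _ _).symm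
    · rintro rfl
      exact Prod.ext (add_tsub_cancel_of_le hag) (add_sub_cancel _ _)
  simp only [h1, Finset.sum_ite_eq']
  split_ifs with h
  · rfl
  · have : y.coeff (g - a) = 0 := by
      by_contra h'
      exact h (mem_supp.2 ⟨tsub_le_self, h'⟩)
    simp [this]

theorem conv_flip (μ : M →ₗ[R] N →ₗ[R] P) (x : Nov R M) (y : Nov R N) :
    conv μ x y = conv μ.flip y x := by
  ext g
  rw [coeff_conv_symm, coeff_conv_symm, Finset.sum_comm]
  simp only [add_comm, LinearMap.flip_apply]

end Basic

end Nov

/-! ## The Novikov ring and its modules -/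

/-- The Novikov ring `Λ_{0,nov}` over `R`. -/
abbrev NovRing (R : Type*) [CommRing R] : Type _ := Nov R R

namespace Nov

section Ring

variable {R M N : Type*} [CommRing R] [AddCommGroup M] [Module R M] [AddCommGroup N] [Module R N]

instance : SMul (NovRing R) (Nov R M) := ⟨fun r x => conv (LinearMap.lsmul R M) r x⟩

theorem novSmul_def (r : NovRing R) (x : Nov R M) : r • x = conv (LinearMap.lsmul R M) r x := rfl

/-- `r ↦ r • x` on constants. -/
def actOn (x : Nov R M) : R →ₗ[R] Nov R M where
  toFun r := r • x
  map_add' r s := add_smul r s x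
  map_smul' r s := by simp [mul_smul]

theorem novSmul_eq_liftR (r : NovRing R) (x : Nov R M) : r • x = liftR (actOn x) r := by
  rw [novSmul_def]
  rfl

instance : Mul (NovRing R) := ⟨fun r s => conv (LinearMap.lsmul R R) r s⟩

instance : One (NovRing R) := ⟨const 1⟩

theorem liftR_novSmul (φ : M →ₗ[R] Nov R N) (r : NovRing R) (x : Nov R M) :
    liftR φ (r • x) = r • liftR φ x := by
  rw [novSmul_eq_liftR, novSmul_eq_liftR, liftR_liftR]
  have h : liftR φ ∘ₗ actOn x = actOn (liftR φ x) :=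
    LinearMap.ext fun s => map_smul (liftR φ) s x
  rw [h]

theorem novMul_smul (r s : NovRing R) (x : Nov R M) : (r * s) • x = r • s • x := by
  rw [novSmul_eq_liftR (r * s) x, novSmul_eq_liftR s x]
  exact liftR_novSmul (actOn x) r s

theorem novOne_smul (x : Nov R M) : (1 : NovRing R) • x = x := by
  rw [novSmul_eq_liftR]
  exact (liftR_const (actOn x) 1).trans (one_smul R x)

theorem novMul_comm (r s : NovRing R) : r * s = s * r := by
  change conv (LinearMap.lsmul R R) r s = conv (LinearMap.lsmul R R) s r
  rw [conv_flip]
  have h : (LinearMap.lsmul R R).flip = LinearMap.lsmul R R := by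
    ext
    simp
  rw [h]

instance : CommRing (NovRing R) :=
  { (inferInstance : AddCommGroup (Nov R R)), (inferInstance : Mul (NovRing R)),
    (inferInstance : One (NovRing R)) with
    left_distrib := fun a b c => map_add (conv (LinearMap.lsmul R R) a) b c
    right_distrib := fun a b c => LinearMap.map_add₂ (conv (LinearMap.lsmul R R)) a b c
    zero_mul := fun a => LinearMap.map_zero₂ (conv (LinearMap.lsmul R R)) a
    mul_zero := fun a => map_zero (conv (LinearMap.lsmul R R) a)
    mul_assoc := fun a b c => novMul_smul a b c
    one_mul := fun a => novOne_smul a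
    mul_one := fun a => (novMul_comm a 1).trans (novOne_smul a)
    mul_comm := novMul_comm }

instance : Module (NovRing R) (Nov R M) where
  one_smul := novOne_smul
  mul_smul := novMul_smul
  smul_zero r := map_zero (conv (LinearMap.lsmul R M) r)
  smul_add r x y := map_add (conv (LinearMap.lsmul R M) r) x y
  add_smul r s x := LinearMap.map_add₂ (conv (LinearMap.lsmul R M)) r s x
  zero_smul x := LinearMap.map_zero₂ (conv (LinearMap.lsmul R M)) x

instance : IsScalarTower R (NovRing R) (Nov R M) where
  smul_assoc r s x := LinearMap.map_smul₂ (conv (LinearMap.lsmul R M)) r s x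

/-- The unique `Λ₀`-linear, energy-continuous extension of an `R`-linear map `M → Nov R N`. -/
def lift (φ : M →ₗ[R] Nov R N) : Nov R M →ₗ[NovRing R] Nov R N where
  toFun := liftR φ
  map_add' := (liftR φ).map_add
  map_smul' r x := liftR_novSmul φ r x

/-- The energy filtration: series all of whose terms have energy at least `l`. -/
def energy (R M : Type*) [CommRing R] [AddCommGroup M] [Module R M] (l : ℝ≥0) :
    Submodule R (Nov R M) where
  carrier := {x | ∀ g, x.coeff g ≠ 0 → l ≤ g.1}
  zero_mem' := fun g h => absurd rfl h
  add_mem' := by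
    intro x y hx hy g h
    by_cases h1 : x.coeff g = 0
    · refine hy g fun h2 => h ?_
      simp [h1, h2]
    · exact hx g h1
  smul_mem' := by
    intro r x hx g h
    refine hx g fun h2 => h ?_
    simp [h2]

theorem mem_energy_zero (x : Nov R M) : x ∈ energy R M 0 := fun _ _ => zero_le

theorem energy_anti {l l' : ℝ≥0} (h : l ≤ l') : energy R M l' ≤ energy R M l :=
  fun _ hx g hg => h.trans (hx g hg)

theorem conv_mem_energy {P : Type*} [AddCommGroup P] [Module R P] (μ : M →ₗ[R] N →ₗ[R] P)
    {l l' : ℝ≥0} {x : Nov R M} {y : Nov R N} (hx : x ∈ energy R M l) (hy : y ∈ energy R N l') :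
    conv μ x y ∈ energy R P (l + l') := by
  intro g h
  rw [coeff_conv] at h
  obtain ⟨a, ha, h'⟩ := Finset.exists_ne_zero_of_sum_ne_zero h
  rw [mem_supp] at ha
  have h1 := hx a ha.2
  have h2 := hy (g - a) fun h0 => h' (by simp [h0])
  calc l + l' ≤ a.1 + (g - a).1 := add_le_add h1 h2
    _ = g.1 := add_tsub_cancel_of_le ha.1

theorem map_mem_energy (h : M →ₗ[R] N) {l : ℝ≥0} {x : Nov R M} (hx : x ∈ energy R M l) :
    map h x ∈ energy R N l := by
  intro g hg
  refine hx g fun h0 => hg ?_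
  simp [h0]

/-- The degree `p` part with respect to a family `𝒱` of degree parts of `M`, where `T` has
degree `0` and `e` has degree `2`. -/
def degreePart (𝒱 : ℤ → Submodule R M) (p : ℤ) : Submodule R (Nov R M) where
  carrier := {x | ∀ g, x.coeff g ∈ 𝒱 (p - 2 * g.2)}
  zero_mem' := fun g => (𝒱 (p - 2 * g.2)).zero_mem
  add_mem' := fun hx hy g => (𝒱 (p - 2 * g.2)).add_mem (hx g) (hy g)
  smul_mem' := fun r _ hx g => (𝒱 (p - 2 * g.2)).smul_mem r (hx g)

/-- Series all of whose coefficients lie in `S`: the energy completion of `S ⊗[R] Λ₀`. -/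
def coeffsIn (S : Submodule R M) : Submodule (NovRing R) (Nov R M) where
  carrier := {x | ∀ g, x.coeff g ∈ S}
  zero_mem' := fun _ => S.zero_mem
  add_mem' := fun hx hy g => S.add_mem (hx g) (hy g)
  smul_mem' := by
    intro r x hx g
    rw [novSmul_def, coeff_conv]
    refine S.sum_mem fun a _ => ?_
    rw [LinearMap.lsmul_apply]
    exact S.smul_mem _ (hx _)

/-- The coefficientwise sum of a sequence of linear maps that is locally finite in energy. -/
def sumMap (u : ℕ → M →ₗ[R] Nov R N)
    (hu : ∀ x : M, ∀ E : ℝ≥0, ∃ D : ℕ, ∀ n, D ≤ n → ∀ g : NovExp, g.1 ≤ E → (u n x).coeff g = 0) :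
    M →ₗ[R] Nov R N where
  toFun x := ⟨fun g => ∑ᶠ n, (u n x).coeff g, fun E => by
    obtain ⟨D, hD⟩ := hu x E
    refine ((Finset.range D).biUnion fun n => (u n x).supp E).finite_toSet.subset ?_
    rintro g ⟨hg, h⟩
    obtain ⟨n, hn⟩ : ∃ n, (u n x).coeff g ≠ 0 := by
      by_contra! h0
      exact h (finsum_eq_zero_of_forall_eq_zero h0)
    refine Finset.mem_coe.2 (Finset.mem_biUnion.2 ⟨n, ?_, mem_supp.2 ⟨hg, hn⟩⟩)
    by_contra hn'
    exact hn (hD n (by simpa using hn') g hg)⟩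
  map_add' x y := by
    ext g
    change ∑ᶠ n, (u n (x + y)).coeff g = ∑ᶠ n, (u n x).coeff g + ∑ᶠ n, (u n y).coeff g
    rw [← finsum_add_distrib]
    · simp
    · obtain ⟨D, hD⟩ := hu x g.1
      refine (Finset.range D).finite_toSet.subset fun n hn => ?_
      by_contra hn'
      exact hn (hD n (by simpa using hn') g le_rfl)
    · obtain ⟨D, hD⟩ := hu y g.1
      refine (Finset.range D).finite_toSet.subset fun n hn => ?_
      by_contra hn'
      exact hn (hD n (by simpa using hn') g le_rfl)
  map_smul' r x := by
    ext g
    change ∑ᶠ n, (u n (r • x)).coeff g = r • ∑ᶠ n, (u n x).coeff g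
    obtain ⟨D, hD⟩ := hu x g.1
    refine Eq.trans ?_ (smul_finsum' r (f := fun n => (u n x).coeff g) ?_).symm
    · simp
    · refine (Finset.range D).finite_toSet.subset fun n hn => ?_
      by_contra hn'
      exact hn (hD n (by simpa using hn') g le_rfl)

end Ring

end Nov

/-! ## The tensor coalgebra, Koszul signs -/

section Tensor

variable (R V : Type*) [CommRing R] [AddCommGroup V] [Module R V]

/-- `⨁ₙ V ⊗ ⋯ ⊗ V`, including the summand `R` for `n = 0`. -/
abbrev TensorSum : Type _ := ⨁ n : ℕ, ⨂[R]^n V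

/-- The completed bar construction `B̂C` of `C = Nov R V`: the energy completion of
`⨁ₙ C ⊗ ⋯ ⊗ C` (tensor products over `Λ₀`), that is, of `(⨁ₙ V ⊗ ⋯ ⊗ V) ⊗[R] Λ₀`. -/
abbrev Bar : Type _ := Nov R (TensorSum R V)

variable {R V}

/-- The inclusion of `V` as the tensors of length one. -/
def tensorOne : V →ₗ[R] TensorSum R V :=
  DirectSum.lof R ℕ (fun n => ⨂[R]^n V) 1 ∘ₗ
    (PiTensorProduct.subsingletonEquiv (R := R) (s := fun _ : Fin 1 => V) 0).symm.toLinearMap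

/-- `x₁, …, xₙ ↦ x₁ ⊗ ⋯ ⊗ xₙ`. -/
def tensorOf (n : ℕ) : MultilinearMap R (fun _ : Fin n => V) (TensorSum R V) :=
  (DirectSum.lof R ℕ (fun n => ⨂[R]^n V) n).compMultilinearMap (PiTensorProduct.tprod R)

/-- The product on `B̂C` that extends the tensor product `⊗`. -/
def barMul : Bar R V →ₗ[R] Bar R V →ₗ[R] Bar R V :=
  Nov.conv (LinearMap.mul R (TensorSum R V))

variable {W : Type*} [AddCommGroup W] [Module R W]

variable (R V W) in
/-- A family of `R`-multilinear maps `V ^ n → B̂(Nov R W)`, one for each `n`. -/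
abbrev BarSeries : Type _ := ∀ n : ℕ, MultilinearMap R (fun _ : Fin n => V) (Bar R W)

/-- `(x₁, …, x_{i+j}) ↦ a (x₁, …, xᵢ) ⊗ b (x_{i+1}, …, x_{i+j})`. -/
def barConcat {i j : ℕ} (a : MultilinearMap R (fun _ : Fin i => V) (Bar R W))
    (b : MultilinearMap R (fun _ : Fin j => V) (Bar R W)) :
    MultilinearMap R (fun _ : Fin (i + j) => V) (Bar R W) :=
  ((TensorProduct.lift barMul).compMultilinearMap (a.domCoprod b)).domDomCongr finSumFinEquiv

theorem barConcat_apply {i j : ℕ} (a : MultilinearMap R (fun _ : Fin i => V) (Bar R W))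
    (b : MultilinearMap R (fun _ : Fin j => V) (Bar R W)) (x : Fin (i + j) → V) :
    barConcat a b x =
      barMul (a fun s => x (Fin.castAdd j s)) (b fun s => x (Fin.natAdd i s)) := by
  simp [barConcat]

namespace BarSeries

/-- `(a ⋆ b) (x₁, …, xₙ) = ∑_{i + j = n} a (x₁, …, xᵢ) ⊗ b (x_{i+1}, …, xₙ)`. -/
def conv (a b : BarSeries R V W) : BarSeries R V W := fun n =>
  ∑ p ∈ (Finset.HasAntidiagonal.antidiagonal n).attach,
    (barConcat (a p.1.1) (b p.1.2)).domDomCongr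
      (finCongr (Finset.HasAntidiagonal.mem_antidiagonal.1 p.2))

/-- The unit of `conv`: it is `1` on the empty sequence and `0` otherwise. -/
def unit : BarSeries R V W
  | 0 => MultilinearMap.constOfIsEmpty R _ (Nov.const (tensorOf 0 ![]))
  | _ + 1 => 0

/-- The `N`-fold convolution power. -/
def power (a : BarSeries R V W) : ℕ → BarSeries R V W
  | 0 => unit
  | N + 1 => conv a (power a N)

/-- The linear map on tensors that corresponds to the family `a`. -/
def toLin (a : BarSeries R V W) : TensorSum R V →ₗ[R] Bar R W :=
  DirectSum.toModule R ℕ (Bar R W) fun n => PiTensorProduct.lift (a n)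

theorem toLin_tensorOf (a : BarSeries R V W) (n : ℕ) (x : Fin n → V) :
    toLin a (tensorOf n x) = a n x := by
  simp [toLin, tensorOf]

theorem power_mem_energy (a : BarSeries R V W) (l : ℝ≥0)
    (h : ∀ x, a 0 x ∈ Nov.energy R (TensorSum R W) l) (N n : ℕ) (x : Fin n → V) :
    power a N n x ∈ Nov.energy R (TensorSum R W) ((N - n : ℕ) * l) := by
  induction N generalizing n with
  | zero => simpa using Nov.mem_energy_zero _
  | succ N ih =>
    rw [power, conv, sum_apply]
    refine Submodule.sum_mem _ fun p _ => ?_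
    obtain ⟨⟨i, j⟩, hp⟩ := p
    obtain rfl : i + j = n := Finset.HasAntidiagonal.mem_antidiagonal.1 hp
    rw [MultilinearMap.domDomCongr_apply, barConcat_apply]
    cases i with
    | zero =>
      refine Nov.energy_anti ?_ (Nov.conv_mem_energy _ (h _) (ih j _))
      calc ((N + 1 - (0 + j) : ℕ) : ℝ≥0) * l ≤ ((1 + (N - j) : ℕ) : ℝ≥0) * l := by
            gcongr
            omega
        _ = l + (N - j : ℕ) * l := by
            rw [Nat.cast_add, add_mul, Nat.cast_one, one_mul]
    | succ i =>
      refine Nov.energy_anti ?_ (Nov.conv_mem_energy _ (Nov.mem_energy_zero _) (ih j _))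
      rw [zero_add]
      exact mul_le_mul_of_nonneg_right (Nat.cast_le.2 (by omega)) zero_le

theorem toLin_power_mem_energy (a : BarSeries R V W) (l : ℝ≥0)
    (h : ∀ x, a 0 x ∈ Nov.energy R (TensorSum R W) l) (t : TensorSum R V) :
    ∃ D : ℕ, ∀ N : ℕ,
      toLin (power a N) t ∈ Nov.energy R (TensorSum R W) ((N - D : ℕ) * l) := by
  have key : ∀ D D' N : ℕ, D ≤ D' → Nov.energy R (TensorSum R W) ((N - D : ℕ) * l) ≤
      Nov.energy R (TensorSum R W) ((N - D' : ℕ) * l) := by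
    intro D D' N hD
    refine Nov.energy_anti ?_
    gcongr
  induction t using DirectSum.induction_on with
  | zero => exact ⟨0, fun N => by simp⟩
  | of n t =>
    refine ⟨n, fun N => ?_⟩
    change toLin (power a N) (DirectSum.lof R ℕ (fun n => ⨂[R]^n V) n t) ∈ _
    rw [toLin, DirectSum.toModule_lof]
    induction t using PiTensorProduct.induction_on with
    | smul_tprod r x =>
      rw [map_smul, PiTensorProduct.lift.tprod]
      exact Submodule.smul_mem _ _ (power_mem_energy a l h N n x)
    | add t t' ht ht' =>
      rw [map_add]
      exact Submodule.add_mem _ ht ht'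
  | add t t' ht ht' =>
    obtain ⟨D, hD⟩ := ht
    obtain ⟨D', hD'⟩ := ht'
    refine ⟨max D D', fun N => ?_⟩
    rw [map_add]
    exact Submodule.add_mem _ (key _ _ N (le_max_left _ _) (hD N))
      (key _ _ N (le_max_right _ _) (hD' N))

/-- The sum `∑_N aᴺ` of all convolution powers, for `a 0` of positive energy:
`x₁ ⊗ ⋯ ⊗ xₖ ↦ ∑_N ∑_{k₁ + ⋯ + k_N = k} a_{k₁} (x₁, …) ⊗ ⋯ ⊗ a_{k_N} (…, xₖ)`. -/
def sumPowers (a : BarSeries R V W)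
    (h : ∃ l > 0, ∀ x, a 0 x ∈ Nov.energy R (TensorSum R W) l) :
    TensorSum R V →ₗ[R] Bar R W :=
  Nov.sumMap (fun N => toLin (power a N)) (by
    obtain ⟨l, hl, h⟩ := h
    intro t E
    obtain ⟨D, hD⟩ := toLin_power_mem_energy a l h t
    obtain ⟨K, hK⟩ := exists_nat_gt (E / l)
    refine ⟨D + K, fun n hn g hg => ?_⟩
    by_contra h'
    refine absurd ((hD n g h').trans hg) (not_le.2 ?_)
    rw [div_lt_iff₀ hl] at hK
    refine hK.trans_le ?_
    gcongr
    omega)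

end BarSeries

end Tensor

/-! ## Koszul signs and degrees -/

section Graded

variable {R V : Type*} [CommRing R] [AddCommGroup V] [Module R V]
  (𝒱 : ℤ → Submodule R V) [DirectSum.Decomposition 𝒱]

/-- The projection of `V` to the sum of the parts `𝒱 d` with `d - 1 ≡ b` modulo `2`: here
`d - 1` is the shifted degree, that is, the degree in `V[1]`. -/
def parityProj (b : ZMod 2) : V →ₗ[R] V :=
  DirectSum.toModule R ℤ V
      (fun d => if ((d - 1 : ℤ) : ZMod 2) = b then (𝒱 d).subtype else 0) ∘ₗ
    (DirectSum.decomposeLinearEquiv 𝒱).toLinearMap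

/-- The map `x ↦ (-1) ^ |x|' x`, where `|x|'` is the shifted degree. -/
def shiftSign : V →ₗ[R] V := parityProj 𝒱 0 - parityProj 𝒱 1

/-- The Koszul sign of `x₁ ⊗ ⋯ ⊗ xₙ ↦ x_{σ 1} ⊗ ⋯ ⊗ x_{σ n}` when `xᵢ` has parity `b i`. -/
def koszulSign {n : ℕ} (σ : Equiv.Perm (Fin n)) (b : Fin n → ZMod 2) : ℤ :=
  ∏ i : Fin n, ∏ j : Fin n,
    if i < j ∧ σ j < σ i ∧ b (σ i) = 1 ∧ b (σ j) = 1 then -1 else 1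

/-- The action of `σ` on `V[1] ⊗ ⋯ ⊗ V[1]`: for homogeneous `xᵢ`, the tensor `x₁ ⊗ ⋯ ⊗ xₙ` goes
to `± x_{σ 1} ⊗ ⋯ ⊗ x_{σ n}`, where `±` is the product of `(-1) ^ (|x_{σ i}|' |x_{σ j}|')` over all
`i < j` with `σ i > σ j`. -/
def koszulPerm {n : ℕ} (σ : Equiv.Perm (Fin n)) : (⨂[R]^n V) →ₗ[R] ⨂[R]^n V :=
  ∑ b : Fin n → ZMod 2, (koszulSign σ b : R) •
    PiTensorProduct.lift
      (((PiTensorProduct.tprod R).compLinearMap fun i => parityProj 𝒱 (b (σ i))).domDomCongr σ)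

/-- Tensors whose components are fixed by the cyclic permutations
`x₁ ⊗ ⋯ ⊗ xₙ ↦ ± x₂ ⊗ ⋯ ⊗ xₙ ⊗ x₁`. -/
def cyclicTensors : Submodule R (TensorSum R V) where
  carrier := {t | ∀ n, koszulPerm 𝒱 (finRotate n) (t n) = t n}
  zero_mem' := fun n => by simp
  add_mem' := fun {s t} hs ht n => by simp [hs n, ht n]
  smul_mem' := fun r t ht n => by rw [DirectSum.smul_apply, map_smul, ht n]

/-- Tensors whose components are fixed by all permutations. -/
def symmetricTensors : Submodule R (TensorSum R V) where
  carrier := {t | ∀ n, ∀ σ : Equiv.Perm (Fin n), koszulPerm 𝒱 σ (t n) = t n}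
  zero_mem' := fun n σ => by simp
  add_mem' := fun {s t} hs ht n σ => by simp [hs n σ, ht n σ]
  smul_mem' := fun r t ht n σ => by rw [DirectSum.smul_apply, map_smul, ht n σ]

/-- The completed cyclic bar construction `B̂ᶜʸᶜC`. -/
def cyclicBar : Submodule (NovRing R) (Bar R V) := Nov.coeffsIn (cyclicTensors 𝒱)

/-- The completed symmetric bar construction `ÊC`. -/
def symmetricBar : Submodule (NovRing R) (Bar R V) := Nov.coeffsIn (symmetricTensors 𝒱)

end Graded

section Degree

variable {R V : Type*} [CommRing R] [AddCommGroup V] [Module R V] (𝒱 : ℤ → Submodule R V)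

/-- The degree `p` part of `⨁ₙ V[1] ⊗ ⋯ ⊗ V[1]`. -/
def tensorDegree (p : ℤ) : Submodule R (TensorSum R V) :=
  Submodule.span R {t | ∃ (n : ℕ) (d : Fin n → ℤ) (x : Fin n → V),
    (∀ i, x i ∈ 𝒱 (d i)) ∧ ∑ i, (d i - 1) = p ∧ t = tensorOf n x}

/-- The degree `p` part of `B̂C`. -/
def barDegree (p : ℤ) : Submodule R (Bar R V) := Nov.degreePart (tensorDegree 𝒱) p

end Degree

/-! ## Cohomology -/

section Cohomology

variable {S M M' : Type*} [Ring S] [AddCommGroup M] [Module S M] [AddCommGroup M'] [Module S M']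

/-- `(B ∩ ker d) / d(A)`: the cohomology at `B` of `A → B → ⋯`. For a subcomplex `A = B` of an
ungraded complex it is the total cohomology of the subcomplex. -/
abbrev CohomologyAt (d : M →ₗ[S] M) (A B : Submodule S M) : Type _ :=
  ↥(B ⊓ LinearMap.ker d) ⧸ (A.map d).submoduleOf (B ⊓ LinearMap.ker d)

/-- The map `f` induces a well-defined map `(B ∩ ker d) / d(A) → (B' ∩ ker d') / d'(A')`,
and this map is an isomorphism. -/
def InducesIsoAt (d : M →ₗ[S] M) (A B : Submodule S M) (d' : M' →ₗ[S] M') (A' B' : Submodule S M')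
    (f : M →ₗ[S] M') : Prop :=
  ∃ (h : ∀ x ∈ B ⊓ LinearMap.ker d, f x ∈ B' ⊓ LinearMap.ker d')
    (h' : (A.map d).submoduleOf (B ⊓ LinearMap.ker d) ≤
      ((A'.map d').submoduleOf (B' ⊓ LinearMap.ker d')).comap (f.restrict h)),
    Function.Bijective
      (Submodule.mapQ _ _ (f.restrict h) h' : CohomologyAt d A B →ₗ[S] CohomologyAt d' A' B')

end Cohomology

/-! ## Filtered `A_∞`-algebras and homomorphisms -/

section AInfinity

variable {R V W : Type*} [CommRing R] [AddCommGroup V] [Module R V] [AddCommGroup W] [Module R W]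

variable (R V W) in
/-- A family of `Λ₀`-multilinear maps `φₖ : C₁ ^ k → C₂`, for `k = 0, 1, …`, where
`C₁ = Nov R V` and `C₂ = Nov R W`. -/
abbrev NovFamily : Type _ :=
  ∀ k : ℕ, MultilinearMap (NovRing R) (fun _ : Fin k => Nov R V) (Nov R W)

namespace NovFamily

/-- The restriction of `φₖ` to `V ^ k`, as an `R`-multilinear map. -/
def restrict (φ : NovFamily R V W) (k : ℕ) : MultilinearMap R (fun _ : Fin k => V) (Nov R W) :=
  ((φ k).restrictScalars R).compLinearMap fun _ => Nov.const

/-- The restrictions, with values viewed as tensors of length one. -/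
def toBarSeries (φ : NovFamily R V W) : BarSeries R V W := fun k =>
  (Nov.map tensorOne).compMultilinearMap (φ.restrict k)

/-- Each `φₖ` respects the energy filtration. -/
def PreservesEnergy (φ : NovFamily R V W) : Prop :=
  ∀ (k : ℕ) (l : Fin k → ℝ≥0) (x : Fin k → Nov R V),
    (∀ i, x i ∈ Nov.energy R V (l i)) → φ k x ∈ Nov.energy R W (∑ i, l i)

/-- `φₖ (C₁ ^ {p₁}, …, C₁ ^ {pₖ}) ⊆ C₂ ^ {p₁ + ⋯ + pₖ + c - k}`. -/
def HasDegree (𝒱 : ℤ → Submodule R V) (𝒲 : ℤ → Submodule R W) (φ : NovFamily R V W) (c : ℤ) :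
    Prop :=
  ∀ (k : ℕ) (p : Fin k → ℤ) (x : Fin k → Nov R V),
    (∀ i, x i ∈ Nov.degreePart 𝒱 (p i)) → φ k x ∈ Nov.degreePart 𝒲 (∑ i, p i + c - k)

/-- `φ₀ (1)` has positive energy. -/
def PositiveAtZero (φ : NovFamily R V W) : Prop := ∃ l > 0, φ 0 ![] ∈ Nov.energy R W l

/-- Modulo positive energy, each `φₖ` is induced from a map `V ^ k → W`: no power of `e` occurs. -/
def IsReducible (φ : NovFamily R V W) : Prop :=
  ∀ (k : ℕ) (x : Fin k → V) (q : ℤ), q ≠ 0 → (φ.restrict k x).coeff (0, q) = 0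

/-- The reduction `φ̄₁ : V → W` of `φ₁` modulo positive energy. -/
def reductionOne (φ : NovFamily R V W) : V →ₗ[R] W where
  toFun v := (φ.restrict 1 fun _ => v).coeff 0
  map_add' v v' := by
    rw [← Nov.coeff_add]
    exact congrArg (fun y => Nov.coeff y 0)
      (((MultilinearMap.ofSubsingleton R V (Nov R W) (0 : Fin 1)).symm (φ.restrict 1)).map_add v v')
  map_smul' r v := by
    rw [RingHom.id_apply, ← Nov.coeff_smul]
    exact congrArg (fun y => Nov.coeff y 0)
      (((MultilinearMap.ofSubsingleton R V (Nov R W) (0 : Fin 1)).symm (φ.restrict 1)).map_smul r v)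

theorem PositiveAtZero.toBarSeries {φ : NovFamily R V W} (h : φ.PositiveAtZero) :
    ∃ l > 0, ∀ x, φ.toBarSeries 0 x ∈ Nov.energy R (TensorSum R W) l := by
  obtain ⟨l, hl, h⟩ := h
  refine ⟨l, hl, fun x => Nov.map_mem_energy _ ?_⟩
  have : φ.restrict 0 x = φ 0 ![] := congrArg (φ 0) (Subsingleton.elim _ _)
  rwa [this]

end NovFamily

/-- The conditions on a submonoid `G` of `ℝ≥0 × 2ℤ` in the gapped condition: its energies are
discrete, `(0, 0)` is its only element of energy zero, and there are finitely many elements of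
each energy. -/
structure IsGapMonoid (G : AddSubmonoid (ℝ≥0 × ℤ)) : Prop where
  even : ∀ β ∈ G, Even β.2
  discrete : ∀ E : ℝ≥0, {l : ℝ≥0 | l ≤ E ∧ ∃ μ : ℤ, (l, μ) ∈ G}.Finite
  eq_zero : ∀ μ : ℤ, ((0 : ℝ≥0), μ) ∈ G → μ = 0
  finite : ∀ l : ℝ≥0, {μ : ℤ | (l, μ) ∈ G}.Finite

/-- `φₖ = ∑_{β = (l, μ) ∈ G} T ^ l e ^ (μ / 2) φ_{k, β}` for `R`-multilinear maps
`φ_{k, β} : V ^ k → W` and a submonoid `G` as above. -/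
def NovFamily.IsGapped (φ : NovFamily R V W) : Prop :=
  ∃ G : AddSubmonoid (ℝ≥0 × ℤ), IsGapMonoid G ∧
    ∃ φβ : ∀ k : ℕ, ℝ≥0 × ℤ → MultilinearMap R (fun _ : Fin k => V) W,
      ∀ (k : ℕ) (x : Fin k → V) (l : ℝ≥0) (q : ℤ),
        ((l, 2 * q) ∈ G → (φ.restrict k x).coeff (l, q) = φβ k (l, 2 * q) x) ∧
        ((l, 2 * q) ∉ G → (φ.restrict k x).coeff (l, q) = 0)

/-- The coderivation `d̂ = ∑ₖ m̂ₖ` of `B̂C`: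
`x₁ ⊗ ⋯ ⊗ xₙ ↦ ∑ (-1) ^ (|x₁|' + ⋯ + |xᵢ|') x₁ ⊗ ⋯ ⊗ xᵢ ⊗ mₖ (x_{i+1}, …, x_{i+k}) ⊗ ⋯ ⊗ xₙ`. -/
def barDifferential (𝒱 : ℤ → Submodule R V) [DirectSum.Decomposition 𝒱] (m : NovFamily R V V) :
    Bar R V →ₗ[NovRing R] Bar R V :=
  Nov.lift (BarSeries.toLin (BarSeries.conv
    (fun n => Nov.const.compMultilinearMap ((tensorOf n).compLinearMap fun _ => shiftSign 𝒱))
    (BarSeries.conv m.toBarSeries fun n => Nov.const.compMultilinearMap (tensorOf n))))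

/-- The coalgebra map `f̂` on completed bar constructions:
`x₁ ⊗ ⋯ ⊗ xₖ ↦ ∑ f_{k₁} (x₁, …, x_{k₁}) ⊗ ⋯ ⊗ f_{k_N} (…, xₖ)`, summed over all `N ≥ 0` and all
`k₁, …, k_N ≥ 0` with sum `k`. -/
def barMap (f : NovFamily R V W) (hf : f.PositiveAtZero) : Bar R V →ₗ[NovRing R] Bar R W :=
  Nov.lift (BarSeries.sumPowers f.toBarSeries hf.toBarSeries)

/-- A filtered `A_∞`-algebra structure `m₀, m₁, m₂, …` on the completed free graded `Λ₀`-module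
`C = Nov R V`, for a graded `R`-module `V`. The `A_∞`-equations are `d̂ ∘ d̂ = 0`. -/
structure FilteredAInfAlgebra (𝒱 : ℤ → Submodule R V) [DirectSum.Decomposition 𝒱] where
  m : NovFamily R V V
  energy : m.PreservesEnergy
  degree : m.HasDegree 𝒱 𝒱 2
  positive : m.PositiveAtZero
  reducible : m.IsReducible
  d_comp_d : barDifferential 𝒱 m ∘ₗ barDifferential 𝒱 m = 0

section Hom

variable {𝒱 : ℤ → Submodule R V} [DirectSum.Decomposition 𝒱]
  {𝒲 : ℤ → Submodule R W} [DirectSum.Decomposition 𝒲]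

/-- The codifferential `d̂` of the bar complex. -/
def FilteredAInfAlgebra.d (C : FilteredAInfAlgebra 𝒱) : Bar R V →ₗ[NovRing R] Bar R V :=
  barDifferential 𝒱 C.m

/-- A filtered `A_∞`-homomorphism `f₀, f₁, f₂, …`. -/
structure FilteredAInfHom (C₁ : FilteredAInfAlgebra 𝒱) (C₂ : FilteredAInfAlgebra 𝒲) where
  f : NovFamily R V W
  energy : f.PreservesEnergy
  degree : f.HasDegree 𝒱 𝒲 1
  positive : f.PositiveAtZero
  reducible : f.IsReducible
  comm : C₂.d ∘ₗ barMap f positive = barMap f positive ∘ₗ C₁.d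

namespace FilteredAInfHom

variable {C₁ : FilteredAInfAlgebra 𝒱} {C₂ : FilteredAInfAlgebra 𝒲}

/-- The induced chain map `f̂` of bar complexes. -/
def hat (f : FilteredAInfHom C₁ C₂) : Bar R V →ₗ[NovRing R] Bar R W := barMap f.f f.positive

/-- `f̄₁` induces an isomorphism on the cohomology of `m̄₁`. -/
def IsQuasiIso (f : FilteredAInfHom C₁ C₂) : Prop :=
  InducesIsoAt C₁.m.reductionOne ⊤ ⊤ C₂.m.reductionOne ⊤ ⊤ f.f.reductionOne

/-- `S₁` and `S₂` are subcomplexes of the bar complexes, `f̂` maps `S₁` to `S₂`, and it induces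
an isomorphism of `Λ₀`-modules on their total cohomologies, and an isomorphism in each degree. -/
def InducesIsoOn (f : FilteredAInfHom C₁ C₂) (S₁ : Submodule (NovRing R) (Bar R V))
    (S₂ : Submodule (NovRing R) (Bar R W)) : Prop :=
  (∀ x ∈ S₁, C₁.d x ∈ S₁) ∧ (∀ y ∈ S₂, C₂.d y ∈ S₂) ∧ (∀ x ∈ S₁, f.hat x ∈ S₂) ∧
  InducesIsoAt C₁.d S₁ S₁ C₂.d S₂ S₂ f.hat ∧
  ∀ p : ℤ, InducesIsoAt
    (C₁.d.restrictScalars R)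
    (S₁.restrictScalars R ⊓ barDegree 𝒱 (p - 1)) (S₁.restrictScalars R ⊓ barDegree 𝒱 p)
    (C₂.d.restrictScalars R)
    (S₂.restrictScalars R ⊓ barDegree 𝒲 (p - 1)) (S₂.restrictScalars R ⊓ barDegree 𝒲 p)
    (f.hat.restrictScalars R)

end FilteredAInfHom

end Hom

end AInfinity

end

/-!
The uncompleted bar construction is the tensor coalgebra `T(V)`. Both `d̂` and `f̂` are determined
by their restrictions to `T(V)`: the coefficients of `d̂` are coderivations
(`tensorDifferential_coeff`, `TensorSum.comul_coderivation`), and `f̂` is the coalgebra map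
`T(V) → T(W)[[T, e]]` that solves the fixed point equation `f̂ = 1 + f * f̂`
(`BarSeries.sumPowers_eq`, `map_comul_tensorMap`).

*Subcomplexes.* Cyclic tensors are those with `Δ t` fixed by the graded swap of `T(V) ⊗ T(V)`, and
symmetric tensors those with `Δ₃ t` fixed by the graded swap of the first two factors
(`TensorSum.cyclicTensors_eq`, `TensorSum.symmetricTensors_eq`): the exchanges of an initial and a
final block of letters are the rotations, and the exchanges of two adjacent initial blocks generate
the symmetric group. As coderivations of odd degree and coalgebra maps of degree `0` are compatible
with `Δ` and with swaps, they respect these conditions.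

*Exactness.* The isomorphisms follow from the exactness of the mapping cone of `f̂` restricted to
the series of invariant tensors. The invariants of the groups `1`, `ℤ / n` and `Sₙ` are treated
together, as `TensorSum.fixedTensors`.
- Over a field, `f̄₁` has an inverse up to homotopies that are compatible with the parity
  (`exists_homotopyInverse`). The homotopies extend to the tensor coalgebra, where `m̄₁` acts by the
  coderivation `TensorSum.linearCoderivation` and `f̄₁` by `TensorSum.map`; averaging, in
  characteristic zero, gives exactness on invariant tensors (`isExactOn_cone_map`).
- Modulo shorter tensors, the energy zero parts of `d̂` and `f̂` agree with these maps, since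
  `m̄₀ = 0` and `f̄₀ = 0`. Induction on the length shows that the cone of the energy zero parts is
  exact (`IsExactOn.of_filtration`, `isExactOn_cone_of_leading`).
- Gappedness yields `l > 0` such that all other terms raise the energy by at least `l`. Cancelling a
  cycle modulo energies `0, l, 2 l, …` gives a convergent series (`Nov.isExactOn_lift`,
  `Nov.isExactOn_cone`).

The statement in each degree follows by applying the projections to the parts of a given degree,
with which `d̂` and `f̂` commute (`TensorSum.HasTensorDegree.lift_barProj`).
-/

noncomputable section

/-! ### Words and recursion on the tensor algebra -/

namespace TensorSum

variable {R V W : Type*} [CommRing R] [AddCommGroup V] [Module R V] [AddCommGroup W] [Module R W]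

-- Direct instances, since the unfolding of `TensorSum` is expensive.
instance : AddCommGroup (TensorSum R V) := inferInstance

instance : AddCommGroup (TensorSum R V ⊗[R] TensorSum R V) := TensorProduct.addCommGroup

instance : AddCommGroup ((TensorSum R V ⊗[R] TensorSum R V) ⊗[R] TensorSum R V) :=
  TensorProduct.addCommGroup

variable (R) in
/-- The tensor `x₁ ⊗ ⋯ ⊗ xₙ` of a list `[x₁, …, xₙ]`, as a product of tensors of length one. -/
def word (l : List V) : TensorSum R V := (l.map (tensorOne (R := R))).prod

@[simp] theorem word_nil : word R ([] : List V) = 1 := rfl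

@[simp] theorem word_cons (v : V) (l : List V) : word R (v :: l) = tensorOne v * word R l := rfl

theorem word_append (l l' : List V) : word R (l ++ l') = word R l * word R l' := by
  simp [word]

theorem tensorOne_eq (v : V) :
    (tensorOne v : TensorSum R V) =
      DirectSum.of (fun n => ⨂[R]^n V) 1 (PiTensorProduct.tprod R fun _ : Fin 1 => v) := by
  simp only [tensorOne, LinearMap.comp_apply]
  rw [DirectSum.lof_eq_of]
  congr 1
  rw [LinearEquiv.coe_coe, LinearEquiv.symm_apply_eq, PiTensorProduct.subsingletonEquiv_apply_tprod]

theorem toDirectSum_ι (v : V) :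
    TensorAlgebra.toDirectSum (TensorAlgebra.ι R v) = (tensorOne v : TensorSum R V) := by
  rw [TensorAlgebra.toDirectSum_ι, tensorOne_eq]

theorem tensorOf_eq_word (n : ℕ) (x : Fin n → V) : tensorOf n x = word R (List.ofFn x) := by
  have h := TensorAlgebra.toDirectSum_tensorPower_tprod (R := R) x
  rw [TensorAlgebra.tprod_apply, map_list_prod, List.map_ofFn] at h
  change DirectSum.lof R ℕ (fun n => ⨂[R]^n V) n (PiTensorProduct.tprod R x) = _
  rw [DirectSum.lof_eq_of, ← h, word, List.map_ofFn]
  congr 2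
  funext i
  exact toDirectSum_ι _

theorem word_eq_tensorOf (l : List V) : word R l = tensorOf l.length l.get := by
  rw [tensorOf_eq_word, List.ofFn_get]

/-- A submodule that contains `1` and is stable under multiplication from the left by the letters
of a spanning set is everything. -/
theorem eq_top_of_mul_mem {X : Set V} (hX : Submodule.span R X = ⊤)
    (p : Submodule R (TensorSum R V)) (h1 : (1 : TensorSum R V) ∈ p)
    (hmul : ∀ v ∈ X, ∀ t ∈ p, tensorOne v * t ∈ p) : p = ⊤ := by
  have hmul' : ∀ v, ∀ t ∈ p, tensorOne v * t ∈ p := by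
    intro v t ht
    have hv : v ∈ Submodule.span R X := hX ▸ Submodule.mem_top
    induction hv using Submodule.span_induction with
    | mem v hv => exact hmul v hv t ht
    | zero => simp
    | add v w _ _ hv hw => rw [map_add, add_mul]; exact p.add_mem hv hw
    | smul r v _ hv => rw [map_smul, smul_mul_assoc]; exact p.smul_mem r hv
  have hw : ∀ l : List V, word R l ∈ p := by
    intro l
    induction l with
    | nil => exact h1
    | cons v l ih => exact hmul' v _ ih
  rw [eq_top_iff]
  rintro t -
  induction t using DirectSum.induction_on with
  | zero => exact p.zero_mem
  | add s t hs ht => exact p.add_mem hs ht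
  | of n t =>
    rw [← DirectSum.lof_eq_of R]
    induction t using PiTensorProduct.induction_on with
    | smul_tprod r x =>
      rw [map_smul]
      refine p.smul_mem r ?_
      have := hw (List.ofFn x)
      rwa [← tensorOf_eq_word] at this
    | add s t hs ht => rw [map_add]; exact p.add_mem hs ht

/-- The words in the letters of a spanning set span the tensor algebra. -/
theorem span_word {X : Set V} (hX : Submodule.span R X = ⊤) :
    Submodule.span R {t : TensorSum R V | ∃ l : List V, (∀ v ∈ l, v ∈ X) ∧ t = word R l} = ⊤ := by
  refine eq_top_of_mul_mem hX _ (Submodule.subset_span ⟨[], by simp, rfl⟩) ?_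
  intro v hv t ht
  induction ht using Submodule.span_induction with
  | mem t ht =>
    obtain ⟨l, hl, rfl⟩ := ht
    refine Submodule.subset_span ⟨v :: l, ?_, rfl⟩
    simpa using ⟨hv, hl⟩
  | zero => simp
  | add s t _ _ hs ht => rw [mul_add]; exact Submodule.add_mem _ hs ht
  | smul r t _ ht => rw [mul_smul_comm]; exact Submodule.smul_mem _ r ht

theorem ext_word_of_span {Y : Type*} [AddCommMonoid Y] [Module R Y] {X : Set V}
    (hX : Submodule.span R X = ⊤) {A B : TensorSum R V →ₗ[R] Y}
    (h : ∀ l : List V, (∀ v ∈ l, v ∈ X) → A (word R l) = B (word R l)) : A = B := by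
  refine LinearMap.ext_on (span_word hX) ?_
  rintro _ ⟨l, hl, rfl⟩
  exact h l hl

theorem ext_word {Y : Type*} [AddCommMonoid Y] [Module R Y] {A B : TensorSum R V →ₗ[R] Y}
    (h : ∀ l : List V, A (word R l) = B (word R l)) : A = B :=
  ext_word_of_span (X := Set.univ) (by simp) fun l _ => h l

/-- Two linear maps on the tensor algebra agree if they agree at `1` and if an agreement at `t`
implies one at `v ⊗ t`, for all letters `v`. -/
theorem ext_rec {Y : Type*} [AddCommMonoid Y] [Module R Y] {A B : TensorSum R V →ₗ[R] Y}
    (h1 : A 1 = B 1)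
    (hmul : ∀ v t, A t = B t → A (tensorOne v * t) = B (tensorOne v * t)) : A = B := by
  refine ext_word fun l => ?_
  induction l with
  | nil => exact h1
  | cons v l ih => exact hmul v _ ih

section Fold

variable {Y : Type*} [AddCommGroup Y] [Module R Y]

/-- The linear map given by the recursion `fold 1 = y₀` and `fold (v ⊗ t) = step v (fold t)`. -/
def fold (step : V →ₗ[R] Y →ₗ[R] Y) (y₀ : Y) : TensorSum R V →ₗ[R] Y :=
  (LinearMap.applyₗ (R := R) y₀ ∘ₗ
    (TensorAlgebra.lift R (A := Module.End R Y) step).toLinearMap) ∘ₗ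
    TensorAlgebra.ofDirectSum.toLinearMap

theorem ofDirectSum_tensorOne (v : V) :
    TensorAlgebra.ofDirectSum (tensorOne v : TensorSum R V) = TensorAlgebra.ι R v := by
  rw [← toDirectSum_ι, TensorAlgebra.ofDirectSum_toDirectSum]

@[simp] theorem fold_one (step : V →ₗ[R] Y →ₗ[R] Y) (y₀ : Y) :
    fold step y₀ (1 : TensorSum R V) = y₀ := by
  simp [fold]

@[simp] theorem fold_mul (step : V →ₗ[R] Y →ₗ[R] Y) (y₀ : Y) (v : V) (t : TensorSum R V) :
    fold step y₀ (tensorOne v * t) = step v (fold step y₀ t) := by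
  simp [fold, ofDirectSum_tensorOne]

end Fold

/-- The algebra map `x₁ ⊗ ⋯ ⊗ xₙ ↦ h x₁ ⊗ ⋯ ⊗ h xₙ`. -/
def map (h : V →ₗ[R] W) : TensorSum R V →ₗ[R] TensorSum R W :=
  fold (LinearMap.mul R (TensorSum R W) ∘ₗ tensorOne ∘ₗ h) 1

@[simp] theorem map_one (h : V →ₗ[R] W) : map h (1 : TensorSum R V) = 1 := by simp [map]

@[simp] theorem map_cons (h : V →ₗ[R] W) (v : V) (t : TensorSum R V) :
    map h (tensorOne v * t) = tensorOne (h v) * map h t := by simp [map]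

@[simp] theorem map_word (h : V →ₗ[R] W) (l : List V) :
    map h (word R l) = word R (l.map h) := by
  induction l with
  | nil => simp
  | cons v l ih => simp [ih]

theorem map_map {U : Type*} [AddCommGroup U] [Module R U] (h : V →ₗ[R] W) (k : W →ₗ[R] U)
    (t : TensorSum R V) : map k (map h t) = map (k ∘ₗ h) t := by
  have : map k ∘ₗ map h = map (k ∘ₗ h) := ext_rec (by simp) fun v t ht => by
    simp only [LinearMap.comp_apply] at ht ⊢
    simp [ht]
  exact LinearMap.congr_fun this t

theorem map_id (t : TensorSum R V) : map LinearMap.id t = t := by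
  have : map (LinearMap.id : V →ₗ[R] V) = LinearMap.id := ext_rec (by simp) fun v t ht => by
    rw [map_cons, ht]; rfl
  exact LinearMap.congr_fun this t

/-! ### Tensor length -/

variable (R V) in
/-- The projection to the tensors of length `n`. -/
def proj (n : ℕ) : TensorSum R V →ₗ[R] TensorSum R V :=
  DirectSum.lof R ℕ (fun n => ⨂[R]^n V) n ∘ₗ DirectSum.component R ℕ (fun n => ⨂[R]^n V) n

theorem proj_apply (n : ℕ) (t : TensorSum R V) :
    proj R V n t = DirectSum.lof R ℕ (fun n => ⨂[R]^n V) n (t n) := rfl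

theorem proj_lof (n m : ℕ) (t : ⨂[R]^m V) :
    proj R V n (DirectSum.lof R ℕ (fun n => ⨂[R]^n V) m t) =
      if n = m then DirectSum.lof R ℕ (fun n => ⨂[R]^n V) m t else 0 := by
  rw [proj_apply]
  split_ifs with h
  · subst h
    rw [DirectSum.lof_apply]
  · have : (DirectSum.lof R ℕ (fun n => ⨂[R]^n V) m t) n = 0 := by
      rw [DirectSum.lof_eq_of]
      exact DirectSum.of_eq_of_ne _ _ _ h
    rw [this, map_zero]

@[simp] theorem proj_word (n : ℕ) (l : List V) :
    proj R V n (word R l) = if n = l.length then word R l else 0 := by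
  rw [word_eq_tensorOf]
  exact proj_lof _ _ _

theorem proj_proj (n m : ℕ) (t : TensorSum R V) :
    proj R V n (proj R V m t) = if n = m then proj R V m t else 0 := by
  rw [proj_apply m, proj_lof]

theorem proj_apply_apply (n m : ℕ) (t : TensorSum R V) :
    proj R V n t m = if m = n then t m else 0 := by
  rw [proj_apply]
  split_ifs with h
  · subst h
    rw [DirectSum.lof_apply]
  · rw [DirectSum.lof_eq_of, DirectSum.of_eq_of_ne _ _ _ h]

theorem ext_proj {s t : TensorSum R V} (h : ∀ n, proj R V n s = proj R V n t) : s = t := by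
  refine DFinsupp.ext fun n => ?_
  have := congrArg (fun u : TensorSum R V => u n) (h n)
  simpa [proj_apply_apply] using this

/-- A tensor has only finitely many nonzero components. -/
theorem exists_forall_proj_eq_zero (t : TensorSum R V) :
    ∃ N : ℕ, ∀ n, N ≤ n → proj R V n t = 0 := by
  induction t using DirectSum.induction_on with
  | zero => exact ⟨0, by simp⟩
  | of m t =>
    refine ⟨m + 1, fun n hn => ?_⟩
    rw [← DirectSum.lof_eq_of R, proj_lof, if_neg (by omega)]
  | add s t hs ht =>
    obtain ⟨N, hN⟩ := hs
    obtain ⟨M, hM⟩ := ht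
    refine ⟨max N M, fun n hn => ?_⟩
    rw [map_add, hN n (le_trans (le_max_left _ _) hn), hM n (le_trans (le_max_right _ _) hn),
      add_zero]

theorem eq_sum_proj {t : TensorSum R V} {N : ℕ} (h : ∀ n, N ≤ n → proj R V n t = 0) :
    t = ∑ n ∈ Finset.range N, proj R V n t := by
  refine ext_proj fun m => ?_
  rw [map_sum]
  simp only [proj_proj]
  rw [Finset.sum_ite_eq (Finset.range N) m]
  split_ifs with hm
  · rfl
  · exact h m (by simpa using hm)

/-- A linear map that preserves the length of words commutes with the projections to tensors of a
given length. -/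
theorem proj_commute {A : TensorSum R V →ₗ[R] TensorSum R W}
    (h : ∀ l : List V, proj R W l.length (A (word R l)) = A (word R l)) (n : ℕ)
    (t : TensorSum R V) : proj R W n (A t) = A (proj R V n t) := by
  have : proj R W n ∘ₗ A = A ∘ₗ proj R V n := ext_word fun l => by
    simp only [LinearMap.comp_apply, proj_word]
    rw [← h l, proj_proj]
    split_ifs <;> simp [h]
  exact LinearMap.congr_fun this t

theorem proj_map (h : V →ₗ[R] W) (n : ℕ) (t : TensorSum R V) :
    proj R W n (map h t) = map h (proj R V n t) :=
  proj_commute (fun l => by simp) n t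

end TensorSum

/-! ### Convolution of Novikov series -/

namespace Nov

variable {R : Type*} [CommRing R]
variable {M N P Q M' N' P' : Type*} [AddCommGroup M] [Module R M] [AddCommGroup N] [Module R N]
  [AddCommGroup P] [Module R P] [AddCommGroup Q] [Module R Q] [AddCommGroup M'] [Module R M']
  [AddCommGroup N'] [Module R N'] [AddCommGroup P'] [Module R P']

variable (R M) in
/-- The coefficient of `T ^ l e ^ q`, for `g = (l, q)`, as a linear map. -/
def coeffHom (g : NovExp) : Nov R M →ₗ[R] M where
  toFun x := x.coeff g
  map_add' _ _ := rfl
  map_smul' _ _ := rfl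

@[simp] theorem coeffHom_apply (g : NovExp) (x : Nov R M) : coeffHom R M g x = x.coeff g := rfl

@[simp] theorem coeff_sum {ι : Type*} (s : Finset ι) (x : ι → Nov R M) (g : NovExp) :
    (∑ i ∈ s, x i).coeff g = ∑ i ∈ s, (x i).coeff g :=
  map_sum (coeffHom R M g) x s

@[simp] theorem coeff_sub (x y : Nov R M) (g : NovExp) :
    (x - y).coeff g = x.coeff g - y.coeff g := map_sub (coeffHom R M g) x y

theorem map_const (h : M →ₗ[R] N) (v : M) : map h (const v : Nov R M) = const (h v) := by
  ext g
  simp only [coeff_map, coeff_const]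
  split_ifs <;> simp

theorem coeff_conv_eq (μ : M →ₗ[R] N →ₗ[R] P) (x : Nov R M) (y : Nov R N) (g : NovExp)
    (S : Finset NovExp) (hS : x.supp g.1 ⊆ S) :
    (conv μ x y).coeff g = ∑ a ∈ S, if a.1 ≤ g.1 then μ (x.coeff a) (y.coeff (g - a)) else 0 :=
  coeff_liftR_eq _ x g S hS

theorem map_conv (μ : M →ₗ[R] N →ₗ[R] P) (h : P →ₗ[R] Q) (x : Nov R M) (y : Nov R N) :
    map h (conv μ x y) = conv (μ.compr₂ h) x y := by
  ext g
  simp [coeff_conv]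

theorem conv_map_left (μ : M →ₗ[R] N →ₗ[R] P) (h : M' →ₗ[R] M) (x : Nov R M') (y : Nov R N) :
    conv μ (map h x) y = conv (μ ∘ₗ h) x y := by
  ext g
  rw [coeff_conv_eq μ (map h x) y g (x.supp g.1), coeff_conv]
  · refine Finset.sum_congr rfl fun a ha => ?_
    rw [if_pos (mem_supp.1 ha).1]
    rfl
  · intro a ha
    rw [mem_supp] at ha ⊢
    refine ⟨ha.1, fun h0 => ha.2 ?_⟩
    simp [h0]

theorem conv_map_right (μ : M →ₗ[R] N →ₗ[R] P) (h : N' →ₗ[R] N) (x : Nov R M) (y : Nov R N') :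
    conv μ x (map h y) = conv (μ.compl₂ h) x y := rfl

theorem conv_add_bilin (μ ν : M →ₗ[R] N →ₗ[R] P) (x : Nov R M) (y : Nov R N) :
    conv (μ + ν) x y = conv μ x y + conv ν x y := by
  ext g
  simp [coeff_conv, Finset.sum_add_distrib]

theorem conv_const_left (μ : M →ₗ[R] N →ₗ[R] P) (v : M) (y : Nov R N) :
    conv μ (const v) y = map (μ v) y :=
  liftR_const _ v

theorem conv_const_right (μ : M →ₗ[R] N →ₗ[R] P) (x : Nov R M) (w : N) :
    conv μ x (const w) = map (μ.flip w) x := by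
  rw [conv_flip, conv_const_left]

theorem conv_assoc (μ : M →ₗ[R] N →ₗ[R] P) (ν : P →ₗ[R] Q →ₗ[R] P') (μ' : N →ₗ[R] Q →ₗ[R] N')
    (ν' : M →ₗ[R] N' →ₗ[R] P') (h : ∀ m n q, ν (μ m n) q = ν' m (μ' n q))
    (x : Nov R M) (y : Nov R N) (z : Nov R Q) :
    conv ν (conv μ x y) z = conv ν' x (conv μ' y z) := by
  refine (liftR_liftR _ _ x).trans ?_
  refine LinearMap.congr_fun (congrArg liftR (LinearMap.ext fun m => ?_)) x
  change conv ν (map (μ m) y) z = map (ν' m) (conv μ' y z)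
  have hm : ν ∘ₗ μ m = μ'.compr₂ (ν' m) := by
    ext n q
    exact h m n q
  rw [conv_map_left, map_conv, hm]

/-- The completed tensor product of two linear maps with values in Novikov series. -/
def tensorHat (A : M →ₗ[R] Nov R M') (B : N →ₗ[R] Nov R N') : M ⊗[R] N →ₗ[R] Nov R (M' ⊗[R] N') :=
  TensorProduct.lift ((conv (TensorProduct.mk R M' N')).compl₁₂ A B)

@[simp] theorem tensorHat_tmul (A : M →ₗ[R] Nov R M') (B : N →ₗ[R] Nov R N') (m : M) (n : N) :
    tensorHat A B (m ⊗ₜ n) = conv (TensorProduct.mk R M' N') (A m) (B n) := by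
  simp [tensorHat]

theorem map_tensorHat (h : M' →ₗ[R] P) (k : N' →ₗ[R] Q) (A : M →ₗ[R] Nov R M')
    (B : N →ₗ[R] Nov R N') :
    map (TensorProduct.map h k) ∘ₗ tensorHat A B = tensorHat (map h ∘ₗ A) (map k ∘ₗ B) := by
  refine TensorProduct.ext' fun m n => ?_
  simp only [LinearMap.comp_apply, tensorHat_tmul]
  rw [map_conv, conv_map_left, conv_map_right]
  congr 2

theorem tensorHat_comp_map (h : P →ₗ[R] M) (k : Q →ₗ[R] N) (A : M →ₗ[R] Nov R M')
    (B : N →ₗ[R] Nov R N') :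
    tensorHat A B ∘ₗ TensorProduct.map h k = tensorHat (A ∘ₗ h) (B ∘ₗ k) :=
  TensorProduct.ext' fun m n => by simp

theorem map_comm_tensorHat (A : M →ₗ[R] Nov R M') (B : N →ₗ[R] Nov R N') :
    map (TensorProduct.comm R M' N').toLinearMap ∘ₗ tensorHat A B =
      tensorHat B A ∘ₗ (TensorProduct.comm R M N).toLinearMap := by
  refine TensorProduct.ext' fun m n => ?_
  simp only [LinearMap.comp_apply, tensorHat_tmul, LinearEquiv.coe_coe, TensorProduct.comm_tmul]
  rw [map_conv, conv_flip]
  congr 2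

end Nov

/-! ### The deconcatenation coproduct -/

namespace TensorSum

variable {R V W : Type*} [CommRing R] [AddCommGroup V] [Module R V] [AddCommGroup W] [Module R W]

variable (R V) in
/-- The step `(t, z) ↦ (v ⊗ t, 1 ⊗ (v t) + (v ⊗ 1) z)` of the recursion for `comul`. -/
def comulStep : V →ₗ[R] (TensorSum R V × (TensorSum R V ⊗[R] TensorSum R V)) →ₗ[R]
    (TensorSum R V × (TensorSum R V ⊗[R] TensorSum R V)) :=
  LinearMap.mk₂ R (fun v y => (tensorOne v * y.1, 1 ⊗ₜ (tensorOne v * y.1) +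
      TensorProduct.map (LinearMap.mulLeft R (tensorOne v)) LinearMap.id y.2))
    (fun v w y => by
      ext1
      · simp [add_mul]
      · have : LinearMap.mulLeft R (tensorOne (v + w) : TensorSum R V) =
            LinearMap.mulLeft R (tensorOne v) + LinearMap.mulLeft R (tensorOne w) := by
          refine LinearMap.ext fun t => ?_
          rw [map_add]
          simp only [LinearMap.mulLeft_apply, LinearMap.add_apply, add_mul]
        simp only [Prod.snd_add]
        rw [this, TensorProduct.map_add_left, map_add, add_mul, TensorProduct.tmul_add,
          LinearMap.add_apply]
        abel)
    (fun r v y => by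
      ext1
      · simp
      · have : LinearMap.mulLeft R (tensorOne (r • v) : TensorSum R V) =
            r • LinearMap.mulLeft R (tensorOne v) := by
          refine LinearMap.ext fun t => ?_
          rw [map_smul]
          simp only [LinearMap.mulLeft_apply, LinearMap.smul_apply, smul_mul_assoc]
        simp only [Prod.smul_snd]
        rw [this, TensorProduct.map_smul_left, map_smul, smul_mul_assoc, TensorProduct.tmul_smul,
          LinearMap.smul_apply, smul_add])
    (fun v y z => by
      ext1
      · simp [mul_add]
      · simp only [Prod.snd_add, Prod.fst_add]
        rw [mul_add, TensorProduct.tmul_add, map_add]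
        abel)
    (fun r v y => by
      ext1
      · simp
      · simp only [Prod.smul_snd, Prod.smul_fst]
        rw [mul_smul_comm, TensorProduct.tmul_smul, map_smul, smul_add])

theorem comulStep_apply (v : V) (y : TensorSum R V × (TensorSum R V ⊗[R] TensorSum R V)) :
    comulStep R V v y = (tensorOne v * y.1, 1 ⊗ₜ (tensorOne v * y.1) +
      TensorProduct.map (LinearMap.mulLeft R (tensorOne v)) LinearMap.id y.2) := rfl

variable (R V) in
/-- The initial value of the recursion for `comul`. -/
abbrev comulInit : TensorSum R V × (TensorSum R V ⊗[R] TensorSum R V) := (1, 1 ⊗ₜ 1)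

/-- The deconcatenation coproduct
`x₁ ⊗ ⋯ ⊗ xₙ ↦ ∑ᵢ (x₁ ⊗ ⋯ ⊗ xᵢ) ⊗ (x_{i+1} ⊗ ⋯ ⊗ xₙ)`. -/
def comul : TensorSum R V →ₗ[R] TensorSum R V ⊗[R] TensorSum R V :=
  LinearMap.snd R (TensorSum R V) _ ∘ₗ fold (comulStep R V) (comulInit R V)

theorem fst_fold_comulStep (t : TensorSum R V) :
    (fold (comulStep R V) (comulInit R V) t).1 = t := by
  have : LinearMap.fst R (TensorSum R V) _ ∘ₗ fold (comulStep R V) (comulInit R V) =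
      LinearMap.id := by
    refine ext_rec (by simp) fun v t ht => ?_
    simp only [LinearMap.comp_apply, LinearMap.fst_apply, LinearMap.id_apply] at ht ⊢
    rw [fold_mul, comulStep_apply, ht]
  exact LinearMap.congr_fun this t

@[simp] theorem comul_one : comul (1 : TensorSum R V) = 1 ⊗ₜ 1 := by simp [comul]

theorem comul_cons (v : V) (t : TensorSum R V) :
    comul (tensorOne v * t) = 1 ⊗ₜ (tensorOne v * t) +
      TensorProduct.map (LinearMap.mulLeft R (tensorOne v)) LinearMap.id (comul t) := by
  simp only [comul, LinearMap.comp_apply, LinearMap.snd_apply, fold_mul]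
  rw [comulStep_apply, fst_fold_comulStep]

theorem comul_word (l : List V) :
    comul (word R l) =
      ∑ i ∈ Finset.range (l.length + 1), word R (l.take i) ⊗ₜ[R] word R (l.drop i) := by
  induction l with
  | nil => simp
  | cons v l ih =>
    rw [word_cons, comul_cons, ih, List.length_cons, Finset.sum_range_succ' _ (l.length + 1),
      map_sum, add_comm]
    simp

theorem comul_coassoc :
    (TensorProduct.assoc R (TensorSum R V) (TensorSum R V) (TensorSum R V)).toLinearMap ∘ₗ
      TensorProduct.map comul LinearMap.id ∘ₗ comul =
    TensorProduct.map LinearMap.id comul ∘ₗ comul := by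
  refine ext_rec (by simp) fun v t ht => ?_
  simp only [LinearMap.comp_apply] at ht ⊢
  rw [comul_cons, map_add, map_add, map_add]
  have h1 : (TensorProduct.assoc R _ _ _).toLinearMap
        (TensorProduct.map (comul (R := R) (V := V)) LinearMap.id
          (TensorProduct.map (LinearMap.mulLeft R (tensorOne v)) LinearMap.id (comul t))) =
      1 ⊗ₜ TensorProduct.map (LinearMap.mulLeft R (tensorOne v)) LinearMap.id (comul t) +
      TensorProduct.map (LinearMap.mulLeft R (tensorOne v)) LinearMap.id
        ((TensorProduct.assoc R _ _ _).toLinearMap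
          (TensorProduct.map comul LinearMap.id (comul t))) := by
    generalize comul t = z
    induction z using TensorProduct.induction_on with
    | zero => simp
    | add x y hx hy =>
      simp only [map_add, TensorProduct.tmul_add, hx, hy]
      abel
    | tmul a b =>
      simp only [TensorProduct.map_tmul, LinearMap.mulLeft_apply, LinearMap.id_apply, comul_cons,
        TensorProduct.add_tmul, map_add]
      congr 1
      generalize comul a = z
      induction z using TensorProduct.induction_on with
      | zero => simp
      | add x y hx hy => simp only [map_add, TensorProduct.add_tmul, hx, hy]
      | tmul c d => simp
  rw [h1, ht]
  simp only [TensorProduct.map_tmul, LinearMap.id_apply, comul_one, comul_cons,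
    TensorProduct.tmul_add, LinearEquiv.coe_coe, TensorProduct.assoc_tmul, add_assoc]
  congr 2
  rw [TensorProduct.map_map, TensorProduct.map_map]
  rfl

variable (R V) in
/-- The coproduct on the completed bar construction. -/
abbrev comulBar : Bar R V →ₗ[R] Nov R (TensorSum R V ⊗[R] TensorSum R V) :=
  Nov.map (N := TensorSum R V ⊗[R] TensorSum R V) comul

/-- The counit: the projection to the tensors of length zero. -/
def counit : TensorSum R V →ₗ[R] R := fold 0 1

@[simp] theorem counit_one : counit (1 : TensorSum R V) = 1 := by simp [counit]

@[simp] theorem counit_cons (v : V) (t : TensorSum R V) : counit (tensorOne v * t) = 0 := by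
  simp [counit]

section Convolve

variable {X Y Z : Type*} [AddCommGroup X] [Module R X] [AddCommGroup Y] [Module R Y]
  [AddCommGroup Z] [Module R Z]

/-- The convolution `t ↦ ∑ β (A t', B t'')` of two linear maps with respect to a bilinear map `β`,
where `∑ t' ⊗ t''` is the coproduct of `t`. -/
def convolve (β : X →ₗ[R] Y →ₗ[R] Z) (A : TensorSum R V →ₗ[R] X) (B : TensorSum R V →ₗ[R] Y) :
    TensorSum R V →ₗ[R] Z :=
  TensorProduct.lift (β.compl₁₂ A B) ∘ₗ comul

theorem convolve_word (β : X →ₗ[R] Y →ₗ[R] Z) (A : TensorSum R V →ₗ[R] X)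
    (B : TensorSum R V →ₗ[R] Y)
    (l : List V) :
    convolve β A B (word R l) =
      ∑ i ∈ Finset.range (l.length + 1), β (A (word R (l.take i))) (B (word R (l.drop i))) := by
  simp [convolve, comul_word]

theorem convolve_one (β : X →ₗ[R] Y →ₗ[R] Z) (A : TensorSum R V →ₗ[R] X)
    (B : TensorSum R V →ₗ[R] Y) :
    convolve β A B 1 = β (A 1) (B 1) := by
  simp [convolve]

theorem convolve_cons (β : X →ₗ[R] Y →ₗ[R] Z) (A : TensorSum R V →ₗ[R] X)
    (B : TensorSum R V →ₗ[R] Y)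
    (v : V) (t : TensorSum R V) :
    convolve β A B (tensorOne v * t) = β (A 1) (B (tensorOne v * t)) +
      convolve β (A ∘ₗ LinearMap.mulLeft R (tensorOne v)) B t := by
  simp only [convolve, LinearMap.comp_apply, comul_cons, map_add]
  refine congrArg₂ (· + ·) (by rw [TensorProduct.lift.tmul, LinearMap.compl₁₂_apply]) ?_
  · rw [← LinearMap.comp_apply]
    refine LinearMap.congr_fun ?_ _
    refine TensorProduct.ext' fun a b => ?_
    simp

end Convolve

end TensorSum

namespace BarSeries

open TensorSum

variable {R V W : Type*} [CommRing R] [AddCommGroup V] [Module R V] [AddCommGroup W] [Module R W]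

theorem toLin_word (a : BarSeries R V W) (l : List V) :
    toLin a (word R l) = a l.length l.get := by
  rw [word_eq_tensorOf, toLin_tensorOf]

theorem toLin_word_of_length (a : BarSeries R V W) {n : ℕ} (x : Fin n → V) (l : List V)
    (h : l = List.ofFn x) : toLin a (word R l) = a n x := by
  rw [h, ← tensorOf_eq_word, toLin_tensorOf]

theorem toLin_conv (a b : BarSeries R V W) :
    toLin (conv a b) = convolve barMul (toLin a) (toLin b) := by
  refine ext_word fun l => ?_
  rw [convolve_word, toLin_word, conv, sum_apply]
  have : ∀ p ∈ (Finset.HasAntidiagonal.antidiagonal l.length).attach,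
      ((barConcat (a p.1.1) (b p.1.2)).domDomCongr
        (finCongr (Finset.HasAntidiagonal.mem_antidiagonal.1 p.2))) l.get =
      (fun q : ℕ × ℕ => barMul (toLin a (word R (l.take q.1))) (toLin b (word R (l.drop q.1))))
        p.1 := by
    rintro ⟨⟨i, j⟩, hp⟩ -
    have hij : i + j = l.length := Finset.HasAntidiagonal.mem_antidiagonal.1 hp
    rw [MultilinearMap.domDomCongr_apply, barConcat_apply]
    congr 1
    · congr 1
      symm
      refine toLin_word_of_length _ _ _ (List.ext_getElem ?_ ?_)
      · simp; omega
      · intro k h1 h2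
        simp
    · symm
      refine toLin_word_of_length _ _ _ (List.ext_getElem ?_ ?_)
      · simp; omega
      · intro k h1 h2
        simp
  rw [Finset.sum_congr rfl this, Finset.sum_attach _ (fun q : ℕ × ℕ =>
    barMul (toLin a (word R (l.take q.1))) (toLin b (word R (l.drop q.1)))),
    Finset.Nat.sum_antidiagonal_eq_sum_range_succ_mk]

end BarSeries

/-! ### Associativity and unitality of convolutions -/

namespace TensorSum

variable {R V W : Type*} [CommRing R] [AddCommGroup V] [Module R V] [AddCommGroup W] [Module R W]

section ConvolveAlgebra

variable {X Y Z U U' U'' : Type*} [AddCommGroup X] [Module R X] [AddCommGroup Y] [Module R Y]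
  [AddCommGroup Z] [Module R Z] [AddCommGroup U] [Module R U] [AddCommGroup U'] [Module R U']
  [AddCommGroup U''] [Module R U'']

theorem convolve_assoc (β : U →ₗ[R] Z →ₗ[R] U'') (γ : X →ₗ[R] Y →ₗ[R] U) (β' : X →ₗ[R] U' →ₗ[R] U'')
    (γ' : Y →ₗ[R] Z →ₗ[R] U') (h : ∀ x y z, β (γ x y) z = β' x (γ' y z))
    (A : TensorSum R V →ₗ[R] X) (B : TensorSum R V →ₗ[R] Y) (C : TensorSum R V →ₗ[R] Z) :
    convolve β (convolve γ A B) C = convolve β' A (convolve γ' B C) := by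
  have h1 : TensorProduct.lift (β.compl₁₂ (convolve γ A B) C) =
      (TensorProduct.lift (β'.compl₁₂ A (TensorProduct.lift (γ'.compl₁₂ B C))) ∘ₗ
        (TensorProduct.assoc R (TensorSum R V) (TensorSum R V) (TensorSum R V)).toLinearMap) ∘ₗ
        TensorProduct.map comul LinearMap.id := by
    refine TensorProduct.ext' fun s t => ?_
    simp only [LinearMap.comp_apply, TensorProduct.lift.tmul, LinearMap.compl₁₂_apply, convolve,
      TensorProduct.map_tmul, LinearMap.id_apply, LinearEquiv.coe_coe]
    generalize comul s = z
    induction z using TensorProduct.induction_on with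
    | zero => simp
    | add x y hx hy => simp only [map_add, LinearMap.add_apply, TensorProduct.add_tmul, hx, hy]
    | tmul a b => simp [h]
  rw [convolve, h1]
  refine LinearMap.ext fun t => ?_
  have h2 := LinearMap.congr_fun (comul_coassoc (R := R) (V := V)) t
  simp only [LinearMap.comp_apply] at h2 ⊢
  rw [h2]
  simp only [convolve, LinearMap.comp_apply]
  generalize comul t = z
  induction z using TensorProduct.induction_on with
  | zero => simp
  | add x y hx hy => simp only [map_add, hx, hy]
  | tmul a b => simp

theorem convolve_add_left (β : X →ₗ[R] Y →ₗ[R] Z) (A A' : TensorSum R V →ₗ[R] X)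
    (B : TensorSum R V →ₗ[R] Y) : convolve β (A + A') B = convolve β A B + convolve β A' B :=
  ext_word fun l => by simp [convolve_word, Finset.sum_add_distrib]

theorem convolve_add_right (β : X →ₗ[R] Y →ₗ[R] Z) (A : TensorSum R V →ₗ[R] X)
    (B B' : TensorSum R V →ₗ[R] Y) : convolve β A (B + B') = convolve β A B + convolve β A B' :=
  ext_word fun l => by simp [convolve_word, Finset.sum_add_distrib]

theorem convolve_sub_right (β : X →ₗ[R] Y →ₗ[R] Z) (A : TensorSum R V →ₗ[R] X)
    (B B' : TensorSum R V →ₗ[R] Y) : convolve β A (B - B') = convolve β A B - convolve β A B' :=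
  ext_word fun l => by simp [convolve_word]

theorem counit_word (l : List V) : counit (word R l) = if l = [] then 1 else 0 := by
  cases l <;> simp

theorem convolve_counit_left (β : X →ₗ[R] Y →ₗ[R] Z) (x : X) (B : TensorSum R V →ₗ[R] Y) :
    convolve β (LinearMap.toSpanSingleton R X x ∘ₗ counit) B = β x ∘ₗ B := by
  refine ext_rec ?_ fun v t _ => ?_
  · simp [convolve_one]
  · rw [convolve_cons]
    have : (LinearMap.toSpanSingleton R X x ∘ₗ counit) ∘ₗ LinearMap.mulLeft R (tensorOne v) = 0 :=
      LinearMap.ext fun s => by simp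
    rw [this]
    have h0 : convolve β 0 B = 0 := by
      refine ext_word fun l => ?_
      simp [convolve_word]
    simp [h0]

end ConvolveAlgebra

end TensorSum

open TensorSum

namespace BarSeries

variable {R V W : Type*} [CommRing R] [AddCommGroup V] [Module R V] [AddCommGroup W] [Module R W]

/-! ### The sum of all convolution powers as a fixed point -/

theorem toLin_unit : toLin (unit : BarSeries R V W) =
    LinearMap.toSpanSingleton R (Bar R W) (Nov.const 1) ∘ₗ counit := by
  refine ext_word fun l => ?_
  rw [toLin_word]
  cases l with
  | nil =>
    have : (tensorOf 0 ![] : TensorSum R W) = 1 := by rw [tensorOf_eq_word]; simp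
    change Nov.const (tensorOf 0 ![]) = _
    rw [this]
    simp
  | cons v l =>
    change (0 : Bar R W) = _
    simp

theorem toLin_power_succ (a : BarSeries R V W) (N : ℕ) :
    toLin (power a (N + 1)) = convolve barMul (toLin a) (toLin (power a N)) :=
  toLin_conv a (power a N)

variable (a : BarSeries R V W) (h : ∃ l > 0, ∀ x, a 0 x ∈ Nov.energy R (TensorSum R W) l)

include h in
theorem exists_power_coeff_eq_zero (t : TensorSum R V) (E : ℝ≥0) :
    ∃ D : ℕ, ∀ n, D ≤ n → ∀ g : NovExp, g.1 ≤ E → (toLin (power a n) t).coeff g = 0 := by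
  obtain ⟨l, hl, h⟩ := h
  obtain ⟨D, hD⟩ := toLin_power_mem_energy a l h t
  obtain ⟨K, hK⟩ := exists_nat_gt (E / l)
  refine ⟨D + K, fun n hn g hg => ?_⟩
  by_contra h'
  refine absurd ((hD n g h').trans hg) (not_le.2 ?_)
  rw [div_lt_iff₀ hl] at hK
  refine hK.trans_le ?_
  gcongr
  omega

/-- Up to any given energy, the sum of all powers is a finite sum. -/
theorem exists_sumPowers_coeff (t : TensorSum R V) (E : ℝ≥0) :
    ∃ D : ℕ, ∀ D', D ≤ D' → ∀ g : NovExp, g.1 ≤ E →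
      (sumPowers a h t).coeff g = (∑ N ∈ Finset.range D', toLin (power a N) t).coeff g := by
  obtain ⟨D, hD⟩ := exists_power_coeff_eq_zero a h t E
  refine ⟨D, fun D' hD' g hg => ?_⟩
  change ∑ᶠ n, (toLin (power a n) t).coeff g = _
  rw [Nov.coeff_sum]
  refine finsum_eq_sum_of_support_subset _ fun n hn => ?_
  by_contra hn'
  exact hn (hD n (hD'.trans (by simpa using hn')) g hg)

theorem _root_.Nov.conv_coeff_congr {M N P : Type*} [AddCommGroup M] [Module R M]
    [AddCommGroup N] [Module R N] [AddCommGroup P] [Module R P] (μ : M →ₗ[R] N →ₗ[R] P)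
    (x : Nov R M) {y y' : Nov R N} {g : NovExp}
    (hy : ∀ g' : NovExp, g'.1 ≤ g.1 → y.coeff g' = y'.coeff g') :
    (Nov.conv μ x y).coeff g = (Nov.conv μ x y').coeff g := by
  rw [Nov.coeff_conv, Nov.coeff_conv]
  exact Finset.sum_congr rfl fun a _ => by rw [hy _ tsub_le_self]

/-- The sum `P = ∑ aᴺ` of all convolution powers is a solution of `P = 1 + a * P`. -/
theorem sumPowers_eq :
    sumPowers a h = LinearMap.toSpanSingleton R (Bar R W) (Nov.const 1) ∘ₗ counit +
      convolve barMul (toLin a) (sumPowers a h) := by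
  refine ext_word fun l => Nov.ext fun g => ?_
  choose D hD using fun t : TensorSum R V => exists_sumPowers_coeff a h t g.1
  obtain ⟨D', hD'⟩ : ∃ D' : ℕ, D (word R l) ≤ D' + 1 ∧
      ∀ i ∈ Finset.range (l.length + 1), D (word R (l.drop i)) ≤ D' :=
    ⟨max (D (word R l)) ((Finset.range (l.length + 1)).sup fun i => D (word R (l.drop i))),
      (le_max_left _ _).trans (Nat.le_succ _),
      fun i hi => (Finset.le_sup (f := fun i => D (word R (l.drop i))) hi).trans (le_max_right _ _)⟩
  rw [hD _ _ hD'.1 g le_rfl, Finset.sum_range_succ', LinearMap.add_apply, ← toLin_unit, add_comm,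
    Nov.coeff_add, Nov.coeff_add]
  refine congrArg₂ (· + ·) rfl ?_
  rw [convolve_word, Nov.coeff_sum, Nov.coeff_sum]
  simp only [toLin_power_succ, convolve_word, Nov.coeff_sum]
  rw [Finset.sum_comm]
  refine Finset.sum_congr rfl fun i hi => ?_
  rw [barMul, Nov.conv_coeff_congr _ _ fun g' hg' => hD _ _ (hD'.2 i hi) g' hg', map_sum,
    Nov.coeff_sum]

end BarSeries

section Coalgebra

variable {R V W : Type*} [CommRing R] [AddCommGroup V] [Module R V] [AddCommGroup W] [Module R W]

/-- A linear map that reproduces itself under convolution with a map that has positive energy on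
tensors of length zero is zero: its energy would be arbitrarily large. -/
theorem eq_zero_of_eq_convolve {M Q : Type*} [AddCommGroup M] [Module R M] [AddCommGroup Q]
    [Module R Q]
    (β : M →ₗ[R] Q →ₗ[R] Q) (A : TensorSum R V →ₗ[R] Nov R M) {l : ℝ≥0} (hl : 0 < l)
    (hA : A 1 ∈ Nov.energy R M l) (X : TensorSum R V →ₗ[R] Nov R Q)
    (hX : X = convolve (Nov.conv β) A X) : X = 0 := by
  have key : ∀ (n : ℕ) (w : List V), w.length = n → X (word R w) = 0 := by
    intro n
    induction n using Nat.strong_induction_on with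
    | _ n ih =>
      intro w hw
      have h1 : X (word R w) = Nov.conv β (A 1) (X (word R w)) := by
        conv_lhs => rw [hX]
        rw [convolve_word, Finset.sum_range_succ', Finset.sum_eq_zero]
        · simp
        · intro i hi
          rw [Finset.mem_range] at hi
          rw [ih (w.length - (i + 1)) (by omega) (w.drop (i + 1)) (by simp), map_zero]
      have h2 : ∀ k : ℕ, X (word R w) ∈ Nov.energy R Q (k * l) := by
        intro k
        induction k with
        | zero => simpa using Nov.mem_energy_zero _
        | succ k ihk =>
          rw [h1]
          refine Nov.energy_anti (le_of_eq ?_) (Nov.conv_mem_energy β hA ihk)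
          push_cast
          ring
      ext g
      by_contra hg
      obtain ⟨K, hK⟩ := exists_nat_gt (g.1 / l)
      rw [div_lt_iff₀ hl] at hK
      exact absurd (h2 K g hg) (not_le.2 hK)
  exact ext_word fun w => key _ w rfl

variable (R V) in
/-- The map `x ↦ 1 ⊗ x` on the completed bar construction. -/
abbrev oneTensor : Bar R V →ₗ[R] Nov R (TensorSum R V ⊗[R] TensorSum R V) :=
  Nov.map (N := TensorSum R V ⊗[R] TensorSum R V) (TensorProduct.mk R (TensorSum R V) _ 1)

variable (R V) in
/-- The product `x, y ↦ x ⊗ y` on the completed bar construction. -/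
abbrev tensorConv : Bar R V →ₗ[R] Bar R V →ₗ[R] Nov R (TensorSum R V ⊗[R] TensorSum R V) :=
  Nov.conv (P := TensorSum R V ⊗[R] TensorSum R V) (TensorProduct.mk R _ _)

theorem tensorConv_const_one (x : Bar R V) : tensorConv R V (Nov.const 1) x = oneTensor R V x :=
  Nov.conv_const_left _ _ _

theorem tensorHat_comp_comul {A B : TensorSum R V →ₗ[R] Bar R W} :
    Nov.tensorHat A B ∘ₗ comul = convolve (tensorConv R W) A B := rfl

/-- Multiplication of the left factor: `a, b ⊗ c ↦ a b ⊗ c`. -/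
def mulTensorLeft : TensorSum R V →ₗ[R] TensorSum R V ⊗[R] TensorSum R V →ₗ[R]
    TensorSum R V ⊗[R] TensorSum R V :=
  LinearMap.rTensorHom (TensorSum R V) ∘ₗ LinearMap.mul R (TensorSum R V)

theorem mulTensorLeft_tmul (a b c : TensorSum R V) :
    mulTensorLeft a (b ⊗ₜ[R] c) = (a * b) ⊗ₜ c := by
  simp [mulTensorLeft]

theorem tensorConv_barMul (x y z : Bar R V) :
    tensorConv R V (barMul x y) z = Nov.conv mulTensorLeft x (tensorConv R V y z) :=
  Nov.conv_assoc _ _ _ _ (fun p q r => (mulTensorLeft_tmul p q r).symm) _ _ _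

theorem comul_tensorOne_mul (v : V) (t : TensorSum R V) :
    comul (tensorOne v * t) = 1 ⊗ₜ (tensorOne v * t) + mulTensorLeft (tensorOne v) (comul t) :=
  comul_cons v t

theorem map_comul_barMul (y : Nov R W) (z : Bar R W) :
    comulBar R W (barMul (Nov.map tensorOne y) z) =
      oneTensor R W (barMul (Nov.map tensorOne y) z) +
        Nov.conv mulTensorLeft (Nov.map tensorOne y) (comulBar R W z) := by
  rw [barMul, Nov.map_conv, Nov.map_conv, Nov.conv_map_left, Nov.conv_map_left, Nov.conv_map_left,
    Nov.conv_map_right, ← Nov.conv_add_bilin]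
  refine congrArg (fun μ => Nov.conv μ y z) ?_
  refine LinearMap.ext fun v => LinearMap.ext fun t => ?_
  exact comul_tensorOne_mul v t

/-- The sum of all convolution powers of a family with values in tensors of length one is
compatible with the coproducts. -/
theorem map_comul_of_fixedPoint (a : TensorSum R V →ₗ[R] Nov R W) {l : ℝ≥0} (hl : 0 < l)
    (ha : a 1 ∈ Nov.energy R W l) (P : TensorSum R V →ₗ[R] Bar R W)
    (hP : P = LinearMap.toSpanSingleton R (Bar R W) (Nov.const 1) ∘ₗ counit +
      convolve barMul (Nov.map tensorOne ∘ₗ a) P) :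
    comulBar R W ∘ₗ P = Nov.tensorHat P P ∘ₗ comul := by
  -- Both sides solve the fixed point equation `X = 1 ⊗ P + A * X`, whose solution is unique.
  set A : TensorSum R V →ₗ[R] Bar R W := Nov.map tensorOne ∘ₗ a with hA
  have hA1 : A 1 ∈ Nov.energy R (TensorSum R W) l := Nov.map_mem_energy _ ha
  have h1 : comulBar R W ∘ₗ P = oneTensor R W ∘ₗ P +
      convolve (Nov.conv mulTensorLeft) A (comulBar R W ∘ₗ P) := by
    have h2 : comulBar R W ∘ₗ convolve barMul A P =
        oneTensor R W ∘ₗ convolve barMul A P +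
          convolve (Nov.conv mulTensorLeft) A (comulBar R W ∘ₗ P) := by
      refine ext_word fun w => ?_
      simp only [LinearMap.comp_apply, LinearMap.add_apply, convolve_word, map_sum,
        ← Finset.sum_add_distrib]
      refine Finset.sum_congr rfl fun i _ => ?_
      simp only [hA, LinearMap.comp_apply]
      exact map_comul_barMul _ _
    have h3 : comulBar R W ∘ₗ
          (LinearMap.toSpanSingleton R (Bar R W) (Nov.const 1) ∘ₗ counit (R := R) (V := V)) =
        oneTensor R W ∘ₗ
          (LinearMap.toSpanSingleton R (Bar R W) (Nov.const 1) ∘ₗ counit) := by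
      refine LinearMap.ext fun t => ?_
      simp only [LinearMap.comp_apply, LinearMap.toSpanSingleton_apply, map_smul, Nov.map_const,
        comul_one, TensorProduct.mk_apply]
    conv_lhs => rw [hP, LinearMap.comp_add, h2, h3, ← add_assoc, ← LinearMap.comp_add, ← hP]
  have h5 : convolve (tensorConv R W) P P =
      oneTensor R W ∘ₗ P + convolve (Nov.conv mulTensorLeft) A
        (convolve (tensorConv R W) P P) := by
    conv_lhs => enter [2]; rw [hP]
    rw [convolve_add_left, convolve_counit_left]
    refine congrArg₂ (· + ·) ?_ ?_
    · exact LinearMap.ext fun t => tensorConv_const_one (P t)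
    · exact convolve_assoc _ _ _ _ tensorConv_barMul _ _ _
  rw [tensorHat_comp_comul]
  refine sub_eq_zero.1 (eq_zero_of_eq_convolve mulTensorLeft A hl hA1 _ ?_)
  rw [convolve_sub_right]
  conv_lhs => rw [h1, h5]
  exact add_sub_add_left_eq_sub _ _ _

end Coalgebra

/-! ### Signs and parity -/

section Parity

variable {R V W : Type*} [CommRing R] [AddCommGroup V] [Module R V] [AddCommGroup W] [Module R W]

variable (R) in
/-- The sign `(-1) ^ b`. -/
def paritySign (b : ZMod 2) : R := if b = 1 then -1 else 1

variable (R) in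
@[simp] theorem paritySign_zero : paritySign R 0 = 1 := by simp [paritySign]

variable (R) in
@[simp] theorem paritySign_one : paritySign R 1 = -1 := by simp [paritySign]

theorem zmod_two_cases (b : ZMod 2) : b = 0 ∨ b = 1 := by
  revert b
  decide

theorem paritySign_add (a b : ZMod 2) : paritySign R (a + b) = paritySign R a * paritySign R b := by
  rcases zmod_two_cases a with rfl | rfl <;> rcases zmod_two_cases b with rfl | rfl <;>
    simp [paritySign, show (1 : ZMod 2) + 1 = 0 from rfl]

theorem paritySign_mul_self (a : ZMod 2) : paritySign R a * paritySign R a = 1 := by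
  rcases zmod_two_cases a with rfl | rfl <;> simp

variable (𝒱 : ℤ → Submodule R V) [DirectSum.Decomposition 𝒱]

theorem parityProj_of_mem (b : ZMod 2) {d : ℤ} {v : V} (hv : v ∈ 𝒱 d) :
    parityProj 𝒱 b v = if ((d - 1 : ℤ) : ZMod 2) = b then v else 0 := by
  rw [parityProj, LinearMap.comp_apply, LinearEquiv.coe_coe, DirectSum.decomposeLinearEquiv_apply,
    DirectSum.decompose_of_mem 𝒱 hv, ← DirectSum.lof_eq_of R, DirectSum.toModule_lof]
  split_ifs <;> simp

theorem shiftSign_of_mem {d : ℤ} {v : V} (hv : v ∈ 𝒱 d) :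
    shiftSign 𝒱 v = paritySign R ((d - 1 : ℤ) : ZMod 2) • v := by
  rw [shiftSign, LinearMap.sub_apply, parityProj_of_mem 𝒱 _ hv, parityProj_of_mem 𝒱 _ hv]
  rcases zmod_two_cases ((d - 1 : ℤ) : ZMod 2) with h | h <;> simp [h]

theorem span_iUnion_grading : Submodule.span R (⋃ d, (𝒱 d : Set V)) = ⊤ := by
  rw [eq_top_iff]
  rintro v -
  induction v using DirectSum.Decomposition.inductionOn 𝒱 with
  | zero => exact Submodule.zero_mem _
  | homogeneous v => exact Submodule.subset_span (Set.mem_iUnion.2 ⟨_, v.2⟩)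
  | add v w hv hw => exact Submodule.add_mem _ hv hw

theorem ext_homogeneous {Y : Type*} [AddCommMonoid Y] [Module R Y] {A B : V →ₗ[R] Y}
    (h : ∀ d, ∀ v ∈ 𝒱 d, A v = B v) : A = B := by
  refine LinearMap.ext_on (span_iUnion_grading 𝒱) fun v hv => ?_
  obtain ⟨d, hd⟩ := Set.mem_iUnion.1 hv
  exact h d v hd

theorem shiftSign_shiftSign (v : V) : shiftSign 𝒱 (shiftSign 𝒱 v) = v := by
  have : shiftSign 𝒱 ∘ₗ shiftSign 𝒱 = LinearMap.id := ext_homogeneous 𝒱 fun d v hv => by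
    rw [LinearMap.comp_apply, shiftSign_of_mem 𝒱 hv, map_smul, shiftSign_of_mem 𝒱 hv, smul_smul,
      paritySign_mul_self, one_smul, LinearMap.id_apply]
  exact LinearMap.congr_fun this v

end Parity

/-! ### The grading of the tensor algebra -/

namespace TensorSum

variable {R V W : Type*} [CommRing R] [AddCommGroup V] [Module R V] [AddCommGroup W] [Module R W]

section Degree

variable (𝒱 : ℤ → Submodule R V)

/-- The list `l` of pairs `(d, v)` consists of vectors `v` of degree `d`. -/
def IsHomogeneous (l : List (ℤ × V)) : Prop := ∀ y ∈ l, y.2 ∈ 𝒱 y.1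

/-- The total shifted degree of a list of pairs `(d, v)`. -/
def shiftedDegree (l : List (ℤ × V)) : ℤ := (l.map fun y => y.1 - 1).sum

theorem tensorDegree_eq_span (p : ℤ) : tensorDegree 𝒱 p = Submodule.span R
    {t | ∃ l : List (ℤ × V), IsHomogeneous 𝒱 l ∧ shiftedDegree l = p ∧
      t = word R (l.map Prod.snd)} := by
  rw [tensorDegree]
  congr 1
  ext t
  constructor
  · rintro ⟨n, d, x, hx, hd, rfl⟩
    refine ⟨List.ofFn fun i => (d i, x i), ?_, ?_, ?_⟩
    · intro y hy
      obtain ⟨i, rfl⟩ := (List.mem_ofFn' _ _).1 hy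
      exact hx i
    · rw [shiftedDegree, List.map_ofFn, List.sum_ofFn, ← hd]
      rfl
    · rw [tensorOf_eq_word, List.map_ofFn]
      rfl
  · rintro ⟨l, hl, hp, rfl⟩
    refine ⟨l.length, fun i => (l.get i).1, fun i => (l.get i).2, fun i => hl _ (l.get_mem i), ?_,
      ?_⟩
    · rw [← hp, shiftedDegree, ← List.sum_ofFn]
      congr 1
      refine List.ext_getElem (by simp) fun k h1 h2 => by simp
    · rw [tensorOf_eq_word]
      congr 1
      refine List.ext_getElem (by simp) fun k h1 h2 => by simp

theorem word_mem_tensorDegree {l : List (ℤ × V)} (hl : IsHomogeneous 𝒱 l) :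
    word R (l.map Prod.snd) ∈ tensorDegree 𝒱 (shiftedDegree l) := by
  rw [tensorDegree_eq_span]
  exact Submodule.subset_span ⟨l, hl, rfl, rfl⟩

theorem tensorDegree_le {p : ℤ} {S : Submodule R (TensorSum R V)}
    (h : ∀ l : List (ℤ × V), IsHomogeneous 𝒱 l → shiftedDegree l = p →
      word R (l.map Prod.snd) ∈ S) : tensorDegree 𝒱 p ≤ S := by
  rw [tensorDegree_eq_span, Submodule.span_le]
  rintro _ ⟨l, hl, hp, rfl⟩
  exact h l hl hp

theorem one_mem_tensorDegree : (1 : TensorSum R V) ∈ tensorDegree 𝒱 0 :=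
  word_mem_tensorDegree 𝒱 (l := []) (fun _ h => absurd h List.not_mem_nil)

theorem mul_mem_tensorDegree {p q : ℤ} {s t : TensorSum R V} (hs : s ∈ tensorDegree 𝒱 p)
    (ht : t ∈ tensorDegree 𝒱 q) : s * t ∈ tensorDegree 𝒱 (p + q) := by
  have h1 : tensorDegree 𝒱 p ≤
      (tensorDegree 𝒱 (p + q)).comap (LinearMap.mulRight R t) := by
    refine tensorDegree_le 𝒱 fun l hl hp => ?_
    have h2 : tensorDegree 𝒱 q ≤ (tensorDegree 𝒱 (p + q)).comap
        (LinearMap.mulLeft R (word R (l.map Prod.snd))) := by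
      refine tensorDegree_le 𝒱 fun l' hl' hq => ?_
      rw [Submodule.mem_comap, LinearMap.mulLeft_apply, ← word_append, ← List.map_append]
      have h3 : shiftedDegree (l ++ l') = p + q := by
        rw [← hp, ← hq]
        simp [shiftedDegree]
      rw [← h3]
      refine word_mem_tensorDegree 𝒱 fun y hy => ?_
      rcases List.mem_append.1 hy with hy | hy
      · exact hl y hy
      · exact hl' y hy
    exact h2 ht
  exact h1 hs

theorem tensorOne_mem_tensorDegree {d : ℤ} {v : V} (hv : v ∈ 𝒱 d) :
    (tensorOne v : TensorSum R V) ∈ tensorDegree 𝒱 (d - 1) := by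
  have := word_mem_tensorDegree (R := R) 𝒱 (l := [(d, v)]) (by
    intro y hy
    rw [List.mem_singleton] at hy
    subst hy
    exact hv)
  simpa [shiftedDegree] using this

theorem barMul_mem_barDegree {p q : ℤ} {x y : Bar R V} (hx : x ∈ barDegree 𝒱 p)
    (hy : y ∈ barDegree 𝒱 q) : barMul x y ∈ barDegree 𝒱 (p + q) := by
  intro g
  rw [barMul, Nov.coeff_conv]
  refine Submodule.sum_mem _ fun a ha => ?_
  have h := mul_mem_tensorDegree 𝒱 (hx a) (hy (g - a))
  have e : p - 2 * a.2 + (q - 2 * (g - a).2) = p + q - 2 * g.2 := by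
    rw [Prod.snd_sub]
    ring
  rwa [e] at h

theorem const_mem_barDegree {p : ℤ} {t : TensorSum R V} (ht : t ∈ tensorDegree 𝒱 p) :
    Nov.const t ∈ barDegree 𝒱 p := by
  intro g
  rw [Nov.coeff_const]
  split_ifs with h
  · subst h
    simpa using ht
  · exact Submodule.zero_mem _

/-- The linear map `A` from tensors to the completed bar construction has degree `r`. -/
def HasTensorDegree (𝒱 : ℤ → Submodule R V) (𝒲 : ℤ → Submodule R W)
    (A : TensorSum R V →ₗ[R] Bar R W) (r : ℤ) : Prop :=
  ∀ p, ∀ t ∈ tensorDegree 𝒱 p, A t ∈ barDegree 𝒲 (p + r)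

variable {𝒱} {𝒲 : ℤ → Submodule R W}

theorem HasTensorDegree.of_word {A : TensorSum R V →ₗ[R] Bar R W} {r : ℤ}
    (h : ∀ l : List (ℤ × V), IsHomogeneous 𝒱 l →
      A (word R (l.map Prod.snd)) ∈ barDegree 𝒲 (shiftedDegree l + r)) :
    HasTensorDegree 𝒱 𝒲 A r := by
  intro p t ht
  refine (tensorDegree_le (S := (barDegree 𝒲 (p + r)).comap A) 𝒱 fun l hl hp => ?_) ht
  rw [← hp]
  exact h l hl

theorem HasTensorDegree.convolve {A B : TensorSum R V →ₗ[R] Bar R W} {r s : ℤ}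
    (hA : HasTensorDegree 𝒱 𝒲 A r) (hB : HasTensorDegree 𝒱 𝒲 B s) :
    HasTensorDegree 𝒱 𝒲 (convolve barMul A B) (r + s) := by
  refine .of_word fun l hl => ?_
  rw [convolve_word]
  refine Submodule.sum_mem _ fun i _ => ?_
  rw [← List.map_take, ← List.map_drop]
  have h := barMul_mem_barDegree 𝒲
    (hA _ _ (word_mem_tensorDegree 𝒱 (l := l.take i) fun y hy => hl y (List.mem_of_mem_take hy)))
    (hB _ _ (word_mem_tensorDegree 𝒱 (l := l.drop i) fun y hy => hl y (List.mem_of_mem_drop hy)))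
  have e : shiftedDegree (l.take i) + r + (shiftedDegree (l.drop i) + s) =
      shiftedDegree l + (r + s) := by
    conv_rhs => rw [← List.take_append_drop i l]
    simp only [shiftedDegree, List.map_append, List.sum_append]
    ring
  rwa [e] at h

end Degree

section Decomposition

variable (𝒱 : ℤ → Submodule R V) [DirectSum.Decomposition 𝒱]

theorem ext_tensorDegree {Y : Type*} [AddCommMonoid Y] [Module R Y]
    {A B : TensorSum R V →ₗ[R] Y} (h : ∀ p, ∀ t ∈ tensorDegree 𝒱 p, A t = B t) : A = B := by
  refine ext_word_of_span (span_iUnion_grading 𝒱) fun l hl => ?_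
  have : ∃ l' : List (ℤ × V), IsHomogeneous 𝒱 l' ∧ l'.map Prod.snd = l := by
    induction l with
    | nil => exact ⟨[], fun _ h => absurd h List.not_mem_nil, rfl⟩
    | cons v l ih =>
      obtain ⟨l', hl', rfl⟩ := ih fun w hw => hl w (List.mem_cons_of_mem _ hw)
      obtain ⟨d, hd⟩ := Set.mem_iUnion.1 (hl v List.mem_cons_self)
      refine ⟨(d, v) :: l', fun y hy => ?_, rfl⟩
      rcases List.mem_cons.1 hy with rfl | hy
      · exact hd
      · exact hl' y hy
  obtain ⟨l', hl', rfl⟩ := this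
  exact h _ _ (word_mem_tensorDegree 𝒱 hl')

/-- The step `y ↦ (p ↦ ∑_d v_d ⊗ y (p - (d - 1)))` of the recursion for `degreeProj`. -/
def degreeStep : V →ₗ[R] (ℤ → TensorSum R V) →ₗ[R] (ℤ → TensorSum R V) :=
  DirectSum.toModule R ℤ _ (fun d => LinearMap.mk₂ R
    (fun (v : 𝒱 d) y p => tensorOne (v : V) * y (p - (d - 1)))
    (fun v w y => by ext1 p; simp [add_mul])
    (fun r v y => by ext1 p; simp)
    (fun v y z => by ext1 p; simp [mul_add])
    (fun r v y => by ext1 p; simp)) ∘ₗ (DirectSum.decomposeLinearEquiv 𝒱).toLinearMap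

theorem degreeStep_of_mem {d : ℤ} {v : V} (hv : v ∈ 𝒱 d) (y : ℤ → TensorSum R V) (p : ℤ) :
    degreeStep 𝒱 v y p = tensorOne v * y (p - (d - 1)) := by
  rw [degreeStep, LinearMap.comp_apply, LinearEquiv.coe_coe, DirectSum.decomposeLinearEquiv_apply,
    DirectSum.decompose_of_mem 𝒱 hv, ← DirectSum.lof_eq_of R, DirectSum.toModule_lof]
  rfl

/-- The projection to the tensors of degree `p`. -/
def degreeProj (p : ℤ) : TensorSum R V →ₗ[R] TensorSum R V :=
  LinearMap.proj p ∘ₗ fold (degreeStep 𝒱) fun p => if p = 0 then 1 else 0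

theorem degreeProj_of_mem {p q : ℤ} {t : TensorSum R V} (ht : t ∈ tensorDegree 𝒱 q) :
    degreeProj 𝒱 p t = if p = q then t else 0 := by
  have : tensorDegree 𝒱 q ≤
      LinearMap.ker (degreeProj 𝒱 p - if p = q then LinearMap.id else 0) := by
    refine tensorDegree_le 𝒱 fun l hl hq => ?_
    rw [LinearMap.mem_ker, LinearMap.sub_apply, sub_eq_zero]
    clear ht t
    induction l generalizing p q with
    | nil =>
      subst hq
      simp only [degreeProj, List.map_nil, word_nil, LinearMap.comp_apply, fold_one,
        LinearMap.proj_apply, shiftedDegree, List.sum_nil]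
      split_ifs <;> rfl
    | cons y l ih =>
      have hl' : IsHomogeneous 𝒱 l := fun z hz => hl z (List.mem_cons_of_mem _ hz)
      have e : shiftedDegree (y :: l) = y.1 - 1 + shiftedDegree l := by simp [shiftedDegree]
      have h := ih (p := p - (y.1 - 1)) hl' rfl
      rw [degreeProj, List.map_cons, word_cons, LinearMap.comp_apply, fold_mul,
        LinearMap.proj_apply, degreeStep_of_mem 𝒱 (hl y List.mem_cons_self)]
      have h' : fold (degreeStep 𝒱) (fun p => if p = 0 then 1 else 0)
          (word R (l.map Prod.snd)) (p - (y.1 - 1)) =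
          degreeProj 𝒱 (p - (y.1 - 1)) (word R (l.map Prod.snd)) := rfl
      rw [h', h, ← hq, e]
      by_cases hp : p = y.1 - 1 + shiftedDegree l
      · rw [if_pos hp, if_pos (by rw [hp]; ring)]
        rfl
      · rw [if_neg hp, if_neg fun h => hp (by rw [← h]; ring)]
        simp
  have h := this ht
  rw [LinearMap.mem_ker, LinearMap.sub_apply, sub_eq_zero] at h
  rw [h]
  split_ifs <;> rfl

theorem degreeProj_mem (p : ℤ) (t : TensorSum R V) : degreeProj 𝒱 p t ∈ tensorDegree 𝒱 p := by
  have : (tensorDegree 𝒱 p).mkQ ∘ₗ degreeProj 𝒱 p = 0 := by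
    refine ext_tensorDegree 𝒱 fun q t ht => ?_
    rw [LinearMap.comp_apply, degreeProj_of_mem 𝒱 ht]
    split_ifs with h
    · subst h
      simpa using ht
    · simp
  have h := LinearMap.congr_fun this t
  simpa using h

variable {𝒱} {𝒲 : ℤ → Submodule R W} [DirectSum.Decomposition 𝒲]

theorem HasTensorDegree.degreeProj_coeff {A : TensorSum R V →ₗ[R] Bar R W} {r : ℤ}
    (hA : HasTensorDegree 𝒱 𝒲 A r) (t : TensorSum R V) (p : ℤ) (g : NovExp) :
    degreeProj 𝒲 (p + r - 2 * g.2) ((A t).coeff g) = (A (degreeProj 𝒱 p t)).coeff g := by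
  have : degreeProj 𝒲 (p + r - 2 * g.2) ∘ₗ Nov.coeffHom R _ g ∘ₗ A =
      Nov.coeffHom R _ g ∘ₗ A ∘ₗ degreeProj 𝒱 p := by
    refine ext_tensorDegree 𝒱 fun q t ht => ?_
    simp only [LinearMap.comp_apply, Nov.coeffHom_apply]
    rw [degreeProj_of_mem 𝒱 ht, degreeProj_of_mem 𝒲 (hA q t ht g)]
    by_cases h : p = q
    · rw [if_pos h, if_pos (by rw [h])]
    · rw [if_neg h, if_neg fun h' => h (by linarith)]
      simp
  exact LinearMap.congr_fun this t

variable (𝒱) in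
/-- The sign `(-1) ^ p` on tensors of degree `p`. -/
def tensorSign : TensorSum R V →ₗ[R] TensorSum R V := map (shiftSign 𝒱)

variable (𝒱) in
theorem tensorSign_of_mem {p : ℤ} {t : TensorSum R V} (ht : t ∈ tensorDegree 𝒱 p) :
    tensorSign 𝒱 t = paritySign R (p : ZMod 2) • t := by
  have : tensorDegree 𝒱 p ≤
      LinearMap.ker (tensorSign 𝒱 - paritySign R (p : ZMod 2) • LinearMap.id) := by
    refine tensorDegree_le 𝒱 fun l hl hp => ?_
    rw [LinearMap.mem_ker, LinearMap.sub_apply, sub_eq_zero, ← hp, LinearMap.smul_apply,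
      LinearMap.id_apply, tensorSign]
    clear hp ht
    induction l with
    | nil => simp [shiftedDegree]
    | cons y l ih =>
      have e : shiftedDegree (y :: l) = y.1 - 1 + shiftedDegree l := by simp [shiftedDegree]
      rw [List.map_cons, word_cons, map_cons, ih fun z hz => hl z (List.mem_cons_of_mem _ hz),
        shiftSign_of_mem 𝒱 (hl y List.mem_cons_self), e, Int.cast_add, paritySign_add, map_smul,
        smul_mul_assoc, mul_smul_comm, smul_smul]
  have h := this ht
  rwa [LinearMap.mem_ker, LinearMap.sub_apply, sub_eq_zero] at h

@[simp] theorem tensorSign_one : tensorSign 𝒱 (1 : TensorSum R V) = 1 := map_one _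

@[simp] theorem tensorSign_cons (v : V) (t : TensorSum R V) :
    tensorSign 𝒱 (tensorOne v * t) = tensorOne (shiftSign 𝒱 v) * tensorSign 𝒱 t := map_cons _ _ _

theorem tensorSign_tensorSign (t : TensorSum R V) : tensorSign 𝒱 (tensorSign 𝒱 t) = t := by
  rw [tensorSign, map_map, (LinearMap.ext (shiftSign_shiftSign 𝒱) :
    shiftSign 𝒱 ∘ₗ shiftSign 𝒱 = LinearMap.id), map_id]

theorem HasTensorDegree.tensorSign_coeff {A : TensorSum R V →ₗ[R] Bar R W} {r : ℤ}
    (hA : HasTensorDegree 𝒱 𝒲 A r) (t : TensorSum R V) (g : NovExp) :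
    tensorSign 𝒲 ((A t).coeff g) =
      paritySign R (r : ZMod 2) • (A (tensorSign 𝒱 t)).coeff g := by
  have : tensorSign 𝒲 ∘ₗ Nov.coeffHom R _ g ∘ₗ A =
      paritySign R (r : ZMod 2) • (Nov.coeffHom R _ g ∘ₗ A ∘ₗ tensorSign 𝒱) := by
    refine ext_tensorDegree 𝒱 fun q t ht => ?_
    simp only [LinearMap.comp_apply, Nov.coeffHom_apply, LinearMap.smul_apply]
    rw [tensorSign_of_mem 𝒱 ht, tensorSign_of_mem 𝒲 (hA q t ht g), map_smul, Nov.coeff_smul,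
      smul_smul, ← paritySign_add]
    congr 2
    push_cast
    rw [show (2 : ZMod 2) = 0 from rfl]
    ring
  exact LinearMap.congr_fun this t

end Decomposition

end TensorSum

/-! ### Degrees of the structure maps -/

open TensorSum

section StructureMaps

variable {R V W : Type*} [CommRing R] [AddCommGroup V] [Module R V] [AddCommGroup W] [Module R W]

namespace NovFamily

theorem toLin_toBarSeries_word (φ : NovFamily R V W) (l : List V) :
    BarSeries.toLin φ.toBarSeries (word R l) =
      Nov.map tensorOne (φ.restrict l.length l.get) :=
  BarSeries.toLin_word _ l

/-- The family `φ` as a linear map on tensors. -/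
def onTensors (φ : NovFamily R V W) : TensorSum R V →ₗ[R] Nov R W :=
  DirectSum.toModule R ℕ (Nov R W) fun n => PiTensorProduct.lift (φ.restrict n)

theorem onTensors_word (φ : NovFamily R V W) (l : List V) :
    φ.onTensors (word R l) = φ.restrict l.length l.get := by
  rw [word_eq_tensorOf]
  simp [onTensors, tensorOf]

theorem toLin_toBarSeries (φ : NovFamily R V W) :
    BarSeries.toLin φ.toBarSeries = Nov.map tensorOne ∘ₗ φ.onTensors :=
  ext_word fun l => by
    rw [toLin_toBarSeries_word, LinearMap.comp_apply, onTensors_word]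

theorem HasDegree.onTensors_mem {𝒱 : ℤ → Submodule R V} {𝒲 : ℤ → Submodule R W}
    {φ : NovFamily R V W} {c : ℤ} (h : φ.HasDegree 𝒱 𝒲 c) {l : List (ℤ × V)}
    (hl : IsHomogeneous 𝒱 l) :
    φ.onTensors (word R (l.map Prod.snd)) ∈ Nov.degreePart 𝒲 (shiftedDegree l + c) := by
  rw [onTensors_word]
  have h1 := h (l.map Prod.snd).length (fun i => (l.get (i.cast (by simp))).1)
    (fun i => Nov.const ((l.map Prod.snd).get i)) (by
      intro i g
      rw [Nov.coeff_const]
      split_ifs with hg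
      · subst hg
        simpa using hl (l.get (i.cast (by simp))) (List.get_mem _ _)
      · exact Submodule.zero_mem _)
  have e : shiftedDegree l + c = ∑ i : Fin (l.map Prod.snd).length,
      (l.get (i.cast (by simp))).1 + c - (l.map Prod.snd).length := by
    have e1 : shiftedDegree l = ∑ i : Fin (l.map Prod.snd).length,
        ((l.get (i.cast (by simp))).1 - 1) := by
      rw [shiftedDegree, ← List.sum_ofFn]
      congr 1
      exact List.ext_getElem (by simp) fun k h1 h2 => by simp
    rw [e1, Finset.sum_sub_distrib]
    simp
    ring
  rw [e]
  exact h1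

theorem HasDegree.toLin {𝒱 : ℤ → Submodule R V} {𝒲 : ℤ → Submodule R W}
    {φ : NovFamily R V W} {c : ℤ} (h : φ.HasDegree 𝒱 𝒲 c) :
    HasTensorDegree 𝒱 𝒲 (BarSeries.toLin φ.toBarSeries) (c - 1) := by
  refine .of_word fun l hl g => ?_
  rw [toLin_toBarSeries, LinearMap.comp_apply, Nov.coeff_map]
  have := tensorOne_mem_tensorDegree (R := R) 𝒲 (h.onTensors_mem hl g)
  have e : shiftedDegree l + c - 2 * g.2 - 1 = shiftedDegree l + (c - 1) - 2 * g.2 := by ring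
  rwa [e] at this

end NovFamily

section Differential

variable (𝒱 : ℤ → Submodule R V) [DirectSum.Decomposition 𝒱] (m : NovFamily R V V)

/-- The codifferential on tensors with constant coefficients. -/
def tensorDifferential : TensorSum R V →ₗ[R] Bar R V :=
  convolve barMul (Nov.const ∘ₗ tensorSign 𝒱)
    (convolve barMul (BarSeries.toLin m.toBarSeries) Nov.const)

theorem barDifferential_eq : barDifferential 𝒱 m = Nov.lift (tensorDifferential 𝒱 m) := by
  rw [barDifferential, BarSeries.toLin_conv, BarSeries.toLin_conv, tensorDifferential]
  congr 2
  · refine ext_word fun l => ?_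
    rw [BarSeries.toLin_word]
    change Nov.const (tensorOf l.length fun i => shiftSign 𝒱 (l.get i)) =
      Nov.const (TensorSum.map (shiftSign 𝒱) (word R l))
    rw [tensorOf_eq_word, map_word]
    congr 2
    exact List.ext_getElem (by simp) fun k h1 h2 => by simp
  · congr 1
    refine ext_word fun l => ?_
    rw [BarSeries.toLin_word]
    change Nov.const (tensorOf l.length l.get) = _
    rw [← word_eq_tensorOf]

variable {𝒱 m}

theorem hasTensorDegree_tensorDifferential (hm : m.HasDegree 𝒱 𝒱 2) :
    HasTensorDegree 𝒱 𝒱 (tensorDifferential 𝒱 m) 1 := by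
  have h1 : HasTensorDegree 𝒱 𝒱 (Nov.const ∘ₗ tensorSign 𝒱) 0 := by
    intro p t ht
    rw [LinearMap.comp_apply, tensorSign_of_mem 𝒱 ht, add_zero]
    exact const_mem_barDegree 𝒱 (Submodule.smul_mem _ _ ht)
  have h2 : HasTensorDegree 𝒱 𝒱 (Nov.const : TensorSum R V →ₗ[R] Bar R V) 0 := by
    intro p t ht
    rw [add_zero]
    exact const_mem_barDegree 𝒱 ht
  have h := h1.convolve (hm.toLin.convolve h2)
  rwa [show (0 : ℤ) + (2 - 1 + 0) = 1 by norm_num] at h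

end Differential

section BarMap

variable {𝒱 : ℤ → Submodule R V} {𝒲 : ℤ → Submodule R W}

theorem hasTensorDegree_sumPowers {f : NovFamily R V W} (hf : f.PositiveAtZero)
    (hd : f.HasDegree 𝒱 𝒲 1) :
    HasTensorDegree 𝒱 𝒲 (BarSeries.sumPowers f.toBarSeries hf.toBarSeries) 0 := by
  have h : ∀ N, HasTensorDegree 𝒱 𝒲 (BarSeries.toLin (BarSeries.power f.toBarSeries N)) 0 := by
    intro N
    induction N with
    | zero =>
      refine .of_word fun l _ => ?_
      rw [BarSeries.power, BarSeries.toLin_unit, LinearMap.comp_apply,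
        LinearMap.toSpanSingleton_apply, counit_word]
      split_ifs with hl
      · rw [List.map_eq_nil_iff] at hl
        subst hl
        rw [one_smul]
        exact const_mem_barDegree 𝒲 (one_mem_tensorDegree 𝒲)
      · rw [zero_smul]
        exact Submodule.zero_mem _
    | succ N ih =>
      rw [BarSeries.toLin_power_succ]
      have h := hd.toLin.convolve ih
      rwa [show (1 : ℤ) - 1 + 0 = 0 by norm_num] at h
  intro p t ht g
  obtain ⟨D, hD⟩ := BarSeries.exists_sumPowers_coeff f.toBarSeries hf.toBarSeries t g.1
  rw [hD D le_rfl g le_rfl, Nov.coeff_sum]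
  exact Submodule.sum_mem _ fun N _ => h N p t ht g

end BarMap

end StructureMaps

/-! ### Coderivations -/

open TensorSum

namespace Nov

variable {R : Type*} [CommRing R] {M N : Type*} [AddCommGroup M] [Module R M] [AddCommGroup N]
  [Module R N]

theorem map_sub_hom (h k : M →ₗ[R] N) : map (h - k) = map h - map k :=
  LinearMap.ext fun x => Nov.ext fun g => by simp

theorem map_smul_hom (r : R) (h : M →ₗ[R] N) : map (r • h) = r • map h := rfl

theorem map_comp_hom {P : Type*} [AddCommGroup P] [Module R P] (h : N →ₗ[R] P) (k : M →ₗ[R] N) :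
    map (h ∘ₗ k) = map h ∘ₗ map k := rfl

end Nov

namespace TensorSum

section Coderivation

variable {R V : Type*} [CommRing R] [AddCommGroup V] [Module R V]

variable (𝒱 : ℤ → Submodule R V) [DirectSum.Decomposition 𝒱]

/-- Application of `μ` to the initial segments of a tensor:
`x₁ ⊗ ⋯ ⊗ xₙ ↦ ∑ₖ μ (x₁ ⊗ ⋯ ⊗ xₖ) ⊗ x_{k+1} ⊗ ⋯ ⊗ xₙ`. -/
def applyInitial (μ : TensorSum R V →ₗ[R] V) : TensorSum R V →ₗ[R] TensorSum R V :=
  convolve (LinearMap.mul R (TensorSum R V)) (tensorOne ∘ₗ μ) LinearMap.id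

/-- The coderivation of the tensor coalgebra of `V[1]` that corresponds to the odd map `μ`:
`x₁ ⊗ ⋯ ⊗ xₙ ↦ ∑ ± x₁ ⊗ ⋯ ⊗ xᵢ ⊗ μ (x_{i+1} ⊗ ⋯ ⊗ x_{i+k}) ⊗ ⋯ ⊗ xₙ`. -/
def coderivation (μ : TensorSum R V →ₗ[R] V) : TensorSum R V →ₗ[R] TensorSum R V :=
  convolve (LinearMap.mul R (TensorSum R V)) (tensorSign 𝒱) (applyInitial μ)

theorem comul_eq_convolve :
    comul = convolve (TensorProduct.mk R (TensorSum R V) (TensorSum R V)) LinearMap.id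
      LinearMap.id := by
  refine ext_word fun l => ?_
  simp [convolve_word, comul_word]

theorem map_comul_eq_convolve {X Y : Type*} [AddCommGroup X] [Module R X] [AddCommGroup Y]
    [Module R Y] (A : TensorSum R V →ₗ[R] X) (B : TensorSum R V →ₗ[R] Y) :
    TensorProduct.map A B ∘ₗ comul = convolve (Z := X ⊗[R] Y) (TensorProduct.mk R X Y) A B := by
  refine ext_word fun l => ?_
  simp [convolve_word, comul_word]

/-- Application of `μ` to initial segments is a one-sided version of a coderivation. -/
theorem comul_applyInitial (μ : TensorSum R V →ₗ[R] V) (t : TensorSum R V) :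
    comul (applyInitial μ t) = 1 ⊗ₜ applyInitial μ t +
      TensorProduct.map (applyInitial μ) LinearMap.id (comul t) := by
  have h1 : TensorProduct.map (applyInitial μ) LinearMap.id ∘ₗ comul =
      convolve (Z := TensorSum R V ⊗[R] TensorSum R V) mulTensorLeft (tensorOne ∘ₗ μ) comul := by
    rw [map_comul_eq_convolve, comul_eq_convolve]
    exact convolve_assoc _ _ _ _ (fun x y z => (mulTensorLeft_tmul x y z).symm) _ _ _
  have h2 : comul ∘ₗ applyInitial μ =
      TensorProduct.mk R (TensorSum R V) (TensorSum R V) 1 ∘ₗ applyInitial μ +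
        TensorProduct.map (applyInitial μ) LinearMap.id ∘ₗ comul := by
    rw [h1]
    refine ext_word fun l => ?_
    simp only [applyInitial, LinearMap.comp_apply, LinearMap.add_apply, convolve_word, map_sum,
      ← Finset.sum_add_distrib]
    refine Finset.sum_congr rfl fun i _ => ?_
    exact comul_tensorOne_mul _ _
  exact LinearMap.congr_fun h2 t

theorem coderivation_one (μ : TensorSum R V →ₗ[R] V) :
    coderivation 𝒱 μ 1 = applyInitial μ 1 := by
  simp [coderivation, convolve_one]

theorem coderivation_cons (μ : TensorSum R V →ₗ[R] V) (v : V) (t : TensorSum R V) :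
    coderivation 𝒱 μ (tensorOne v * t) = applyInitial μ (tensorOne v * t) +
      tensorOne (shiftSign 𝒱 v) * coderivation 𝒱 μ t := by
  rw [coderivation, convolve_cons, tensorSign_one, LinearMap.mul_apply', one_mul]
  congr 1
  have : convolve (LinearMap.mul R (TensorSum R V))
        (tensorSign 𝒱 ∘ₗ LinearMap.mulLeft R (tensorOne v)) (applyInitial μ) =
      LinearMap.mulLeft R (tensorOne (shiftSign 𝒱 v)) ∘ₗ
        convolve (LinearMap.mul R (TensorSum R V)) (tensorSign 𝒱) (applyInitial μ) := by
    refine ext_word fun l => ?_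
    simp only [convolve_word, LinearMap.comp_apply, LinearMap.mulLeft_apply, tensorSign_cons,
      LinearMap.mul_apply', Finset.mul_sum, mul_assoc]
  exact LinearMap.congr_fun this t

/-- The map `D ⊗ 1 + γ ⊗ D` on `T ⊗ T`, where `γ` is the sign operator. -/
def tensorSquareDifferential (D : TensorSum R V →ₗ[R] TensorSum R V) :
    TensorSum R V ⊗[R] TensorSum R V →ₗ[R] TensorSum R V ⊗[R] TensorSum R V :=
  TensorProduct.map D LinearMap.id + TensorProduct.map (tensorSign 𝒱) D

/-- The defining property `Δ D = (D ⊗ 1 + γ ⊗ D) Δ` of a coderivation of odd degree. -/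
theorem comul_coderivation (μ : TensorSum R V →ₗ[R] V) :
    comul ∘ₗ coderivation 𝒱 μ = tensorSquareDifferential 𝒱 (coderivation 𝒱 μ) ∘ₗ comul := by
  refine ext_rec ?_ fun v t ht => ?_
  · simp only [LinearMap.comp_apply, coderivation_one, comul_applyInitial, comul_one,
      tensorSquareDifferential, LinearMap.add_apply, TensorProduct.map_tmul, LinearMap.id_apply,
      tensorSign_one]
    rw [add_comm]
  · simp only [LinearMap.comp_apply] at ht ⊢
    have h1 : tensorSquareDifferential 𝒱 (coderivation 𝒱 μ) ∘ₗ
          TensorProduct.map (LinearMap.mulLeft R (tensorOne v)) LinearMap.id =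
        TensorProduct.map (applyInitial μ) LinearMap.id ∘ₗ
          TensorProduct.map (LinearMap.mulLeft R (tensorOne v)) LinearMap.id +
        TensorProduct.map (LinearMap.mulLeft R (tensorOne (shiftSign 𝒱 v))) LinearMap.id ∘ₗ
          tensorSquareDifferential 𝒱 (coderivation 𝒱 μ) := by
      refine TensorProduct.ext' fun a b => ?_
      simp only [tensorSquareDifferential, LinearMap.comp_apply, LinearMap.add_apply,
        TensorProduct.map_tmul, LinearMap.mulLeft_apply, LinearMap.id_apply, coderivation_cons,
        tensorSign_cons, TensorProduct.add_tmul, map_add, add_assoc]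
    have h2 := LinearMap.congr_fun h1 (comul t)
    simp only [LinearMap.comp_apply, LinearMap.add_apply] at h2
    rw [coderivation_cons, map_add, comul_applyInitial, comul_cons, comul_cons, ht]
    conv_rhs => rw [map_add, h2]
    rw [map_add]
    simp only [tensorSquareDifferential, LinearMap.add_apply, TensorProduct.map_tmul,
      LinearMap.id_apply, coderivation_one, tensorSign_one, coderivation_cons,
      TensorProduct.tmul_add]
    abel

end Coderivation

/-! ### The graded exchange of tensor factors -/

section Swap

variable {R V W : Type*} [Field R] [AddCommGroup V] [Module R V]
  [AddCommGroup W] [Module R W]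
variable (𝒱 : ℤ → Submodule R V) [DirectSum.Decomposition 𝒱]
variable (𝒲 : ℤ → Submodule R W) [DirectSum.Decomposition 𝒲]

/-- The graded exchange `s ⊗ t ↦ (-1) ^ (|s| |t|) t ⊗ s` of tensor factors. With the sign operator
`γ`, the sign `(-1) ^ (|s| |t|)` is given by `(1 + γ ⊗ 1 + 1 ⊗ γ - γ ⊗ γ) / 2`. -/
def gradedSwap : TensorSum R V ⊗[R] TensorSum R V →ₗ[R] TensorSum R V ⊗[R] TensorSum R V :=
  (TensorProduct.comm R (TensorSum R V) (TensorSum R V)).toLinearMap ∘ₗ ((2 : R)⁻¹ •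
    (TensorProduct.map LinearMap.id LinearMap.id + TensorProduct.map (tensorSign 𝒱) LinearMap.id +
      TensorProduct.map LinearMap.id (tensorSign 𝒱) -
      TensorProduct.map (tensorSign 𝒱) (tensorSign 𝒱)))

theorem gradedSwap_tmul (a b : TensorSum R V) :
    gradedSwap 𝒱 (a ⊗ₜ b) = (2 : R)⁻¹ • (b ⊗ₜ a + b ⊗ₜ tensorSign 𝒱 a + tensorSign 𝒱 b ⊗ₜ a -
      tensorSign 𝒱 b ⊗ₜ tensorSign 𝒱 a) := by
  simp [gradedSwap]

theorem gradedSwap_of_sign [CharZero R] {a b : TensorSum R V} {p q : ZMod 2}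
    (ha : tensorSign 𝒱 a = paritySign R p • a) (hb : tensorSign 𝒱 b = paritySign R q • b) :
    gradedSwap 𝒱 (a ⊗ₜ b) = paritySign R (p * q) • (b ⊗ₜ a) := by
  rw [gradedSwap_tmul, ha, hb]
  have h2 : (2 : R) ≠ 0 := two_ne_zero
  rcases zmod_two_cases p with rfl | rfl <;> rcases zmod_two_cases q with rfl | rfl <;>
    simp only [paritySign_zero, paritySign_one, one_smul, mul_zero, mul_one,
      ← TensorProduct.smul_tmul', TensorProduct.tmul_smul] <;>
    rw [inv_smul_eq_iff₀ h2] <;> module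

theorem gradedSwap_map_sign (z : TensorSum R V ⊗[R] TensorSum R V) :
    gradedSwap 𝒱 (TensorProduct.map (tensorSign 𝒱) (tensorSign 𝒱) z) =
      TensorProduct.map (tensorSign 𝒱) (tensorSign 𝒱) (gradedSwap 𝒱 z) := by
  induction z using TensorProduct.induction_on with
  | zero => simp
  | add x y hx hy => simp only [map_add, hx, hy]
  | tmul a b => simp [gradedSwap_tmul]

theorem gradedSwap_differential {D : TensorSum R V →ₗ[R] TensorSum R V}
    (hD : ∀ t, tensorSign 𝒱 (D t) = -D (tensorSign 𝒱 t))
    (z : TensorSum R V ⊗[R] TensorSum R V) :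
    gradedSwap 𝒱 (tensorSquareDifferential 𝒱 D z) =
      tensorSquareDifferential 𝒱 D (gradedSwap 𝒱 z) := by
  induction z using TensorProduct.induction_on with
  | zero => simp
  | add x y hx hy => simp only [map_add, hx, hy]
  | tmul a b =>
    simp only [tensorSquareDifferential, LinearMap.add_apply, TensorProduct.map_tmul, map_add,
      gradedSwap_tmul, LinearMap.id_apply, map_smul, map_sub, hD, tensorSign_tensorSign,
      TensorProduct.neg_tmul, TensorProduct.tmul_neg, ← smul_add]
    congr 1
    abel

/-- The defect `t ↦ ∑ ± t'' ⊗ t' - t' ⊗ t''` of graded cocommutativity. -/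
def swapDefect : TensorSum R V →ₗ[R] TensorSum R V ⊗[R] TensorSum R V :=
  gradedSwap 𝒱 ∘ₗ comul - comul

/-- The defect `t ↦ ∑ ± t'' ⊗ t' ⊗ t''' - t' ⊗ t'' ⊗ t'''` of invariance under the exchange of
adjacent initial blocks. -/
def initialSwapDefect :
    TensorSum R V →ₗ[R] (TensorSum R V ⊗[R] TensorSum R V) ⊗[R] TensorSum R V :=
  TensorProduct.map (swapDefect 𝒱) LinearMap.id ∘ₗ comul

theorem comul_tensorSign (t : TensorSum R V) :
    comul (tensorSign 𝒱 t) = TensorProduct.map (tensorSign 𝒱) (tensorSign 𝒱) (comul t) := by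
  have : comul ∘ₗ tensorSign 𝒱 = TensorProduct.map (tensorSign 𝒱) (tensorSign 𝒱) ∘ₗ comul := by
    refine ext_word fun l => ?_
    simp [comul_word, tensorSign]
  exact LinearMap.congr_fun this t

theorem swapDefect_tensorSign :
    swapDefect 𝒱 ∘ₗ tensorSign 𝒱 =
      TensorProduct.map (tensorSign 𝒱) (tensorSign 𝒱) ∘ₗ swapDefect 𝒱 := by
  refine LinearMap.ext fun t => ?_
  simp only [swapDefect, LinearMap.comp_apply, LinearMap.sub_apply, map_sub, comul_tensorSign,
    gradedSwap_map_sign]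

section Differential

variable {𝒱} {D : TensorSum R V →ₗ[R] TensorSum R V}
  (hD : ∀ t, tensorSign 𝒱 (D t) = -D (tensorSign 𝒱 t))
  (hc : comul ∘ₗ D = tensorSquareDifferential 𝒱 D ∘ₗ comul)

include hD hc

theorem swapDefect_differential :
    swapDefect 𝒱 ∘ₗ D = tensorSquareDifferential 𝒱 D ∘ₗ swapDefect 𝒱 := by
  refine LinearMap.ext fun t => ?_
  have h := LinearMap.congr_fun hc t
  simp only [LinearMap.comp_apply] at h
  simp only [swapDefect, LinearMap.comp_apply, LinearMap.sub_apply, map_sub, h,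
    gradedSwap_differential 𝒱 hD]

theorem map_mem_ker_swapDefect {t : TensorSum R V} (ht : t ∈ LinearMap.ker (swapDefect 𝒱)) :
    D t ∈ LinearMap.ker (swapDefect 𝒱) := by
  have h := LinearMap.congr_fun (swapDefect_differential hD hc) t
  rw [LinearMap.mem_ker] at ht ⊢
  simpa [ht] using h

theorem map_mem_ker_initialSwapDefect {t : TensorSum R V}
    (ht : t ∈ LinearMap.ker (initialSwapDefect 𝒱)) :
    D t ∈ LinearMap.ker (initialSwapDefect 𝒱) := by
  have h1 : TensorProduct.map (swapDefect 𝒱) LinearMap.id ∘ₗ tensorSquareDifferential 𝒱 D =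
      (TensorProduct.map (tensorSquareDifferential 𝒱 D) LinearMap.id +
        TensorProduct.map (TensorProduct.map (tensorSign 𝒱) (tensorSign 𝒱)) D) ∘ₗ
        TensorProduct.map (swapDefect 𝒱) LinearMap.id := by
    have e1 := swapDefect_differential hD hc
    have e2 := swapDefect_tensorSign 𝒱
    refine TensorProduct.ext' fun a b => ?_
    have e1' := LinearMap.congr_fun e1 a
    have e2' := LinearMap.congr_fun e2 a
    simp only [LinearMap.comp_apply] at e1' e2'
    conv_lhs => rw [LinearMap.comp_apply, tensorSquareDifferential, LinearMap.add_apply,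
      TensorProduct.map_tmul, TensorProduct.map_tmul, map_add, TensorProduct.map_tmul,
      TensorProduct.map_tmul, e1', e2']
    rfl
  have h2 := LinearMap.congr_fun hc t
  have h3 := LinearMap.congr_fun h1 (comul t)
  rw [LinearMap.mem_ker, initialSwapDefect, LinearMap.comp_apply] at ht ⊢
  simp only [LinearMap.comp_apply] at h2 h3
  rw [h2, h3, ht, map_zero]

end Differential

section CoalgebraMap

variable {𝒱 𝒲} {P : TensorSum R V →ₗ[R] Bar R W}
  (hP : ∀ t, Nov.map (tensorSign 𝒲) (P t) = P (tensorSign 𝒱 t))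
  (hc : comulBar R W ∘ₗ P = Nov.tensorHat P P ∘ₗ comul)

include hP

/-- A map that preserves the parity is compatible with the graded exchange of factors, because this
exchange is built from the sign operator. -/
theorem map_gradedSwap_tensorHat :
    Nov.map (M := TensorSum R W ⊗[R] TensorSum R W) (N := TensorSum R W ⊗[R] TensorSum R W)
      (gradedSwap 𝒲) ∘ₗ Nov.tensorHat P P = Nov.tensorHat P P ∘ₗ gradedSwap 𝒱 := by
  have hP' : Nov.map (tensorSign 𝒲) ∘ₗ P = P ∘ₗ tensorSign 𝒱 := LinearMap.ext hP
  have hid : Nov.map LinearMap.id ∘ₗ P = P ∘ₗ LinearMap.id := rfl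
  have hs : ∀ (h k : TensorSum R W →ₗ[R] TensorSum R W) (h' k' : TensorSum R V →ₗ[R] TensorSum R V),
      Nov.map h ∘ₗ P = P ∘ₗ h' → Nov.map k ∘ₗ P = P ∘ₗ k' →
      ∀ z, Nov.map (M := TensorSum R W ⊗[R] TensorSum R W)
        (N := TensorSum R W ⊗[R] TensorSum R W) (TensorProduct.map h k) (Nov.tensorHat P P z) =
        Nov.tensorHat P P (TensorProduct.map h' k' z) := by
    intro h k h' k' h1 h2 z
    have h3 := LinearMap.congr_fun (Nov.map_tensorHat h k P P) z
    rw [h1, h2, ← Nov.tensorHat_comp_map] at h3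
    exact h3
  refine LinearMap.ext fun z => ?_
  have hcomm := LinearMap.congr_fun (Nov.map_comm_tensorHat P P)
  simp only [LinearMap.comp_apply] at hcomm
  rw [gradedSwap, gradedSwap, LinearMap.comp_apply, LinearMap.comp_apply, LinearMap.comp_apply,
    ← hcomm, Nov.map_comp_hom (M := TensorSum R W ⊗[R] TensorSum R W)
      (N := TensorSum R W ⊗[R] TensorSum R W) (P := TensorSum R W ⊗[R] TensorSum R W),
    LinearMap.comp_apply]
  refine congrArg (Nov.map (M := TensorSum R W ⊗[R] TensorSum R W)
    (N := TensorSum R W ⊗[R] TensorSum R W) (TensorProduct.comm R _ _).toLinearMap) ?_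
  rw [LinearMap.smul_apply, map_smul, LinearMap.sub_apply, map_sub, LinearMap.add_apply, map_add,
    LinearMap.add_apply, map_add, ← hs _ _ _ _ hid hid z, ← hs _ _ _ _ hP' hid z,
    ← hs _ _ _ _ hid hP' z, ← hs _ _ _ _ hP' hP' z, Nov.map_smul_hom, Nov.map_sub_hom]
  rfl

include hc

theorem map_swapDefect_comp :
    Nov.map (N := TensorSum R W ⊗[R] TensorSum R W) (swapDefect 𝒲) ∘ₗ P =
      Nov.tensorHat P P ∘ₗ swapDefect 𝒱 := by
  rw [swapDefect, Nov.map_sub_hom, Nov.map_comp_hom, LinearMap.sub_comp, LinearMap.comp_assoc, hc,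
    ← LinearMap.comp_assoc, map_gradedSwap_tensorHat hP, swapDefect, LinearMap.comp_sub,
    LinearMap.comp_assoc]

theorem map_mem_coeffsIn_ker_swapDefect {t : TensorSum R V}
    (ht : t ∈ LinearMap.ker (swapDefect 𝒱)) :
    P t ∈ Nov.coeffsIn (LinearMap.ker (swapDefect 𝒲)) := by
  have h := LinearMap.congr_fun (map_swapDefect_comp hP hc) t
  rw [LinearMap.mem_ker] at ht
  rw [LinearMap.comp_apply, LinearMap.comp_apply, ht, map_zero] at h
  exact fun g => congrArg (fun x => Nov.coeff x g) h

theorem map_mem_coeffsIn_ker_initialSwapDefect {t : TensorSum R V}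
    (ht : t ∈ LinearMap.ker (initialSwapDefect 𝒱)) :
    P t ∈ Nov.coeffsIn (LinearMap.ker (initialSwapDefect 𝒲)) := by
  have h1 : Nov.map (N := (TensorSum R W ⊗[R] TensorSum R W) ⊗[R] TensorSum R W)
        (initialSwapDefect 𝒲) ∘ₗ P =
      Nov.tensorHat (Nov.tensorHat P P) P ∘ₗ initialSwapDefect 𝒱 := by
    rw [initialSwapDefect, Nov.map_comp_hom, LinearMap.comp_assoc, hc, ← LinearMap.comp_assoc,
      Nov.map_tensorHat, map_swapDefect_comp hP hc, initialSwapDefect, ← LinearMap.comp_assoc,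
      Nov.tensorHat_comp_map]
    rfl
  have h := LinearMap.congr_fun h1 t
  rw [LinearMap.mem_ker] at ht
  rw [LinearMap.comp_apply, LinearMap.comp_apply, ht, map_zero] at h
  exact fun g => congrArg (fun x => Nov.coeff x g) h

end CoalgebraMap

end Swap

end TensorSum

/-! ### Koszul signs -/

section KoszulSign

/-- The sign `(-1) ^ (a c)` of exchanging neighbours of parities `a` and `c`. -/
def exchangeSign (a c : ZMod 2) : ℤ := if a = 1 ∧ c = 1 then -1 else 1

theorem exchangeSign_comm (a c : ZMod 2) : exchangeSign a c = exchangeSign c a := by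
  simp only [exchangeSign, and_comm]

theorem exchangeSign_mul_self (a c : ZMod 2) : exchangeSign a c * exchangeSign a c = 1 := by
  rw [exchangeSign]
  split_ifs <;> rfl

theorem exchangeSign_add_left (a a' c : ZMod 2) :
    exchangeSign (a + a') c = exchangeSign a c * exchangeSign a' c := by
  revert a a' c
  decide

theorem exchangeSign_zero_left (c : ZMod 2) : exchangeSign 0 c = 1 := by
  revert c
  decide

theorem koszulSign_eq {n : ℕ} (σ : Equiv.Perm (Fin n)) (b : Fin n → ZMod 2) :
    koszulSign σ b = ∏ i, ∏ j,
      if i < j then (if σ j < σ i then exchangeSign (b (σ i)) (b (σ j)) else 1) else 1 := by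
  refine Finset.prod_congr rfl fun i _ => Finset.prod_congr rfl fun j _ => ?_
  rw [exchangeSign]
  by_cases h1 : i < j <;> by_cases h2 : σ j < σ i <;> simp [h1, h2]

/-- A product over unordered pairs does not change under a permutation of the indices. -/
theorem prod_pairs_perm {n : ℕ} (τ : Equiv.Perm (Fin n)) (g : Fin n → Fin n → ℤ)
    (hg : ∀ i j, g i j = g j i) :
    ∏ i, ∏ j, (if i < j then g (τ i) (τ j) else 1) = ∏ i, ∏ j, if i < j then g i j else 1 := by
  have h1 : ∏ i, ∏ j, (if i < j then g (τ i) (τ j) else 1) =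
      ∏ a, ∏ c, if τ.symm a < τ.symm c then g a c else 1 := by
    symm
    rw [← Equiv.prod_comp τ]
    refine Finset.prod_congr rfl fun i _ => ?_
    rw [← Equiv.prod_comp τ]
    simp
  have h2 : ∏ a, ∏ c, (if τ.symm a < τ.symm c then g a c else 1) =
      (∏ a, ∏ c, if a < c ∧ τ.symm a < τ.symm c then g a c else 1) *
        ∏ a, ∏ c, if c < a ∧ τ.symm a < τ.symm c then g a c else 1 := by
    rw [← Finset.prod_mul_distrib]
    refine Finset.prod_congr rfl fun a _ => ?_
    rw [← Finset.prod_mul_distrib]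
    refine Finset.prod_congr rfl fun c _ => ?_
    rcases lt_trichotomy a c with h | rfl | h
    · simp [h, h.not_gt]
    · simp
    · simp [h, h.not_gt]
  rw [h1, h2, Finset.prod_comm (f := fun a c => if c < a ∧ τ.symm a < τ.symm c then g a c else 1),
    ← Finset.prod_mul_distrib]
  refine Finset.prod_congr rfl fun a _ => ?_
  rw [← Finset.prod_mul_distrib]
  refine Finset.prod_congr rfl fun c _ => ?_
  by_cases h : a < c
  · have hne : τ.symm a ≠ τ.symm c := fun h' => h.ne (τ.symm.injective h')
    rcases lt_or_gt_of_ne hne with h' | h'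
    · simp [h, h', h'.not_gt]
    · simp [h, h', h'.not_gt, hg c a]
  · simp [h]

/-- The cocycle identity of the Koszul sign. -/
theorem koszulSign_mul {n : ℕ} (σ τ : Equiv.Perm (Fin n)) (b : Fin n → ZMod 2) :
    koszulSign (σ * τ) b = koszulSign σ b * koszulSign τ (b ∘ σ) := by
  -- `g i j` is the sign contributed by the pair `{i, j}`; it is symmetric in `i` and `j`, so that
  -- the pairs may be enumerated through `τ`.
  set g : Fin n → Fin n → ℤ := fun i j =>
    if (σ j < σ i ↔ j < i) then 1 else exchangeSign (b (σ i)) (b (σ j)) with hgdef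
  have hg : ∀ i j, g i j = g j i := by
    intro i j
    simp only [hgdef]
    rcases lt_trichotomy i j with h | rfl | h
    · have hne : σ i ≠ σ j := fun h' => h.ne (σ.injective h')
      rcases lt_or_gt_of_ne hne with h' | h' <;> simp [h, h', h.not_gt, h'.not_gt]
      exact exchangeSign_comm _ _
    · rfl
    · have hne : σ j ≠ σ i := fun h' => h.ne (σ.injective h')
      rcases lt_or_gt_of_ne hne with h' | h' <;> simp [h, h', h.not_gt, h'.not_gt]
      exact exchangeSign_comm _ _
  have hσ : koszulSign σ b = ∏ i, ∏ j, if i < j then g i j else 1 := by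
    rw [koszulSign_eq]
    refine Finset.prod_congr rfl fun i _ => Finset.prod_congr rfl fun j _ => ?_
    by_cases h : i < j
    · by_cases h' : σ j < σ i <;> simp [hgdef, h, h', h.not_gt]
    · simp [h]
  rw [hσ, ← prod_pairs_perm τ g hg, koszulSign_eq, koszulSign_eq, ← Finset.prod_mul_distrib]
  refine Finset.prod_congr rfl fun i _ => ?_
  rw [← Finset.prod_mul_distrib]
  refine Finset.prod_congr rfl fun j _ => ?_
  by_cases h : i < j
  · by_cases h1 : τ j < τ i <;> by_cases h2 : σ (τ j) < σ (τ i) <;>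
      simp [hgdef, h, h1, h2, exchangeSign_mul_self]
  · simp [h]

theorem koszulSign_one {n : ℕ} (b : Fin n → ZMod 2) : koszulSign 1 b = 1 := by
  rw [koszulSign_eq]
  refine Finset.prod_eq_one fun i _ => Finset.prod_eq_one fun j _ => ?_
  by_cases h : i < j
  · simp [h, h.not_gt]
  · simp [h]

/-- The sign of moving a letter of parity `b a` past those letters of the list that precede it
in the natural order. -/
def crossSign {n : ℕ} (b : Fin n → ZMod 2) (a : Fin n) (L : List (Fin n)) : ℤ :=
  (L.map fun c => if c < a then exchangeSign (b a) (b c) else 1).prod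

/-- The Koszul sign of a list of indices: the product over its inversions. -/
def listSign {n : ℕ} (b : Fin n → ZMod 2) : List (Fin n) → ℤ
  | [] => 1
  | a :: L => crossSign b a L * listSign b L

theorem listSign_ofFn {n m : ℕ} (b : Fin n → ZMod 2) (y : Fin m → Fin n) :
    listSign b (List.ofFn y) = ∏ i, ∏ j,
      if i < j then (if y j < y i then exchangeSign (b (y i)) (b (y j)) else 1) else 1 := by
  induction m with
  | zero => simp [listSign]
  | succ m ih =>
    rw [List.ofFn_succ, listSign, ih, Fin.prod_univ_succ]
    congr 1
    · rw [Fin.prod_univ_succ, crossSign, List.map_ofFn, List.prod_ofFn]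
      simp
    · refine Finset.prod_congr rfl fun i _ => ?_
      rw [Fin.prod_univ_succ]
      simp

theorem koszulSign_eq_listSign {n : ℕ} (σ : Equiv.Perm (Fin n)) (b : Fin n → ZMod 2) :
    koszulSign σ b = listSign b (List.ofFn σ) := by
  rw [listSign_ofFn, koszulSign_eq]

section ListSign

variable {n : ℕ} (b : Fin n → ZMod 2)

theorem crossSign_append (a : Fin n) (L L' : List (Fin n)) :
    crossSign b a (L ++ L') = crossSign b a L * crossSign b a L' := by
  simp [crossSign]

theorem crossSign_of_lt {a : Fin n} {L : List (Fin n)} (h : ∀ c ∈ L, a < c) :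
    crossSign b a L = 1 := by
  refine List.prod_eq_one fun x hx => ?_
  obtain ⟨c, hc, rfl⟩ := List.mem_map.1 hx
  exact if_neg (h c hc).not_gt

theorem crossSign_of_gt {a : Fin n} {L : List (Fin n)} (h : ∀ c ∈ L, c < a) :
    crossSign b a L = exchangeSign (b a) (L.map b).sum := by
  induction L with
  | nil => simp [crossSign, exchangeSign]
  | cons c L ih =>
    have h1 := ih fun d hd => h d (List.mem_cons_of_mem _ hd)
    rw [List.map_cons, List.sum_cons, exchangeSign_comm, exchangeSign_add_left,
      exchangeSign_comm _ (b a), exchangeSign_comm _ (b a), ← h1]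
    simp [crossSign, h c List.mem_cons_self]

theorem listSign_append (L L' : List (Fin n)) :
    listSign b (L ++ L') =
      listSign b L * listSign b L' * (L.map fun a => crossSign b a L').prod := by
  induction L with
  | nil => simp [listSign]
  | cons a L ih =>
    rw [List.cons_append, listSign, ih, crossSign_append, listSign, List.map_cons, List.prod_cons]
    ring

theorem listSign_of_pairwise {L : List (Fin n)} (h : L.Pairwise (· < ·)) : listSign b L = 1 := by
  induction L with
  | nil => rfl
  | cons a L ih =>
    rw [List.pairwise_cons] at h
    rw [listSign, ih h.2, crossSign_of_lt b h.1, one_mul]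

theorem prod_crossSign_of_lt {L L' : List (Fin n)} (h : ∀ a ∈ L, ∀ c ∈ L', a < c) :
    (L.map fun a => crossSign b a L').prod = 1 := by
  refine List.prod_eq_one fun x hx => ?_
  obtain ⟨a, ha, rfl⟩ := List.mem_map.1 hx
  exact crossSign_of_lt b (h a ha)

theorem prod_crossSign_of_gt {L L' : List (Fin n)} (h : ∀ a ∈ L, ∀ c ∈ L', c < a) :
    (L.map fun a => crossSign b a L').prod = exchangeSign (L.map b).sum (L'.map b).sum := by
  induction L with
  | nil => simp [exchangeSign_zero_left]
  | cons a L ih =>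
    rw [List.map_cons, List.prod_cons, ih fun c hc => h c (List.mem_cons_of_mem _ hc),
      crossSign_of_gt b (h a List.mem_cons_self), List.map_cons, List.sum_cons,
      exchangeSign_add_left]

/-- The Koszul sign of the exchange of two adjacent initial blocks. -/
theorem listSign_swap {L₁ L₂ L₃ : List (Fin n)} (h : (L₁ ++ L₂ ++ L₃).Pairwise (· < ·)) :
    listSign b (L₂ ++ L₁ ++ L₃) = exchangeSign (L₁.map b).sum (L₂.map b).sum := by
  rw [List.pairwise_append, List.pairwise_append] at h
  obtain ⟨⟨h1, h2, h12⟩, h3, h123⟩ := h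
  rw [listSign_append, listSign_append, listSign_of_pairwise b h1, listSign_of_pairwise b h2,
    listSign_of_pairwise b h3, prod_crossSign_of_gt b fun a ha c hc => h12 c hc a ha,
    prod_crossSign_of_lt b, exchangeSign_comm]
  · simp
  · intro a ha c hc
    rcases List.mem_append.1 ha with ha | ha
    · exact h123 a (List.mem_append_right _ ha) c hc
    · exact h123 a (List.mem_append_left _ ha) c hc

end ListSign

theorem intCast_exchangeSign (R : Type*) [CommRing R] (a c : ZMod 2) :
    ((exchangeSign a c : ℤ) : R) = paritySign R (a * c) := by
  rcases zmod_two_cases a with rfl | rfl <;> rcases zmod_two_cases c with rfl | rfl <;>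
    simp [exchangeSign]

end KoszulSign

/-! ### The action of permutations on tensors -/

section KoszulPerm

variable {R V : Type*} [CommRing R] [AddCommGroup V] [Module R V]
  (𝒱 : ℤ → Submodule R V) [DirectSum.Decomposition 𝒱]

theorem parityProj_parityProj (b c : ZMod 2) (v : V) :
    parityProj 𝒱 b (parityProj 𝒱 c v) = if b = c then parityProj 𝒱 c v else 0 := by
  have : parityProj 𝒱 b ∘ₗ parityProj 𝒱 c = if b = c then parityProj 𝒱 c else 0 := by
    refine ext_homogeneous 𝒱 fun d v hv => ?_
    rw [LinearMap.comp_apply, parityProj_of_mem 𝒱 c hv]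
    by_cases h : ((d - 1 : ℤ) : ZMod 2) = c
    · rw [if_pos h, parityProj_of_mem 𝒱 b hv, h]
      by_cases h' : b = c
      · subst h'
        simp [parityProj_of_mem 𝒱 b hv, h]
      · simp [h', Ne.symm h']
    · rw [if_neg h, map_zero]
      by_cases h' : b = c
      · subst h'
        rw [if_pos rfl, parityProj_of_mem 𝒱 _ hv, if_neg h]
      · simp [h']
  have h := LinearMap.congr_fun this v
  rw [LinearMap.comp_apply] at h
  rw [h]
  split_ifs <;> rfl

/-- The letter `v` lies in the part of parity `b`, with respect to the shifted degree. -/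
def HasParity (b : ZMod 2) (v : V) : Prop := parityProj 𝒱 b v = v

theorem hasParity_of_mem {d : ℤ} {v : V} (hv : v ∈ 𝒱 d) :
    HasParity 𝒱 ((d - 1 : ℤ) : ZMod 2) v := by
  rw [HasParity, parityProj_of_mem 𝒱 _ hv, if_pos rfl]

theorem koszulPerm_tprod {n : ℕ} (σ : Equiv.Perm (Fin n)) (x : Fin n → V) (b : Fin n → ZMod 2)
    (hx : ∀ i, HasParity 𝒱 (b i) (x i)) :
    koszulPerm 𝒱 σ (PiTensorProduct.tprod R x) =
      (koszulSign σ b : R) • PiTensorProduct.tprod R fun i => x (σ i) := by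
  rw [koszulPerm, LinearMap.sum_apply, Finset.sum_eq_single b]
  · rw [LinearMap.smul_apply, PiTensorProduct.lift.tprod]
    refine congrArg _ ?_
    change PiTensorProduct.tprod R (fun i => parityProj 𝒱 (b (σ i)) (x (σ i))) = _
    congr 1
    funext i
    exact hx (σ i)
  · intro c _ hc
    obtain ⟨j, hj⟩ := Function.ne_iff.1 hc
    rw [LinearMap.smul_apply, PiTensorProduct.lift.tprod]
    have : (((PiTensorProduct.tprod R).compLinearMap fun i => parityProj 𝒱 (c (σ i))).domDomCongr σ)
        x = 0 := by
      change PiTensorProduct.tprod R (fun i => parityProj 𝒱 (c (σ i)) (x (σ i))) = 0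
      refine MultilinearMap.map_coord_zero _ (σ.symm j) ?_
      rw [σ.apply_symm_apply, ← (hx j : parityProj 𝒱 (b j) (x j) = x j), parityProj_parityProj,
        if_neg hj]
    rw [this, smul_zero]
  · intro h
    exact absurd (Finset.mem_univ _) h

/-- Linear maps on a tensor power agree if they agree on tensors with homogeneous letters. -/
theorem ext_tprod_homogeneous {Y : Type*} [AddCommGroup Y] [Module R Y] {n : ℕ}
    {A B : (⨂[R]^n V) →ₗ[R] Y}
    (h : ∀ (x : Fin n → V) (d : Fin n → ℤ), (∀ i, x i ∈ 𝒱 (d i)) →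
      A (PiTensorProduct.tprod R x) = B (PiTensorProduct.tprod R x)) : A = B := by
  have key : A ∘ₗ DirectSum.component R ℕ (fun n => ⨂[R]^n V) n =
      B ∘ₗ DirectSum.component R ℕ (fun n => ⨂[R]^n V) n := by
    refine ext_word_of_span (span_iUnion_grading 𝒱) fun l hl => ?_
    rw [LinearMap.comp_apply, LinearMap.comp_apply, word_eq_tensorOf]
    change A (DirectSum.lof R ℕ (fun n => ⨂[R]^n V) _ _ n) =
      B (DirectSum.lof R ℕ (fun n => ⨂[R]^n V) _ _ n)
    by_cases hn : l.length = n
    · subst hn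
      rw [DirectSum.lof_apply]
      have hd : ∀ i : Fin l.length, ∃ d, l.get i ∈ 𝒱 d := fun i =>
        Set.mem_iUnion.1 (hl _ (l.get_mem i))
      choose d hd using hd
      exact h _ d hd
    · rw [DirectSum.lof_eq_of, DirectSum.of_eq_of_ne _ _ _ (Ne.symm hn), map_zero, map_zero]
  refine LinearMap.ext fun t => ?_
  have h2 := LinearMap.congr_fun key (DirectSum.lof R ℕ (fun n => ⨂[R]^n V) n t)
  rwa [LinearMap.comp_apply, LinearMap.comp_apply, DirectSum.component.lof_self] at h2

theorem koszulPerm_mul {n : ℕ} (σ τ : Equiv.Perm (Fin n)) (t : ⨂[R]^n V) :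
    koszulPerm 𝒱 (σ * τ) t = koszulPerm 𝒱 τ (koszulPerm 𝒱 σ t) := by
  have : koszulPerm 𝒱 (σ * τ) = koszulPerm 𝒱 τ ∘ₗ koszulPerm (R := R) 𝒱 σ := by
    refine ext_tprod_homogeneous 𝒱 fun x d hx => ?_
    have hp := fun i => hasParity_of_mem 𝒱 (hx i)
    rw [LinearMap.comp_apply, koszulPerm_tprod 𝒱 _ x _ hp, koszulPerm_tprod 𝒱 _ x _ hp, map_smul,
      koszulPerm_tprod 𝒱 _ _ _ fun i => hp (σ i), smul_smul, koszulSign_mul, Int.cast_mul]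
    rfl
  exact LinearMap.congr_fun this t

theorem koszulPerm_one {n : ℕ} (t : ⨂[R]^n V) : koszulPerm 𝒱 1 t = t := by
  have : koszulPerm (R := R) 𝒱 (1 : Equiv.Perm (Fin n)) = LinearMap.id := by
    refine ext_tprod_homogeneous 𝒱 fun x d hx => ?_
    rw [koszulPerm_tprod 𝒱 _ x _ fun i => hasParity_of_mem 𝒱 (hx i), koszulSign_one]
    simp
  exact LinearMap.congr_fun this t

/-- The permutations that fix a given tensor form a subgroup. -/
def koszulStabilizer {n : ℕ} (t : ⨂[R]^n V) : Subgroup (Equiv.Perm (Fin n)) where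
  carrier := {σ | koszulPerm 𝒱 σ t = t}
  one_mem' := koszulPerm_one 𝒱 t
  mul_mem' := by
    intro σ τ hσ hτ
    change koszulPerm 𝒱 (σ * τ) t = t
    rw [koszulPerm_mul, hσ, hτ]
  inv_mem' := by
    intro σ hσ
    change koszulPerm 𝒱 σ⁻¹ t = t
    conv_lhs => rw [← (hσ : koszulPerm 𝒱 σ t = t)]
    rw [← koszulPerm_mul, mul_inv_cancel, koszulPerm_one]

theorem mem_koszulStabilizer {n : ℕ} {t : ⨂[R]^n V} {σ : Equiv.Perm (Fin n)} :
    σ ∈ koszulStabilizer 𝒱 t ↔ koszulPerm 𝒱 σ t = t := Iff.rfl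

end KoszulPerm

/-! ### Rotations and block exchanges as permutations -/

section Lists

theorem ofFn_finRotate_pow (n q : ℕ) :
    List.ofFn ((finRotate n) ^ q : Equiv.Perm (Fin n)) = (List.finRange n).rotate q := by
  induction q with
  | zero => simp [List.ofFn_id]
  | succ q ih =>
    rw [← List.rotate_rotate, ← ih]
    cases n with
    | zero => simp
    | succ n =>
      refine List.ext_getElem (by simp) fun k h1 h2 => ?_
      simp only [List.getElem_rotate, List.getElem_ofFn, pow_succ, Equiv.Perm.mul_apply,
        finRotate_apply]
      congr 1
      ext
      simp [Fin.val_add]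

theorem exists_perm_ofFn {n : ℕ} {L : List (Fin n)} (h : L.Perm (List.finRange n)) :
    ∃ σ : Equiv.Perm (Fin n), List.ofFn σ = L := by
  have hlen : L.length = n := by simpa using h.length_eq
  have hnd : L.Nodup := h.nodup_iff.2 (List.nodup_finRange n)
  have hmem : ∀ i, i ∈ L := fun i => h.mem_iff.2 (List.mem_finRange i)
  refine ⟨(finCongr hlen.symm).trans (hnd.getEquivOfForallMemList L hmem), ?_⟩
  refine List.ext_getElem (by simp [hlen]) fun k h1 h2 => ?_
  simp

/-- The list of indices in which the blocks `0, …, q - 1` and `q, …, p - 1` are exchanged. -/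
def blockSwapList (n p q : ℕ) : List (Fin n) :=
  ((List.finRange n).take p).drop q ++ ((List.finRange n).take p).take q ++
    (List.finRange n).drop p

theorem blockSwapList_perm (n p q : ℕ) : (blockSwapList n p q).Perm (List.finRange n) := by
  rw [blockSwapList]
  conv_rhs => rw [← List.take_append_drop p (List.finRange n)]
  refine List.Perm.append_right _ ?_
  conv_rhs => rw [← List.take_append_drop q ((List.finRange n).take p)]
  exact List.perm_append_comm

theorem ofFn_finRotate_pow_eq_blockSwapList {n q : ℕ} (hq : q ≤ n) :
    List.ofFn ((finRotate n) ^ q : Equiv.Perm (Fin n)) = blockSwapList n n q := by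
  rw [ofFn_finRotate_pow, blockSwapList, List.take_of_length_le (by simp),
    List.drop_of_length_le (i := n) (by simp), List.append_nil,
    List.rotate_eq_drop_append_take (by simpa using hq)]

theorem ofFn_swap (n : ℕ) :
    List.ofFn (Equiv.swap (0 : Fin (n + 2)) 1) = blockSwapList (n + 2) 2 1 := by
  refine List.ext_getElem ?_ fun k h1 h2 => ?_
  · simp [(blockSwapList_perm (n + 2) 2 1).length_eq]
  · rw [List.getElem_ofFn]
    have : blockSwapList (n + 2) 2 1 = 1 :: 0 :: (List.finRange (n + 2)).drop 2 := by
      rw [blockSwapList]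
      simp [List.finRange_succ]
    simp only [this]
    rcases k with _ | _ | k
    · simp
    · simp
    · rw [List.getElem_cons_succ, List.getElem_cons_succ, List.getElem_drop, List.getElem_finRange]
      rw [Equiv.swap_apply_of_ne_of_ne]
      · ext
        simp
        omega
      · simp [Fin.ext_iff]
      · simp [Fin.ext_iff]

end Lists

/-! ### Components of the comultiplication and block exchanges -/

namespace TensorSum

section Blocks

variable {R V : Type*} [CommRing R] [AddCommGroup V] [Module R V]

variable (R V) in
/-- The component of the comultiplication that splits tensors of length `a + b` into tensors of
lengths `a` and `b`. -/
def comulPart (a b : ℕ) : TensorSum R V →ₗ[R] TensorSum R V ⊗[R] TensorSum R V :=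
  TensorProduct.map (proj R V a) (proj R V b) ∘ₗ comul

theorem comulPart_word (a b : ℕ) (l : List V) :
    comulPart R V a b (word R l) =
      if l.length = a + b then word R (l.take a) ⊗ₜ word R (l.drop a) else 0 := by
  rw [comulPart, LinearMap.comp_apply, comul_word, map_sum]
  simp only [TensorProduct.map_tmul, proj_word, List.length_take, List.length_drop]
  split_ifs with h
  · rw [Finset.sum_eq_single a]
    · rw [if_pos (by omega), if_pos (by omega)]
    · intro i hi hia
      rw [Finset.mem_range] at hi
      rw [if_neg (by omega), TensorProduct.zero_tmul]
    · intro ha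
      exact absurd (Finset.mem_range.2 (by omega)) ha
  · refine Finset.sum_eq_zero fun i hi => ?_
    rw [Finset.mem_range] at hi
    by_cases h1 : a = min i l.length
    · rw [if_neg (c := b = _) (by omega), TensorProduct.tmul_zero]
    · rw [if_neg h1, TensorProduct.zero_tmul]

theorem comulPart_append {a b : ℕ} {l l' : List V} (h : l.length = a) (h' : l'.length = b) :
    comulPart R V a b (word R (l ++ l')) = word R l ⊗ₜ word R l' := by
  subst h h'
  rw [comulPart_word, if_pos (by simp), List.take_left, List.drop_left]

theorem comulPart_of_length_ne {a b : ℕ} {l : List V} (h : l.length ≠ a + b) :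
    comulPart R V a b (word R l) = 0 := by
  rw [comulPart_word, if_neg h]

/-- The coproduct of a tensor of length `n` is the sum of its components in the lengths `(a, b)`
with `a + b = n`. -/
theorem comul_proj (n : ℕ) (t : TensorSum R V) :
    comul (proj R V n t) =
      ∑ p ∈ Finset.HasAntidiagonal.antidiagonal n, comulPart R V p.1 p.2 t := by
  have : comul ∘ₗ proj R V n =
      ∑ p ∈ Finset.HasAntidiagonal.antidiagonal n, comulPart R V p.1 p.2 := by
    refine ext_word fun l => ?_
    rw [LinearMap.comp_apply, proj_word, LinearMap.sum_apply]
    by_cases h : n = l.length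
    · rw [if_pos h, comul_word, Finset.Nat.sum_antidiagonal_eq_sum_range_succ_mk, ← h]
      refine Finset.sum_congr rfl fun i hi => ?_
      rw [Finset.mem_range] at hi
      rw [comulPart_word, if_pos (by omega)]
    · rw [if_neg h, map_zero]
      refine (Finset.sum_eq_zero fun p hp => ?_).symm
      rw [Finset.HasAntidiagonal.mem_antidiagonal] at hp
      exact comulPart_of_length_ne (by omega)
  have h := LinearMap.congr_fun this t
  rwa [LinearMap.sum_apply] at h

variable (R V) in
/-- The component of the iterated comultiplication in lengths `a`, `b`, `c`. -/
def comulPart₃ (a b c : ℕ) :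
    TensorSum R V →ₗ[R] (TensorSum R V ⊗[R] TensorSum R V) ⊗[R] TensorSum R V :=
  TensorProduct.map (comulPart R V a b) LinearMap.id ∘ₗ comulPart R V (a + b) c

theorem comulPart₃_append {a b c : ℕ} {l l' l'' : List V} (h : l.length = a) (h' : l'.length = b)
    (h'' : l''.length = c) :
    comulPart₃ R V a b c (word R (l ++ l' ++ l'')) = (word R l ⊗ₜ word R l') ⊗ₜ word R l'' := by
  rw [comulPart₃, LinearMap.comp_apply, comulPart_append (by simp [h, h']) h'',
    TensorProduct.map_tmul, comulPart_append h h']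
  rfl

theorem comulPart₃_of_length_ne {a b c : ℕ} {l : List V} (h : l.length ≠ a + b + c) :
    comulPart₃ R V a b c (word R l) = 0 := by
  rw [comulPart₃, LinearMap.comp_apply, comulPart_of_length_ne h, map_zero]

variable (R V) in
/-- The product of two tensors as a linear map. -/
def mulTwo : TensorSum R V ⊗[R] TensorSum R V →ₗ[R] TensorSum R V :=
  LinearMap.mul' R (TensorSum R V)

@[simp] theorem mulTwo_tmul (s t : TensorSum R V) : mulTwo R V (s ⊗ₜ t) = s * t := rfl

variable (R V) in
/-- The product of three tensors as a linear map. -/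
def mulThree : (TensorSum R V ⊗[R] TensorSum R V) ⊗[R] TensorSum R V →ₗ[R] TensorSum R V :=
  mulTwo R V ∘ₗ TensorProduct.map (mulTwo R V) LinearMap.id

@[simp] theorem mulThree_tmul (s t u : TensorSum R V) :
    mulThree R V ((s ⊗ₜ t) ⊗ₜ u) = s * t * u := rfl

theorem exists_append_eq {X : Type*} {l : List X} {a b c : ℕ} (h : l.length = a + b + c) :
    ∃ l₁ l₂ l₃ : List X, l = l₁ ++ l₂ ++ l₃ ∧ l₁.length = a ∧ l₂.length = b ∧ l₃.length = c := by
  refine ⟨(l.take (a + b)).take a, (l.take (a + b)).drop a, l.drop (a + b), ?_, ?_, ?_, ?_⟩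
  · rw [List.take_append_drop, List.take_append_drop]
  all_goals simp; omega

theorem mulThree_comulPart₃ {a b c n : ℕ} (hn : a + b + c = n) (t : TensorSum R V) :
    mulThree R V (comulPart₃ R V a b c t) = proj R V n t := by
  have : mulThree R V ∘ₗ comulPart₃ R V a b c = proj R V n := by
    refine ext_word fun l => ?_
    rw [LinearMap.comp_apply, proj_word]
    split_ifs with h
    · obtain ⟨l₁, l₂, l₃, rfl, h1, h2, h3⟩ := exists_append_eq (h.symm.trans hn.symm)
      rw [comulPart₃_append h1 h2 h3, mulThree_tmul, word_append, word_append]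
    · rw [comulPart₃_of_length_ne (by omega), map_zero]
  exact LinearMap.congr_fun this t

theorem comulPart_proj {a b n : ℕ} (hn : a + b = n) (t : TensorSum R V) :
    comulPart R V a b (proj R V n t) = comulPart R V a b t := by
  have : comulPart R V a b ∘ₗ proj R V n = comulPart R V a b := by
    refine ext_word fun l => ?_
    rw [LinearMap.comp_apply, proj_word]
    split_ifs with h
    · rfl
    · rw [comulPart_of_length_ne (by omega), map_zero]
  exact LinearMap.congr_fun this t

theorem comulPart₃_proj {a b c n : ℕ} (hn : a + b + c = n) (t : TensorSum R V) :
    comulPart₃ R V a b c (proj R V n t) = comulPart₃ R V a b c t := by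
  rw [comulPart₃, LinearMap.comp_apply, comulPart_proj hn, LinearMap.comp_apply]

variable (𝒱 : ℤ → Submodule R V) [DirectSum.Decomposition 𝒱]

theorem ext_word_homogeneous {Y : Type*} [AddCommGroup Y] [Module R Y]
    {A B : TensorSum R V →ₗ[R] Y}
    (h : ∀ l : List (ℤ × V), IsHomogeneous 𝒱 l →
      A (word R (l.map Prod.snd)) = B (word R (l.map Prod.snd))) : A = B := by
  refine ext_tensorDegree 𝒱 fun p t ht => ?_
  have h1 : tensorDegree 𝒱 p ≤ LinearMap.ker (A - B) := by
    refine tensorDegree_le 𝒱 fun l hl _ => ?_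
    rw [LinearMap.mem_ker, LinearMap.sub_apply, h l hl, sub_self]
  have h2 := h1 ht
  rwa [LinearMap.mem_ker, LinearMap.sub_apply, sub_eq_zero] at h2

/-- The action of a permutation on the tensors of length `n`, extended by zero to other lengths. -/
def permTensor {n : ℕ} (σ : Equiv.Perm (Fin n)) : TensorSum R V →ₗ[R] TensorSum R V :=
  DirectSum.lof R ℕ (fun n => ⨂[R]^n V) n ∘ₗ koszulPerm 𝒱 σ ∘ₗ
    DirectSum.component R ℕ (fun n => ⨂[R]^n V) n

variable {n : ℕ}

theorem permTensor_apply (σ : Equiv.Perm (Fin n)) (t : TensorSum R V) :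
    permTensor 𝒱 σ t = DirectSum.lof R ℕ (fun n => ⨂[R]^n V) n (koszulPerm 𝒱 σ (t n)) := rfl

theorem permTensor_eq_iff (σ : Equiv.Perm (Fin n)) (t : TensorSum R V) :
    permTensor 𝒱 σ t = proj R V n t ↔ koszulPerm 𝒱 σ (t n) = t n := by
  rw [permTensor_apply, proj_apply]
  refine ⟨fun h => ?_, fun h => by rw [h]⟩
  have := congrArg (fun u : TensorSum R V => u n) h
  simpa only [DirectSum.lof_apply] using this

theorem permTensor_one (t : TensorSum R V) :
    permTensor 𝒱 (1 : Equiv.Perm (Fin n)) t = proj R V n t := by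
  rw [permTensor_eq_iff, koszulPerm_one]

theorem permTensor_mul (σ τ : Equiv.Perm (Fin n)) (t : TensorSum R V) :
    permTensor 𝒱 (σ * τ) t = permTensor 𝒱 τ (permTensor 𝒱 σ t) := by
  rw [permTensor_apply, permTensor_apply, permTensor_apply, DirectSum.lof_apply, koszulPerm_mul]

theorem permTensor_proj (σ : Equiv.Perm (Fin n)) (t : TensorSum R V) :
    permTensor 𝒱 σ (proj R V n t) = permTensor 𝒱 σ t := by
  rw [permTensor_apply, permTensor_apply, proj_apply_apply, if_pos rfl]

theorem proj_permTensor (σ : Equiv.Perm (Fin n)) (t : TensorSum R V) :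
    proj R V n (permTensor 𝒱 σ t) = permTensor 𝒱 σ t := by
  rw [permTensor_apply, proj_lof, if_pos rfl]

theorem permTensor_word_of_ne (σ : Equiv.Perm (Fin n)) {l : List V} (h : l.length ≠ n) :
    permTensor 𝒱 σ (word R l) = 0 := by
  rw [← permTensor_proj, proj_word, if_neg (Ne.symm h), map_zero]

theorem permTensor_tensorOf (σ : Equiv.Perm (Fin n)) (x : Fin n → V) (d : Fin n → ℤ)
    (hx : ∀ i, x i ∈ 𝒱 (d i)) :
    permTensor 𝒱 σ (tensorOf n x) =
      (koszulSign σ (fun i => ((d i - 1 : ℤ) : ZMod 2)) : R) • tensorOf n fun i => x (σ i) := by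
  rw [permTensor_apply]
  have : (tensorOf n x : TensorSum R V) n = PiTensorProduct.tprod R x :=
    DirectSum.lof_apply (R := R) (M := fun n => ⨂[R]^n V) n _
  rw [this, koszulPerm_tprod 𝒱 σ x _ fun i => hasParity_of_mem 𝒱 (hx i), map_smul]
  rfl

/-- The permutation `σ` moves the block of the first `q` letters behind the next `r` letters. -/
def IsBlockSwap (σ : Equiv.Perm (Fin n)) (q r : ℕ) : Prop :=
  List.ofFn σ = blockSwapList n (q + r) q

theorem permTensor_word {σ : Equiv.Perm (Fin n)} {q r : ℕ} (hσ : IsBlockSwap σ q r)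
    {l₁ l₂ l₃ : List (ℤ × V)} (hl : IsHomogeneous 𝒱 (l₁ ++ l₂ ++ l₃)) (h₁ : l₁.length = q)
    (h₂ : l₂.length = r) (hn : (l₁ ++ l₂ ++ l₃).length = n) :
    permTensor 𝒱 σ (word R ((l₁ ++ l₂ ++ l₃).map Prod.snd)) =
      paritySign R ((shiftedDegree l₁ : ZMod 2) * (shiftedDegree l₂ : ZMod 2)) •
        word R ((l₂ ++ l₁ ++ l₃).map Prod.snd) := by
  set L := l₁ ++ l₂ ++ l₃ with hL
  subst hn
  set F := List.finRange L.length with hF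
  have hmap : F.map L.get = L := by
    rw [hF, ← List.ofFn_eq_map]
    exact List.ofFn_get L
  have e12 : (F.take (q + r)).map L.get = l₁ ++ l₂ := by
    rw [List.map_take, hmap, hL, List.take_left' (by simp [h₁, h₂])]
  have e1 : ((F.take (q + r)).take q).map L.get = l₁ := by
    rw [List.map_take, e12, List.take_left' h₁]
  have e2 : ((F.take (q + r)).drop q).map L.get = l₂ := by
    rw [List.map_drop, e12, List.drop_left' h₁]
  have e3 : (F.drop (q + r)).map L.get = l₃ := by
    rw [List.map_drop, hmap, hL, List.drop_left' (by simp [h₁, h₂])]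
  have hpair : ((F.take (q + r)).take q ++ (F.take (q + r)).drop q ++ F.drop (q + r)).Pairwise
      (· < ·) := by
    rw [List.take_append_drop, List.take_append_drop, hF]
    exact List.pairwise_lt_finRange _
  have hword : word R (L.map Prod.snd) = tensorOf L.length fun i => (L.get i).2 := by
    rw [tensorOf_eq_word]
    congr 1
    refine List.ext_getElem (by simp) fun k h1 h2 => by simp
  have hdeg : ∀ K : List (Fin L.length),
      (K.map fun i => (((L.get i).1 - 1 : ℤ) : ZMod 2)).sum =
        (shiftedDegree (K.map L.get) : ZMod 2) := by
    intro K
    induction K with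
    | nil => simp [shiftedDegree]
    | cons i K ih =>
      have : shiftedDegree (L.get i :: K.map L.get) =
        (L.get i).1 - 1 + shiftedDegree (K.map L.get) := by simp [shiftedDegree]
      rw [List.map_cons, List.sum_cons, ih, List.map_cons, this, Int.cast_add]
  rw [hword, permTensor_tensorOf 𝒱 σ _ (fun i => (L.get i).1) fun i => hl _ (L.get_mem i),
    koszulSign_eq_listSign, hσ, blockSwapList, listSign_swap _ hpair, intCast_exchangeSign, hdeg,
    hdeg, e1, e2, tensorOf_eq_word]
  refine congrArg _ (congrArg _ ?_)
  have : (List.ofFn fun i => (L.get (σ i)).2) = (List.ofFn σ).map fun i => (L.get i).2 := by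
    rw [List.map_ofFn]
    rfl
  rw [this, hσ, blockSwapList]
  have h2 : (fun i => (L.get i).2) = Prod.snd ∘ L.get := rfl
  rw [h2, ← List.map_map, ← hF, List.map_append, List.map_append (l₁ := List.drop _ _), e1, e2,
    e3]

/-- A subgroup that contains all exchanges of adjacent initial blocks is everything: the full
rotation and the transposition of the first two letters are such exchanges. -/
theorem _root_.Subgroup.eq_top_of_isBlockSwap (H : Subgroup (Equiv.Perm (Fin n)))
    (h : ∀ (σ : Equiv.Perm (Fin n)) (q r s : ℕ), q + r + s = n → IsBlockSwap σ q r → σ ∈ H) :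
    H = ⊤ := by
  rcases n with _ | _ | n
  · exact Subsingleton.elim _ _
  · rw [eq_top_iff]
    rintro σ -
    have : σ = 1 := Equiv.ext fun i => Fin.ext (by omega)
    rw [this]
    exact H.one_mem
  · rw [eq_top_iff, ← Equiv.Perm.closure_cycle_adjacent_swap
      (isCycle_finRotate (n := n)) support_finRotate 0, Subgroup.closure_le]
    rintro σ (rfl | hσ)
    · refine h _ 1 (n + 1) 0 (by omega) ?_
      have := ofFn_finRotate_pow_eq_blockSwapList (n := n + 2) (q := 1) (by omega)
      rw [pow_one] at this
      rw [IsBlockSwap, this]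
      congr 1
      omega
    · rw [Set.mem_singleton_iff] at hσ
      subst hσ
      refine h _ 1 1 n (by omega) ?_
      have := ofFn_swap n
      rw [IsBlockSwap, ← this]
      simp

end Blocks

end TensorSum

/-! ### Cyclic and symmetric tensors in terms of the comultiplication -/

namespace TensorSum

section Invariants

variable {R V W : Type*} [Field R] [AddCommGroup V] [Module R V]
  [AddCommGroup W] [Module R W]
  (𝒱 : ℤ → Submodule R V) [DirectSum.Decomposition 𝒱]
  (𝒲 : ℤ → Submodule R W) [DirectSum.Decomposition 𝒲]

variable {n : ℕ}

section CharZero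

variable [CharZero R]

theorem gradedSwap_word {l₁ l₂ : List (ℤ × V)} (h₁ : IsHomogeneous 𝒱 l₁)
    (h₂ : IsHomogeneous 𝒱 l₂) :
    gradedSwap 𝒱 (word R (l₁.map Prod.snd) ⊗ₜ word R (l₂.map Prod.snd)) =
      paritySign R ((shiftedDegree l₁ : ZMod 2) * (shiftedDegree l₂ : ZMod 2)) •
        (word R (l₂.map Prod.snd) ⊗ₜ word R (l₁.map Prod.snd)) :=
  gradedSwap_of_sign 𝒱 (tensorSign_of_mem 𝒱 (word_mem_tensorDegree 𝒱 h₁))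
    (tensorSign_of_mem 𝒱 (word_mem_tensorDegree 𝒱 h₂))

/-- The exchange of adjacent initial blocks in terms of the iterated comultiplication. -/
theorem gradedSwap_comulPart₃ {σ : Equiv.Perm (Fin n)} {q r s : ℕ} (hn : q + r + s = n)
    (hσ : IsBlockSwap σ q r) (t : TensorSum R V) :
    TensorProduct.map (gradedSwap 𝒱) LinearMap.id (comulPart₃ R V q r s t) =
      comulPart₃ R V r q s (permTensor 𝒱 σ t) := by
  have : TensorProduct.map (gradedSwap 𝒱) LinearMap.id ∘ₗ comulPart₃ R V q r s =
      comulPart₃ R V r q s ∘ₗ permTensor 𝒱 σ := by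
    refine ext_word_homogeneous 𝒱 fun l hl => ?_
    simp only [LinearMap.comp_apply]
    by_cases h : l.length = n
    · obtain ⟨l₁, l₂, l₃, rfl, h1, h2, h3⟩ := exists_append_eq (h.trans hn.symm)
      rw [permTensor_word 𝒱 hσ hl h1 h2 h, map_smul, List.map_append, List.map_append,
        List.map_append, List.map_append, comulPart₃_append (by simpa using h1) (by simpa using h2)
        (by simpa using h3), comulPart₃_append (by simpa using h2) (by simpa using h1)
        (by simpa using h3), TensorProduct.map_tmul,
        gradedSwap_word 𝒱 (fun y hy => hl y (by simp [hy])) (fun y hy => hl y (by simp [hy])),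
        TensorProduct.smul_tmul']
      rfl
    · rw [permTensor_word_of_ne 𝒱 σ (by simpa using h), map_zero,
        comulPart₃_of_length_ne (by simp; omega), map_zero]
  exact LinearMap.congr_fun this t

theorem gradedSwap_comulPart {σ : Equiv.Perm (Fin n)} {q r : ℕ} (hn : q + r = n)
    (hσ : IsBlockSwap σ q r) (t : TensorSum R V) :
    gradedSwap 𝒱 (comulPart R V q r t) = comulPart R V r q (permTensor 𝒱 σ t) := by
  have : gradedSwap 𝒱 ∘ₗ comulPart R V q r = comulPart R V r q ∘ₗ permTensor 𝒱 σ := by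
    refine ext_word_homogeneous 𝒱 fun l hl => ?_
    simp only [LinearMap.comp_apply]
    by_cases h : l.length = n
    · obtain ⟨l₁, l₂, l₃, rfl, h1, h2, h3⟩ := exists_append_eq (c := 0) (h.trans hn.symm)
      obtain rfl := List.length_eq_zero_iff.1 h3
      rw [permTensor_word 𝒱 hσ hl h1 h2 h, map_smul, List.append_nil, List.append_nil,
        List.map_append, List.map_append, comulPart_append (by simpa using h1) (by simpa using h2),
        comulPart_append (by simpa using h2) (by simpa using h1),
        gradedSwap_word 𝒱 (fun y hy => hl y (by simp [hy])) (fun y hy => hl y (by simp [hy]))]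
    · rw [permTensor_word_of_ne 𝒱 σ (by simpa using h), map_zero,
        comulPart_of_length_ne (by simp; omega), map_zero]
  exact LinearMap.congr_fun this t

theorem permTensor_eq_mulThree {σ : Equiv.Perm (Fin n)} {q r s : ℕ} (hn : q + r + s = n)
    (hσ : IsBlockSwap σ q r) (t : TensorSum R V) :
    permTensor 𝒱 σ t = mulThree R V
      (TensorProduct.map (gradedSwap 𝒱) LinearMap.id (comulPart₃ R V q r s t)) := by
  rw [gradedSwap_comulPart₃ 𝒱 hn hσ, mulThree_comulPart₃ (n := n) (by omega) _, proj_permTensor]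

end CharZero

theorem tensorSign_proj (n : ℕ) (t : TensorSum R V) :
    tensorSign 𝒱 (proj R V n t) = proj R V n (tensorSign 𝒱 t) := (proj_map _ n t).symm

theorem gradedSwap_map_proj (a b : ℕ) (z : TensorSum R V ⊗[R] TensorSum R V) :
    gradedSwap 𝒱 (TensorProduct.map (proj R V a) (proj R V b) z) =
      TensorProduct.map (proj R V b) (proj R V a) (gradedSwap 𝒱 z) := by
  induction z using TensorProduct.induction_on with
  | zero => simp
  | add x y hx hy => simp only [map_add, hx, hy]
  | tmul a b => simp [gradedSwap_tmul, tensorSign_proj]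

theorem isBlockSwap_finRotate (m : ℕ) : IsBlockSwap (finRotate (m + 1)) 1 m := by
  have h := ofFn_finRotate_pow_eq_blockSwapList (n := m + 1) (q := 1) (by omega)
  rw [pow_one] at h
  rw [IsBlockSwap, h, add_comm 1 m]

theorem isBlockSwap_finRotate_pow {q r : ℕ} (hn : q + r = n) :
    IsBlockSwap (finRotate n ^ q) q r := by
  rw [IsBlockSwap, ofFn_finRotate_pow_eq_blockSwapList (by omega), hn]

theorem mulTwo_comulPart {a b : ℕ} (hn : a + b = n) (t : TensorSum R V) :
    mulTwo R V (comulPart R V a b t) = proj R V n t := by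
  have : mulTwo R V ∘ₗ comulPart R V a b = proj R V n := by
    refine ext_word fun l => ?_
    rw [LinearMap.comp_apply, proj_word, comulPart_word]
    split_ifs with h h' h'
    · rw [mulTwo_tmul, ← word_append, List.take_append_drop]
    · omega
    · omega
    · rw [map_zero]
  exact LinearMap.congr_fun this t

theorem mem_of_forall_proj_mem (S : Submodule R (TensorSum R V)) {t : TensorSum R V}
    (h : ∀ n, proj R V n t ∈ S) : t ∈ S := by
  obtain ⟨N, hN⟩ := exists_forall_proj_eq_zero t
  rw [eq_sum_proj hN]
  exact S.sum_mem fun n _ => h n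

theorem swapDefect_proj (p : ℕ) :
    swapDefect 𝒱 ∘ₗ proj R V p = ∑ x ∈ Finset.HasAntidiagonal.antidiagonal p,
      (gradedSwap 𝒱 ∘ₗ comulPart R V x.1 x.2 - comulPart R V x.2 x.1) := by
  refine LinearMap.ext fun t => ?_
  rw [LinearMap.comp_apply, swapDefect, LinearMap.sub_apply, LinearMap.comp_apply, comul_proj,
    map_sum, LinearMap.sum_apply]
  simp only [LinearMap.sub_apply, LinearMap.comp_apply, Finset.sum_sub_distrib]
  congr 1
  exact (Finset.Nat.sum_antidiagonal_swap (f := fun x : ℕ × ℕ => comulPart R V x.1 x.2 t)).symm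

/-- Cyclic invariance is graded cocommutativity. -/
theorem cyclicTensors_eq [CharZero R] : cyclicTensors 𝒱 = LinearMap.ker (swapDefect 𝒱) := by
  ext t
  constructor
  · intro ht
    have hrot : ∀ n q : ℕ, permTensor 𝒱 (finRotate n ^ q) t = proj R V n t := by
      intro n q
      have h1 : finRotate n ∈ koszulStabilizer 𝒱 (t n) := ht n
      exact (permTensor_eq_iff 𝒱 _ t).2 (Subgroup.pow_mem _ h1 q)
    refine mem_of_forall_proj_mem _ fun n => ?_
    have h := LinearMap.congr_fun (swapDefect_proj 𝒱 n) t
    rw [LinearMap.comp_apply] at h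
    rw [LinearMap.mem_ker, h, LinearMap.sum_apply]
    refine Finset.sum_eq_zero fun x hx => ?_
    rw [Finset.HasAntidiagonal.mem_antidiagonal] at hx
    rw [LinearMap.sub_apply, LinearMap.comp_apply,
      gradedSwap_comulPart 𝒱 hx (isBlockSwap_finRotate_pow hx), hrot, comulPart_proj (by omega),
      sub_self]
  · intro ht n
    rcases n with _ | m
    · have : finRotate 0 = 1 := Subsingleton.elim _ _
      rw [this, koszulPerm_one]
    · rw [LinearMap.mem_ker, swapDefect, LinearMap.sub_apply, LinearMap.comp_apply, sub_eq_zero]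
        at ht
      rw [← permTensor_eq_iff, ← proj_permTensor, ← mulTwo_comulPart (a := m) (b := 1) rfl,
        ← gradedSwap_comulPart 𝒱 (by omega) (isBlockSwap_finRotate m), comulPart,
        LinearMap.comp_apply, gradedSwap_map_proj, ht]
      exact mulTwo_comulPart rfl t

theorem comulPart₃_eq (a b c : ℕ) (t : TensorSum R V) :
    comulPart₃ R V a b c t =
      TensorProduct.map (TensorProduct.map (proj R V a) (proj R V b)) (proj R V c)
        (TensorProduct.map comul LinearMap.id (comul t)) := by
  change TensorProduct.map (comulPart R V a b) LinearMap.id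
    (TensorProduct.map (proj R V (a + b)) (proj R V c) (comul t)) = _
  generalize comul t = z
  induction z using TensorProduct.induction_on with
  | zero => simp
  | add x y hx hy => simp only [map_add, hx, hy]
  | tmul x y =>
    have h := comulPart_proj (a := a) (b := b) rfl x
    simp only [TensorProduct.map_tmul, h, LinearMap.id_apply]
    rfl

/-- Invariance under all permutations is invariance under exchanges of adjacent initial blocks. -/
theorem symmetricTensors_eq [CharZero R] :
    symmetricTensors 𝒱 = LinearMap.ker (initialSwapDefect 𝒱) := by
  ext t
  constructor
  · intro ht
    have hperm : ∀ (n : ℕ) (σ : Equiv.Perm (Fin n)), permTensor 𝒱 σ t = proj R V n t :=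
      fun n σ => (permTensor_eq_iff 𝒱 σ t).2 (ht n σ)
    refine mem_of_forall_proj_mem _ fun n => ?_
    rw [LinearMap.mem_ker, initialSwapDefect, LinearMap.comp_apply, comul_proj, map_sum]
    refine Finset.sum_eq_zero fun x hx => ?_
    obtain ⟨p, s⟩ := x
    rw [Finset.HasAntidiagonal.mem_antidiagonal] at hx
    have h1 : TensorProduct.map (swapDefect 𝒱) LinearMap.id (comulPart R V p s t) =
        TensorProduct.map (swapDefect 𝒱 ∘ₗ proj R V p) LinearMap.id (comulPart R V p s t) := by
      rw [comulPart, LinearMap.comp_apply]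
      generalize comul t = z
      induction z using TensorProduct.induction_on with
      | zero => simp
      | add x y hx hy => simp only [map_add, hx, hy]
      | tmul x y => simp [proj_proj]
    change TensorProduct.map (swapDefect 𝒱) LinearMap.id (comulPart R V p s t) = 0
    -- Decompose the first factor of the coproduct further into lengths `(q, r)`.
    have h2 : ∀ A : TensorSum R V →ₗ[R] TensorSum R V ⊗[R] TensorSum R V,
        TensorProduct.map A LinearMap.id (comulPart R V p s t) =
          LinearMap.rTensorHom (TensorSum R V) A (comulPart R V p s t) := fun A => rfl
    rw [h1, swapDefect_proj, h2, map_sum, LinearMap.sum_apply]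
    refine Finset.sum_eq_zero fun y hy => ?_
    obtain ⟨q, r⟩ := y
    rw [Finset.HasAntidiagonal.mem_antidiagonal] at hy
    dsimp only at hx hy ⊢
    obtain ⟨σ, hσ⟩ := exists_perm_ofFn (blockSwapList_perm n (q + r) q)
    have h3 := gradedSwap_comulPart₃ 𝒱 (s := s) (by omega) hσ t
    rw [hperm, comulPart₃_proj (by omega)] at h3
    rw [map_sub, LinearMap.sub_apply, ← h2, ← h2, sub_eq_zero]
    subst hy
    rw [comulPart₃, comulPart₃, LinearMap.comp_apply, LinearMap.comp_apply, TensorProduct.map_map,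
      LinearMap.comp_id, add_comm r q] at h3
    exact h3
  · intro ht n
    have key : koszulStabilizer 𝒱 (t n) = ⊤ := by
      refine Subgroup.eq_top_of_isBlockSwap _ fun σ q r s hn hσ => ?_
      rw [mem_koszulStabilizer, ← permTensor_eq_iff, permTensor_eq_mulThree 𝒱 hn hσ,
        ← mulThree_comulPart₃ (a := r) (b := q) (c := s) (by omega), comulPart₃_eq, comulPart₃_eq]
      congr 1
      rw [LinearMap.mem_ker, initialSwapDefect, LinearMap.comp_apply] at ht
      have h1 : ∀ z : TensorSum R V ⊗[R] TensorSum R V,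
          TensorProduct.map (gradedSwap 𝒱) LinearMap.id
            (TensorProduct.map (TensorProduct.map (proj R V q) (proj R V r)) (proj R V s)
              (TensorProduct.map comul LinearMap.id z)) -
          TensorProduct.map (TensorProduct.map (proj R V r) (proj R V q)) (proj R V s)
              (TensorProduct.map comul LinearMap.id z) =
          TensorProduct.map (TensorProduct.map (proj R V r) (proj R V q)) (proj R V s)
            (TensorProduct.map (swapDefect 𝒱) LinearMap.id z) := by
        intro z
        induction z using TensorProduct.induction_on with
        | zero => simp
        | add x y hx hy =>
          simp only [map_add, ← hx, ← hy]
          abel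
        | tmul x y =>
          simp only [TensorProduct.map_tmul, gradedSwap_map_proj, swapDefect, LinearMap.sub_apply,
            LinearMap.comp_apply, map_sub, TensorProduct.sub_tmul, LinearMap.id_apply]
      rw [← sub_eq_zero, h1, ht, map_zero]
    intro σ
    have : σ ∈ koszulStabilizer 𝒱 (t n) := key ▸ Subgroup.mem_top σ
    exact this

end Invariants

end TensorSum

/-! ### Equivariant maps and averaging -/

namespace TensorSum

section Equivariant

variable {R V W : Type*} [Field R] [AddCommGroup V] [Module R V]
  [AddCommGroup W] [Module R W]
  (𝒱 : ℤ → Submodule R V) [DirectSum.Decomposition 𝒱]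
  (𝒲 : ℤ → Submodule R W) [DirectSum.Decomposition 𝒲]

/-- A linear map between tensor algebras that preserves the length of tensors and commutes with
permutations. (The case `σ = 1` of the condition is the preservation of length.) -/
def IsPermEquivariant (A : TensorSum R V →ₗ[R] TensorSum R W) : Prop :=
  ∀ (n : ℕ) (σ : Equiv.Perm (Fin n)) (t : TensorSum R V),
    A (permTensor 𝒱 σ t) = permTensor 𝒲 σ (A t)

variable {𝒱 𝒲}

theorem IsPermEquivariant.proj {A : TensorSum R V →ₗ[R] TensorSum R W}
    (hA : IsPermEquivariant 𝒱 𝒲 A) (n : ℕ) (t : TensorSum R V) :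
    A (proj R V n t) = TensorSum.proj R W n (A t) := by
  rw [← permTensor_one 𝒱, ← permTensor_one 𝒲, hA]

theorem isPermEquivariant_map {h : V →ₗ[R] W} (hh : ∀ d, ∀ v ∈ 𝒱 d, h v ∈ 𝒲 d) :
    IsPermEquivariant 𝒱 𝒲 (map h) := by
  intro n σ t
  have key : map h ∘ₗ permTensor 𝒱 σ = permTensor 𝒲 σ ∘ₗ map h := by
    refine ext_word_homogeneous 𝒱 fun l hl => ?_
    simp only [LinearMap.comp_apply]
    by_cases hn : l.length = n
    · subst hn
      have hword : word R (l.map Prod.snd) = tensorOf l.length fun i => (l.get i).2 := by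
        rw [tensorOf_eq_word]
        congr 1
        refine List.ext_getElem (by simp) fun k h1 h2 => by simp
      have hmap : ∀ x : Fin l.length → V,
          map h (tensorOf l.length x) = tensorOf l.length fun i => h (x i) := by
        intro x
        rw [tensorOf_eq_word, map_word, List.map_ofFn, tensorOf_eq_word]
        rfl
      have hd : ∀ i : Fin l.length, (l.get i).2 ∈ 𝒱 (l.get i).1 := fun i => hl _ (l.get_mem i)
      rw [hword, permTensor_tensorOf 𝒱 σ _ _ hd, map_smul, hmap, hmap,
        permTensor_tensorOf 𝒲 σ _ _ fun i => hh _ _ (hd i)]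
    · rw [permTensor_word_of_ne 𝒱 σ (by simpa using hn), map_zero, map_word,
        permTensor_word_of_ne 𝒲 σ (by simpa using hn)]
  exact LinearMap.congr_fun key t

theorem isPermEquivariant_degreeProj (p : ℤ) : IsPermEquivariant 𝒱 𝒱 (degreeProj 𝒱 p) := by
  intro n σ t
  have key : degreeProj 𝒱 p ∘ₗ permTensor 𝒱 σ = permTensor 𝒱 σ ∘ₗ degreeProj 𝒱 p := by
    refine ext_tensorDegree 𝒱 fun q t ht => ?_
    have hmem : tensorDegree 𝒱 q ≤ (tensorDegree 𝒱 q).comap (permTensor 𝒱 σ) := by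
      rw [tensorDegree, Submodule.span_le]
      rintro _ ⟨m, d, x, hx, hd, rfl⟩
      change permTensor 𝒱 σ _ ∈ tensorDegree 𝒱 q
      by_cases hm : m = n
      · subst hm
        rw [permTensor_tensorOf 𝒱 σ x d hx]
        refine Submodule.smul_mem _ _ (Submodule.subset_span
          ⟨m, fun i => d (σ i), fun i => x (σ i), fun i => hx (σ i), ?_, rfl⟩)
        rw [← hd]
        exact Equiv.sum_comp σ fun i => d i - 1
      · rw [tensorOf_eq_word, permTensor_word_of_ne 𝒱 σ (by simpa using hm)]
        exact Submodule.zero_mem _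
    simp only [LinearMap.comp_apply]
    rw [degreeProj_of_mem 𝒱 ht, degreeProj_of_mem 𝒱 (hmem ht)]
    split_ifs <;> simp
  exact LinearMap.congr_fun key t

section Derivation

variable [CharZero R] {D : TensorSum R V →ₗ[R] TensorSum R V}

/-- A length preserving odd coderivation that is also a derivation commutes with permutations. -/
theorem isPermEquivariant_of_derivation
    (hD : ∀ t, tensorSign 𝒱 (D t) = -D (tensorSign 𝒱 t))
    (hc : comul ∘ₗ D = tensorSquareDifferential 𝒱 D ∘ₗ comul)
    (hder : ∀ s t, D (s * t) = D s * t + tensorSign 𝒱 s * D t)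
    (hlen : ∀ n t, D (proj R V n t) = proj R V n (D t)) : IsPermEquivariant 𝒱 𝒱 D := by
  have h2 : ∀ a b t, comulPart R V a b (D t) =
      tensorSquareDifferential 𝒱 D (comulPart R V a b t) := by
    intro a b t
    have h := LinearMap.congr_fun hc t
    rw [LinearMap.comp_apply, LinearMap.comp_apply] at h
    rw [comulPart, LinearMap.comp_apply, h, LinearMap.comp_apply]
    generalize comul t = z
    induction z using TensorProduct.induction_on with
    | zero => simp
    | add x y hx hy => simp only [map_add, hx, hy]
    | tmul x y =>
      simp [tensorSquareDifferential, hlen, tensorSign_proj]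
  have hs : ∀ a b t, comulPart R V a b (tensorSign 𝒱 t) =
      TensorProduct.map (tensorSign 𝒱) (tensorSign 𝒱) (comulPart R V a b t) := by
    intro a b t
    rw [comulPart, LinearMap.comp_apply, comul_tensorSign, LinearMap.comp_apply]
    generalize comul t = z
    induction z using TensorProduct.induction_on with
    | zero => simp
    | add x y hx hy => simp only [map_add, hx, hy]
    | tmul x y => simp [tensorSign_proj]
  -- `D₃` is the map induced by `D` on threefold tensors.
  set D₃ := TensorProduct.map (tensorSquareDifferential 𝒱 D) LinearMap.id +
    TensorProduct.map (TensorProduct.map (tensorSign 𝒱) (tensorSign 𝒱)) D with hD₃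
  have h3 : ∀ a b c t, comulPart₃ R V a b c (D t) = D₃ (comulPart₃ R V a b c t) := by
    intro a b c t
    rw [comulPart₃, LinearMap.comp_apply, h2, LinearMap.comp_apply]
    generalize comulPart R V (a + b) c t = z
    induction z using TensorProduct.induction_on with
    | zero => simp
    | add x y hx hy => simp only [map_add, hx, hy]
    | tmul x y =>
      rw [tensorSquareDifferential, LinearMap.add_apply, map_add, TensorProduct.map_tmul,
        TensorProduct.map_tmul, TensorProduct.map_tmul, TensorProduct.map_tmul,
        TensorProduct.map_tmul, h2, hs]
      rfl
  have hsw : ∀ z, TensorProduct.map (gradedSwap 𝒱) LinearMap.id (D₃ z) =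
      D₃ (TensorProduct.map (gradedSwap 𝒱) LinearMap.id z) := by
    intro z
    induction z using TensorProduct.induction_on with
    | zero => simp
    | add x y hx hy => simp only [map_add, hx, hy]
    | tmul x y =>
      rw [hD₃, LinearMap.add_apply, map_add, TensorProduct.map_tmul,
        TensorProduct.map_tmul, TensorProduct.map_tmul, TensorProduct.map_tmul,
        gradedSwap_differential 𝒱 hD, gradedSwap_map_sign]
      rfl
  have hmul : ∀ z, mulThree R V (D₃ z) = D (mulThree R V z) := by
    have : mulThree R V ∘ₗ D₃ = D ∘ₗ mulThree R V := by
      refine TensorProduct.ext_threefold fun x y z => ?_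
      simp only [hD₃, tensorSquareDifferential, LinearMap.comp_apply, LinearMap.add_apply,
        TensorProduct.map_tmul, TensorProduct.add_tmul, map_add, mulThree_tmul, hder,
        LinearMap.id_apply, tensorSign, mul_assoc, mul_add, add_assoc]
    exact fun z => LinearMap.congr_fun this z
  -- The permutations that commute with `D` form a subgroup that contains the block exchanges.
  intro n
  let H : Subgroup (Equiv.Perm (Fin n)) :=
    { carrier := {σ | ∀ t, D (permTensor 𝒱 σ t) = permTensor 𝒱 σ (D t)}
      one_mem' := fun t => by rw [permTensor_one, permTensor_one, hlen]
      mul_mem' := fun {σ τ} hσ hτ t => by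
        rw [permTensor_mul, permTensor_mul, ← (hσ : ∀ t, _), ← (hτ : ∀ t, _)]
      inv_mem' := fun {σ} hσ t => by
        have e : ∀ t, permTensor 𝒱 σ⁻¹ (permTensor 𝒱 σ t) = proj R V n t := fun t => by
          rw [← permTensor_mul, mul_inv_cancel, permTensor_one]
        have e' : ∀ t, permTensor 𝒱 σ (permTensor 𝒱 σ⁻¹ t) = proj R V n t := fun t => by
          rw [← permTensor_mul, inv_mul_cancel, permTensor_one]
        calc D (permTensor 𝒱 σ⁻¹ t) = proj R V n (D (permTensor 𝒱 σ⁻¹ t)) := by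
              rw [← hlen, proj_permTensor]
          _ = permTensor 𝒱 σ⁻¹ (D (permTensor 𝒱 σ (permTensor 𝒱 σ⁻¹ t))) := by
              rw [← e, ← (hσ : ∀ t, _)]
          _ = permTensor 𝒱 σ⁻¹ (D t) := by rw [e', hlen, permTensor_proj] }
  have hH : H = ⊤ := by
    refine Subgroup.eq_top_of_isBlockSwap _ fun σ q r s hn hσ t => ?_
    rw [permTensor_eq_mulThree 𝒱 hn hσ, permTensor_eq_mulThree 𝒱 hn hσ, h3, hsw, hmul]
  intro σ
  have h : σ ∈ H := hH ▸ Subgroup.mem_top σ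
  exact h

end Derivation

variable (𝒱) in
/-- The tensors whose components of length `n` are fixed by the permutations in `H n`. -/
def fixedTensors (H : ∀ n, Subgroup (Equiv.Perm (Fin n))) : Submodule R (TensorSum R V) where
  carrier := {t | ∀ n, ∀ σ ∈ H n, permTensor 𝒱 σ t = proj R V n t}
  zero_mem' := fun n σ _ => by simp
  add_mem' := fun {s t} hs ht n σ h => by rw [map_add, map_add, hs n σ h, ht n σ h]
  smul_mem' := fun r t ht n σ h => by rw [map_smul, map_smul, ht n σ h]

variable (𝒱) in
theorem fixedTensors_bot : fixedTensors 𝒱 (fun _ => ⊥) = ⊤ := by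
  rw [eq_top_iff]
  rintro t - n σ hσ
  rw [Subgroup.mem_bot.1 hσ, permTensor_one]

variable (𝒱) in
theorem fixedTensors_zpowers :
    fixedTensors 𝒱 (fun n => Subgroup.zpowers (finRotate n)) = cyclicTensors 𝒱 := by
  ext t
  constructor
  · intro h n
    exact (permTensor_eq_iff 𝒱 _ t).1 (h n _ (Subgroup.mem_zpowers _))
  · intro h n σ hσ
    have h1 : Subgroup.zpowers (finRotate n) ≤ koszulStabilizer 𝒱 (t n) :=
      (Subgroup.zpowers_le).2 (h n)
    exact (permTensor_eq_iff 𝒱 _ t).2 (h1 hσ)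

variable (𝒱) in
theorem fixedTensors_top : fixedTensors 𝒱 (fun _ => ⊤) = symmetricTensors 𝒱 := by
  ext t
  exact ⟨fun h n σ => (permTensor_eq_iff 𝒱 _ t).1 (h n σ (Subgroup.mem_top σ)),
    fun h n σ _ => (permTensor_eq_iff 𝒱 _ t).2 (h n σ)⟩

variable {H : ∀ n, Subgroup (Equiv.Perm (Fin n))}

theorem IsPermEquivariant.map_mem {A : TensorSum R V →ₗ[R] TensorSum R W}
    (hA : IsPermEquivariant 𝒱 𝒲 A) {t : TensorSum R V} (ht : t ∈ fixedTensors 𝒱 H) :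
    A t ∈ fixedTensors 𝒲 H := by
  intro n σ hσ
  rw [← hA, ht n σ hσ, hA.proj]

theorem proj_mem_fixedTensors {t : TensorSum R V} (ht : t ∈ fixedTensors 𝒱 H) (m : ℕ) :
    proj R V m t ∈ fixedTensors 𝒱 H := by
  intro n σ hσ
  by_cases h : n = m
  · subst h
    rw [permTensor_proj, proj_proj, if_pos rfl, ht n σ hσ]
  · rw [← permTensor_proj, proj_proj, if_neg h, map_zero]

open Classical in
variable (𝒱 H) in
/-- The average over the permutations in the groups `H n`. -/
def average : TensorSum R V →ₗ[R] TensorSum R V :=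
  DirectSum.lmap fun n => (Nat.card (H n) : R)⁻¹ • ∑ σ : H n, koszulPerm 𝒱 (σ : Equiv.Perm (Fin n))

open Classical in
theorem proj_average (n : ℕ) (t : TensorSum R V) :
    proj R V n (average 𝒱 H t) =
      (Nat.card (H n) : R)⁻¹ • ∑ σ : H n, permTensor 𝒱 (σ : Equiv.Perm (Fin n)) t := by
  rw [proj_apply, average, DirectSum.lmap_apply, LinearMap.smul_apply, map_smul,
    LinearMap.sum_apply, map_sum]
  rfl

theorem average_of_mem [CharZero R] {t : TensorSum R V} (ht : t ∈ fixedTensors 𝒱 H) :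
    average 𝒱 H t = t := by
  classical
  refine ext_proj fun n => ?_
  have h : ∀ σ : H n, permTensor 𝒱 (σ : Equiv.Perm (Fin n)) t = proj R V n t := fun σ =>
    ht n σ.1 σ.2
  rw [proj_average, Finset.sum_congr rfl fun σ _ => h σ, Finset.sum_const,
    Finset.card_univ, ← Nat.card_eq_fintype_card, ← Nat.cast_smul_eq_nsmul R, smul_smul,
    inv_mul_cancel₀ (Nat.cast_ne_zero.2 Nat.card_pos.ne'), one_smul]

theorem average_mem (t : TensorSum R V) : average 𝒱 H t ∈ fixedTensors 𝒱 H := by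
  classical
  intro n σ hσ
  rw [← permTensor_proj, proj_average, map_smul, map_sum]
  refine congrArg _ ?_
  refine Fintype.sum_equiv (Equiv.mulRight (⟨σ, hσ⟩ : H n)) _ _ fun τ => ?_
  rw [← permTensor_mul]
  rfl

theorem IsPermEquivariant.average {A : TensorSum R V →ₗ[R] TensorSum R W}
    (hA : IsPermEquivariant 𝒱 𝒲 A) (t : TensorSum R V) :
    A (average 𝒱 H t) = TensorSum.average 𝒲 H (A t) := by
  classical
  refine ext_proj fun n => ?_
  rw [← hA.proj, proj_average, proj_average, map_smul, map_sum]
  simp only [hA n]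

end Equivariant

end TensorSum

/-! ### Series without small positive energies -/

namespace Nov

section Gap

variable {R M N P : Type*} [CommRing R] [AddCommGroup M] [Module R M] [AddCommGroup N]
  [Module R N] [AddCommGroup P] [Module R P]

variable (R M) in
/-- The series all of whose terms, apart from the constant one, have energy at least `l`. -/
def gapSubmodule (l : ℝ≥0) : Submodule R (Nov R M) where
  carrier := {x | ∀ g : NovExp, g ≠ 0 → g.1 < l → x.coeff g = 0}
  zero_mem' := fun _ _ _ => rfl
  add_mem' := fun {x y} hx hy g h h' => by rw [coeff_add, hx g h h', hy g h h', add_zero]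
  smul_mem' := fun r x hx g h h' => by rw [coeff_smul, hx g h h', smul_zero]

theorem const_mem_gapSubmodule (l : ℝ≥0) (v : M) : (const v : Nov R M) ∈ gapSubmodule R M l :=
  fun _ h _ => if_neg h

theorem map_mem_gapSubmodule (h : M →ₗ[R] N) {l : ℝ≥0} {x : Nov R M}
    (hx : x ∈ gapSubmodule R M l) : map h x ∈ gapSubmodule R N l := fun g hg hg' => by
  rw [coeff_map, hx g hg hg', map_zero]

theorem gapSubmodule_anti {l l' : ℝ≥0} (h : l ≤ l') : gapSubmodule R M l' ≤ gapSubmodule R M l :=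
  fun _ hx g hg hg' => hx g hg (hg'.trans_le h)

theorem sub_eq_of_le {a g : NovExp} (h : a.1 ≤ g.1) : a + (g - a) = g :=
  Prod.ext (add_tsub_cancel_of_le h) (add_sub_cancel _ _)

theorem conv_mem_gapSubmodule (μ : M →ₗ[R] N →ₗ[R] P) {l : ℝ≥0} {x : Nov R M} {y : Nov R N}
    (hx : x ∈ gapSubmodule R M l) (hy : y ∈ gapSubmodule R N l) :
    conv μ x y ∈ gapSubmodule R P l := by
  intro g hg hl
  rw [coeff_conv]
  refine Finset.sum_eq_zero fun a ha => ?_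
  rw [mem_supp] at ha
  have ha0 : a = 0 := by
    by_contra h
    exact ha.2 (hx a h (ha.1.trans_lt hl))
  subst ha0
  have : g - 0 = g := Prod.ext (tsub_zero g.1) (sub_zero g.2)
  rw [this, hy g hg hl, map_zero]

/-- The constant term is multiplicative: `T ^ 0 e ^ q` with `q ≠ 0` does not occur. -/
theorem coeff_zero_conv (μ : M →ₗ[R] N →ₗ[R] P) {l : ℝ≥0} (hl : 0 < l) {x : Nov R M}
    (hx : x ∈ gapSubmodule R M l) (y : Nov R N) :
    (conv μ x y).coeff 0 = μ (x.coeff 0) (y.coeff 0) := by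
  rw [coeff_conv_eq μ x y 0 {0}]
  · have : (0 : NovExp) - 0 = 0 := Prod.ext (tsub_zero 0) (sub_zero 0)
    simp [this]
  · intro a ha
    rw [mem_supp] at ha
    by_contra h
    exact ha.2 (hx a (by simpa using h) (ha.1.trans_lt hl))

/-- Modulo terms of energy at least `l + E`, the extension of `φ` acts on series of energy at
least `E` by its constant term. -/
theorem coeff_lift_of_gap {φ : M →ₗ[R] Nov R N} {l : ℝ≥0} (hφ : ∀ v, φ v ∈ gapSubmodule R N l)
    {E : ℝ≥0} {x : Nov R M} (hx : x ∈ energy R M E) {g : NovExp} (hg : g.1 < E + l) :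
    (lift φ x).coeff g = (φ (x.coeff g)).coeff 0 := by
  change (liftR φ x).coeff g = _
  rw [coeff_liftR_eq φ x g (x.supp g.1 ∪ {g}) Finset.subset_union_left,
    Finset.sum_eq_single g]
  · have : g - g = 0 := Prod.ext (tsub_self g.1) (sub_self g.2)
    rw [if_pos le_rfl, this]
  · intro a ha hag
    by_cases h0 : x.coeff a = 0
    · simp [h0]
    split_ifs with h
    · refine hφ _ _ (fun h' => hag ?_) ?_
      · have := sub_eq_of_le h
        rwa [h', add_zero] at this
      · have h1 := hx a h0
        change g.1 - a.1 < l
        exact (tsub_lt_iff_left h).2 (hg.trans_le (add_le_add_left h1 l))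
    · rfl
  · intro h
    exact absurd (Finset.mem_union_right _ (Finset.mem_singleton_self g)) h

theorem lift_const (φ : M →ₗ[R] Nov R N) (v : M) : lift φ (const v) = φ v := liftR_const φ v

theorem coeff_lift (φ : M →ₗ[R] Nov R N) (x : Nov R M) (g : NovExp) :
    (lift φ x).coeff g = ∑ a ∈ x.supp g.1, (φ (x.coeff a)).coeff (g - a) := rfl

theorem lift_mem_energy (φ : M →ₗ[R] Nov R N) {E : ℝ≥0} {x : Nov R M} (hx : x ∈ energy R M E) :
    lift φ x ∈ energy R N E := by
  intro g hg
  rw [coeff_lift] at hg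
  obtain ⟨a, ha, -⟩ := Finset.exists_ne_zero_of_sum_ne_zero hg
  rw [mem_supp] at ha
  exact (hx a ha.2).trans ha.1

theorem lift_mem_coeffsIn {φ : M →ₗ[R] Nov R N} {S : Submodule R M} {S' : Submodule R N}
    (h : ∀ v ∈ S, φ v ∈ coeffsIn S') {x : Nov R M} (hx : x ∈ coeffsIn S) :
    lift φ x ∈ coeffsIn S' := by
  intro g
  rw [coeff_lift]
  exact Submodule.sum_mem _ fun a _ => h _ (hx a) _

end Gap

end Nov

/-! ### Linear parts of coderivations and coalgebra maps -/

namespace TensorSum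

section Letters

variable {R V W : Type*} [CommRing R] [AddCommGroup V] [Module R V] [AddCommGroup W] [Module R W]

theorem neg_mul_tensor (s t : TensorSum R V) : -s * t = -(s * t) :=
  map_neg (LinearMap.mulRight R t) s

theorem mul_neg_tensor (s t : TensorSum R V) : s * -t = -(s * t) :=
  map_neg (LinearMap.mulLeft R s) t

/-- The part of length one of a tensor. -/
def letter : TensorSum R V →ₗ[R] V :=
  (PiTensorProduct.subsingletonEquiv (R := R) (s := fun _ : Fin 1 => V) 0).toLinearMap ∘ₗ
    DirectSum.component R ℕ (fun n => ⨂[R]^n V) 1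

@[simp] theorem letter_tensorOne (v : V) : letter (tensorOne v : TensorSum R V) = v := by
  simp only [letter, tensorOne, LinearMap.comp_apply, DirectSum.component.lof_self]
  exact LinearEquiv.apply_symm_apply _ _

theorem tensorOne_injective : Function.Injective (tensorOne : V →ₗ[R] TensorSum R V) :=
  Function.LeftInverse.injective letter_tensorOne

theorem letter_proj (t : TensorSum R V) : letter (proj R V 1 t) = letter t := by
  simp only [letter, LinearMap.comp_apply, proj]
  rw [DirectSum.component.lof_self]

theorem letter_word_of_ne {l : List V} (h : l.length ≠ 1) : letter (word R l) = 0 := by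
  rw [← letter_proj, proj_word, if_neg (Ne.symm h), map_zero]

theorem word_eq_tensorOne {l : List V} (h : l.length = 1) :
    ∃ v, word R l = tensorOne v ∧ l = [v] := by
  obtain ⟨v, rfl⟩ := List.length_eq_one_iff.1 h
  exact ⟨v, by simp, rfl⟩

theorem proj_succ_cons (n : ℕ) (v : V) (t : TensorSum R V) :
    proj R V (n + 1) (tensorOne v * t) = tensorOne v * proj R V n t := by
  have : proj R V (n + 1) ∘ₗ LinearMap.mulLeft R (tensorOne v) =
      LinearMap.mulLeft R (tensorOne v) ∘ₗ proj R V n := by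
    refine ext_word fun l => ?_
    simp only [LinearMap.comp_apply, LinearMap.mulLeft_apply, proj_word, ← word_cons,
      List.length_cons, add_left_inj]
    split_ifs <;> simp
  exact LinearMap.congr_fun this t

variable (R V) in
/-- The tensors of length less than `n`. -/
def shorterThan (n : ℕ) : Submodule R (TensorSum R V) where
  carrier := {t | ∀ m, n ≤ m → proj R V m t = 0}
  zero_mem' := fun _ _ => map_zero _
  add_mem' := fun hs ht m hm => by rw [map_add, hs m hm, ht m hm, add_zero]
  smul_mem' := fun r t ht m hm => by rw [map_smul, ht m hm, smul_zero]

theorem word_mem_shorterThan {n : ℕ} {l : List V} (h : l.length < n) :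
    word R l ∈ shorterThan R V n := fun m hm => by
  rw [proj_word, if_neg (by omega)]

theorem shorterThan_mono {n m : ℕ} (h : n ≤ m) : shorterThan R V n ≤ shorterThan R V m :=
  fun _ ht k hk => ht k (h.trans hk)

theorem tensorOne_mul_mem_shorterThan {n : ℕ} (v : V) {t : TensorSum R V}
    (ht : t ∈ shorterThan R V n) : tensorOne v * t ∈ shorterThan R V (n + 1) := by
  intro m hm
  obtain ⟨m, rfl⟩ : ∃ k, m = k + 1 := ⟨m - 1, by omega⟩
  rw [proj_succ_cons, ht m (by omega), mul_zero]

/-- The linear map `A` does not increase the length when it maps words `l` to tensors of length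
at most that of `l`, and similarly for maps that lower the length by `k`. -/
theorem map_mem_shorterThan {A : TensorSum R V →ₗ[R] TensorSum R W} {k : ℕ}
    (h : ∀ l : List V, A (word R l) ∈ shorterThan R W (l.length + 1 - k)) {n : ℕ}
    {t : TensorSum R V} (ht : t ∈ shorterThan R V n) : A t ∈ shorterThan R W (n - k) := by
  have h1 : ∀ m t, A (proj R V m t) ∈ shorterThan R W (m + 1 - k) := by
    intro m t
    have : (shorterThan R W (m + 1 - k)).mkQ ∘ₗ A ∘ₗ proj R V m = 0 := by
      refine ext_word fun l => ?_
      simp only [LinearMap.comp_apply, proj_word]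
      split_ifs with hm
      · subst hm
        rw [Submodule.mkQ_apply, (Submodule.Quotient.mk_eq_zero _).2 (h l)]
        rfl
      · simp
    have h2 := LinearMap.congr_fun this t
    simpa using h2
  rw [eq_sum_proj ht, map_sum]
  refine Submodule.sum_mem _ fun m hm => shorterThan_mono ?_ (h1 m t)
  rw [Finset.mem_range] at hm
  omega

section Coderivation

variable (𝒱 : ℤ → Submodule R V) [DirectSum.Decomposition 𝒱]

theorem coderivation_add (μ ν : TensorSum R V →ₗ[R] V) :
    coderivation 𝒱 (μ + ν) = coderivation 𝒱 μ + coderivation 𝒱 ν := by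
  rw [coderivation, applyInitial, LinearMap.comp_add, convolve_add_left, convolve_add_right]
  rfl

theorem coderivation_zero : coderivation 𝒱 (0 : TensorSum R V →ₗ[R] V) = 0 := by
  refine ext_word fun l => ?_
  simp [coderivation, applyInitial, convolve_word]

/-- A coderivation without constant and linear part lowers the length. -/
theorem coderivation_mem_shorterThan {ν : TensorSum R V →ₗ[R] V}
    (h : ∀ l : List V, l.length ≤ 1 → ν (word R l) = 0) (l : List V) :
    coderivation 𝒱 ν (word R l) ∈ shorterThan R V l.length := by
  rw [coderivation, convolve_word]
  refine Submodule.sum_mem _ fun i hi => ?_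
  rw [Finset.mem_range] at hi
  rw [applyInitial, convolve_word, map_sum]
  refine Submodule.sum_mem _ fun j hj => ?_
  rw [Finset.mem_range, List.length_drop] at hj
  by_cases hj1 : j ≤ 1
  · rw [LinearMap.comp_apply, h _ (by simp; omega)]
    simp
  · rw [tensorSign, map_word]
    simp only [LinearMap.comp_apply, LinearMap.mul_apply', LinearMap.id_apply]
    rw [← word_cons, ← word_append]
    refine word_mem_shorterThan ?_
    simp
    omega

theorem coderivation_eq_zero_of_length_le {ν : TensorSum R V →ₗ[R] V}
    (h : ∀ l : List V, l.length ≤ 1 → ν (word R l) = 0) {l : List V} (hl : l.length ≤ 1) :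
    coderivation 𝒱 ν (word R l) = 0 := by
  rw [coderivation, convolve_word]
  refine Finset.sum_eq_zero fun i _ => ?_
  rw [applyInitial, convolve_word, map_sum]
  refine Finset.sum_eq_zero fun j _ => ?_
  rw [LinearMap.comp_apply, h _ (by simp; omega)]
  simp

/-- The coderivation that extends a linear map `V → V`; it is also a derivation. -/
def linearCoderivation (d : V →ₗ[R] V) : TensorSum R V →ₗ[R] TensorSum R V :=
  coderivation 𝒱 (d ∘ₗ letter)

variable (d : V →ₗ[R] V)

theorem linearCoderivation_one : linearCoderivation 𝒱 d 1 = 0 := by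
  rw [linearCoderivation, coderivation_one, applyInitial, convolve_one]
  have : letter (1 : TensorSum R V) = 0 := letter_word_of_ne (R := R) (l := ([] : List V)) (by simp)
  simp [this]

theorem linearCoderivation_cons (v : V) (t : TensorSum R V) :
    linearCoderivation 𝒱 d (tensorOne v * t) =
      tensorOne (d v) * t + tensorOne (shiftSign 𝒱 v) * linearCoderivation 𝒱 d t := by
  have h : applyInitial (d ∘ₗ letter) ∘ₗ LinearMap.mulLeft R (tensorOne v) =
      LinearMap.mulLeft R (tensorOne (d v)) := by
    refine ext_word fun l => ?_
    rw [LinearMap.comp_apply, LinearMap.mulLeft_apply, LinearMap.mulLeft_apply, ← word_cons,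
      applyInitial, convolve_word, Finset.sum_eq_single 1]
    · simp
    · intro i hi h1
      rw [Finset.mem_range] at hi
      rw [LinearMap.comp_apply, LinearMap.comp_apply, letter_word_of_ne]
      · simp
      · rw [List.length_take]
        omega
    · intro h1
      exact absurd (Finset.mem_range.2 (by simp)) h1
  have h' := LinearMap.congr_fun h t
  rw [LinearMap.comp_apply, LinearMap.mulLeft_apply, LinearMap.mulLeft_apply] at h'
  rw [linearCoderivation, coderivation_cons, h']

theorem linearCoderivation_tensorOne (v : V) :
    linearCoderivation 𝒱 d (tensorOne v) = tensorOne (d v) := by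
  have := linearCoderivation_cons 𝒱 d v 1
  rwa [mul_one, linearCoderivation_one, mul_zero, add_zero, mul_one] at this

theorem linearCoderivation_mul (s t : TensorSum R V) :
    linearCoderivation 𝒱 d (s * t) =
      linearCoderivation 𝒱 d s * t + tensorSign 𝒱 s * linearCoderivation 𝒱 d t := by
  have : linearCoderivation 𝒱 d ∘ₗ LinearMap.mulRight R t =
      LinearMap.mulRight R t ∘ₗ linearCoderivation 𝒱 d +
        LinearMap.mulRight R (linearCoderivation 𝒱 d t) ∘ₗ tensorSign 𝒱 := by
    refine ext_rec ?_ fun v s hs => ?_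
    · simp [linearCoderivation_one]
    · simp only [LinearMap.comp_apply, LinearMap.add_apply, LinearMap.mulRight_apply] at hs ⊢
      rw [mul_assoc, linearCoderivation_cons, hs, linearCoderivation_cons, tensorSign_cons]
      simp only [add_mul, mul_add, mul_assoc, add_assoc]
  exact LinearMap.congr_fun this s

theorem proj_linearCoderivation (n : ℕ) (t : TensorSum R V) :
    linearCoderivation 𝒱 d (proj R V n t) = proj R V n (linearCoderivation 𝒱 d t) := by
  refine (proj_commute (fun l => ?_) n t).symm
  induction l with
  | nil => simp [linearCoderivation_one]
  | cons v l ih =>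
    rw [word_cons, linearCoderivation_cons, map_add, List.length_cons, proj_succ_cons,
      proj_succ_cons, ih, proj_word, if_pos rfl]

theorem tensorSign_linearCoderivation (hd : ∀ v, shiftSign 𝒱 (d v) = -d (shiftSign 𝒱 v))
    (t : TensorSum R V) :
    tensorSign 𝒱 (linearCoderivation 𝒱 d t) = -linearCoderivation 𝒱 d (tensorSign 𝒱 t) := by
  have : tensorSign 𝒱 ∘ₗ linearCoderivation 𝒱 d = -(linearCoderivation 𝒱 d ∘ₗ tensorSign 𝒱) := by
    refine ext_rec ?_ fun v t ht => ?_
    · simp [linearCoderivation_one]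
    · simp only [LinearMap.comp_apply, LinearMap.neg_apply] at ht ⊢
      rw [linearCoderivation_cons, map_add, tensorSign_cons, tensorSign_cons, ht, tensorSign_cons,
        linearCoderivation_cons, hd]
      simp only [map_neg, neg_mul_tensor, mul_neg_tensor, neg_add]
  exact LinearMap.congr_fun this t

variable {𝒱 d} in
theorem linearCoderivation_linearCoderivation (hd : ∀ v, shiftSign 𝒱 (d v) = -d (shiftSign 𝒱 v))
    (hdd : ∀ v, d (d v) = 0) (t : TensorSum R V) :
    linearCoderivation 𝒱 d (linearCoderivation 𝒱 d t) = 0 := by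
  have : linearCoderivation 𝒱 d ∘ₗ linearCoderivation 𝒱 d = 0 := by
    refine ext_rec ?_ fun v t ht => ?_
    · simp [linearCoderivation_one]
    · simp only [LinearMap.comp_apply, LinearMap.zero_apply] at ht ⊢
      rw [linearCoderivation_cons, map_add, linearCoderivation_cons, linearCoderivation_cons, hdd,
        hd, ht, map_neg, neg_mul_tensor]
      simp
  exact LinearMap.congr_fun this t

variable {𝒱 d} in
theorem map_linearCoderivation {𝒲 : ℤ → Submodule R W} [DirectSum.Decomposition 𝒲]
    {d' : W →ₗ[R] W} {f : V →ₗ[R] W} (hf : ∀ v, shiftSign 𝒲 (f v) = f (shiftSign 𝒱 v))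
    (hfd : ∀ v, f (d v) = d' (f v)) (t : TensorSum R V) :
    map f (linearCoderivation 𝒱 d t) = linearCoderivation 𝒲 d' (map f t) := by
  have : map f ∘ₗ linearCoderivation 𝒱 d = linearCoderivation 𝒲 d' ∘ₗ map f := by
    refine ext_rec ?_ fun v t ht => ?_
    · simp [linearCoderivation_one]
    · simp only [LinearMap.comp_apply] at ht ⊢
      rw [linearCoderivation_cons, map_add, map_cons, map_cons, map_cons, linearCoderivation_cons,
        ht, hfd, hf]
  exact LinearMap.congr_fun this t

end Coderivation

end Letters

end TensorSum

/-! ### Coefficients of the codifferential and of the bar map -/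

section Coefficients

variable {R V W : Type*} [CommRing R] [AddCommGroup V] [Module R V] [AddCommGroup W] [Module R W]

theorem TensorSum.mem_of_word_mem {S : Submodule R (TensorSum R V)}
    (h : ∀ l : List V, word R l ∈ S) (t : TensorSum R V) : t ∈ S := by
  have h1 := eq_top_of_mul_mem (R := R) (V := V) (X := Set.univ) (by simp)
    (Submodule.span R (Set.range (word R))) (Submodule.subset_span ⟨[], rfl⟩) (by
      intro v _ t ht
      induction ht using Submodule.span_induction with
      | mem t ht =>
        obtain ⟨l, rfl⟩ := ht
        exact Submodule.subset_span ⟨v :: l, rfl⟩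
      | zero => rw [mul_zero]; exact Submodule.zero_mem _
      | add s t _ _ hs ht => rw [mul_add]; exact Submodule.add_mem _ hs ht
      | smul r t _ ht => rw [mul_smul_comm]; exact Submodule.smul_mem _ r ht)
  have h2 : Submodule.span R (Set.range (word R)) ≤ S := by
    rw [Submodule.span_le]
    rintro _ ⟨l, rfl⟩
    exact h l
  exact h2 (h1 ▸ Submodule.mem_top)

namespace NovFamily

/-- Apart from the constant terms, the family `φ` has energy at least `l`. -/
def HasGap (φ : NovFamily R V W) (l : ℝ≥0) : Prop :=
  ∀ t, φ.onTensors t ∈ Nov.gapSubmodule R W l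

theorem HasGap.anti {φ : NovFamily R V W} {l l' : ℝ≥0} (h : φ.HasGap l') (hl : l ≤ l') :
    φ.HasGap l := fun t => Nov.gapSubmodule_anti hl (h t)

/-- A gapped family has no terms of small positive energy: the gap is the smallest positive
energy of the monoid, or `1`. -/
theorem IsGapped.exists_hasGap {φ : NovFamily R V W} (h : φ.IsGapped) :
    ∃ l > 0, φ.HasGap l := by
  classical
  obtain ⟨G, hG, φβ, hφ⟩ := h
  set s : Finset ℝ≥0 := insert 1 ((hG.discrete 1).toFinset.filter (0 < ·)) with hs
  have hne : s.Nonempty := ⟨1, Finset.mem_insert_self _ _⟩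
  have hpos : 0 < s.min' hne := by
    rcases Finset.mem_insert.1 (s.min'_mem hne) with h1 | h1
    · rw [h1]
      exact one_pos
    · exact (Finset.mem_filter.1 h1).2
  refine ⟨s.min' hne, hpos, fun t => ?_⟩
  refine mem_of_word_mem (S := (Nov.gapSubmodule R W (s.min' hne)).comap φ.onTensors)
    (fun l => ?_) t
  rw [Submodule.mem_comap, onTensors_word]
  rintro ⟨e, q⟩ hg he
  refine (hφ _ _ e q).2 fun hmem => ?_
  rcases eq_or_ne e 0 with rfl | he0
  · have := hG.eq_zero _ hmem
    exact hg (Prod.ext rfl (by simpa using this))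
  · refine absurd (s.min'_le e ?_) (not_le.2 he)
    rw [hs, Finset.mem_insert, Finset.mem_filter]
    refine Or.inr ⟨?_, pos_iff_ne_zero.2 he0⟩
    rw [Set.Finite.mem_toFinset]
    exact ⟨he.le.trans (s.min'_le 1 (Finset.mem_insert_self _ _)), _, hmem⟩

theorem reductionOne_eq (φ : NovFamily R V W) (v : V) :
    φ.reductionOne v = (φ.onTensors (tensorOne v)).coeff 0 := by
  have h : (tensorOne v : TensorSum R V) = word R [v] := by simp
  rw [h, onTensors_word]
  change (φ.restrict 1 fun _ => v).coeff 0 = (φ.restrict 1 [v].get).coeff 0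
  congr 2
  funext i
  fin_cases i
  rfl

theorem onTensors_one (φ : NovFamily R V W) : φ.onTensors 1 = φ 0 ![] := by
  have h : (1 : TensorSum R V) = word R [] := rfl
  rw [h, onTensors_word]
  exact congrArg (φ 0) (Subsingleton.elim _ _)

theorem PositiveAtZero.coeff_onTensors_one {φ : NovFamily R V W} (h : φ.PositiveAtZero) :
    (φ.onTensors 1).coeff 0 = 0 := by
  obtain ⟨l, hl, h⟩ := h
  rw [onTensors_one]
  by_contra h0
  exact absurd (h 0 h0) (not_le.2 hl)

theorem HasDegree.reductionOne_mem {𝒱 : ℤ → Submodule R V} {𝒲 : ℤ → Submodule R W}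
    {φ : NovFamily R V W} {c : ℤ} (h : φ.HasDegree 𝒱 𝒲 c) {d : ℤ} {v : V} (hv : v ∈ 𝒱 d) :
    φ.reductionOne v ∈ 𝒲 (d - 1 + c) := by
  have h1 := h.onTensors_mem (l := [(d, v)]) (by
    intro y hy
    rw [List.mem_singleton] at hy
    subst hy
    exact hv) 0
  have e : shiftedDegree [(d, v)] + c - 2 * (0 : NovExp).2 = d - 1 + c := by
    simp [shiftedDegree]
  rw [e] at h1
  rw [reductionOne_eq]
  simpa using h1

end NovFamily

section Differential

variable (𝒱 : ℤ → Submodule R V) [DirectSum.Decomposition 𝒱] (m : NovFamily R V V)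

/-- Each coefficient of the codifferential is a coderivation. -/
theorem tensorDifferential_coeff (t : TensorSum R V) (g : NovExp) :
    (tensorDifferential 𝒱 m t).coeff g =
      coderivation 𝒱 (Nov.coeffHom R V g ∘ₗ m.onTensors) t := by
  have : Nov.coeffHom R _ g ∘ₗ tensorDifferential 𝒱 m =
      coderivation 𝒱 (Nov.coeffHom R V g ∘ₗ m.onTensors) := by
    refine ext_word fun l => ?_
    rw [LinearMap.comp_apply, tensorDifferential, coderivation, convolve_word, convolve_word,
      map_sum]
    refine Finset.sum_congr rfl fun i _ => ?_
    rw [LinearMap.comp_apply, barMul, Nov.conv_const_left, Nov.coeffHom_apply, Nov.coeff_map]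
    refine congrArg _ ?_
    rw [applyInitial, convolve_word, convolve_word, Nov.coeff_sum]
    refine Finset.sum_congr rfl fun j _ => ?_
    rw [Nov.conv_const_right, Nov.coeff_map, NovFamily.toLin_toBarSeries]
    rfl
  exact LinearMap.congr_fun this t

variable {𝒱 m}

theorem tensorDifferential_mem_gap {l : ℝ≥0} (h : m.HasGap l) (t : TensorSum R V) :
    tensorDifferential 𝒱 m t ∈ Nov.gapSubmodule R _ l := by
  intro g hg hl
  have : Nov.coeffHom R V g ∘ₗ m.onTensors = 0 := LinearMap.ext fun t => h t g hg hl
  rw [tensorDifferential_coeff, this, coderivation_zero]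
  rfl

variable (𝒱 m) in
/-- The part of energy zero of the codifferential. -/
def leadingDifferential : TensorSum R V →ₗ[R] TensorSum R V :=
  Nov.coeffHom R _ 0 ∘ₗ tensorDifferential 𝒱 m

theorem leadingDifferential_eq : leadingDifferential 𝒱 m =
    linearCoderivation 𝒱 m.reductionOne + coderivation 𝒱
      (Nov.coeffHom R V 0 ∘ₗ m.onTensors - m.reductionOne ∘ₗ letter) := by
  rw [linearCoderivation, ← coderivation_add, add_sub_cancel]
  exact LinearMap.ext fun t => tensorDifferential_coeff 𝒱 m t 0

theorem coeff_onTensors_sub_eq_zero (hm : m.PositiveAtZero) (l : List V) (hl : l.length ≤ 1) :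
    (Nov.coeffHom R V 0 ∘ₗ m.onTensors - m.reductionOne ∘ₗ letter) (word R l) = 0 := by
  rw [LinearMap.sub_apply, LinearMap.comp_apply, LinearMap.comp_apply, Nov.coeffHom_apply]
  rcases Nat.le_one_iff_eq_zero_or_eq_one.1 hl with h | h
  · obtain rfl := List.length_eq_zero_iff.1 h
    rw [letter_word_of_ne (by simp), word_nil, hm.coeff_onTensors_one, map_zero, sub_zero]
  · obtain ⟨v, hv, -⟩ := word_eq_tensorOne (R := R) h
    rw [hv, letter_tensorOne, m.reductionOne_eq, sub_self]

theorem leadingDifferential_sub_mem (hm : m.PositiveAtZero) (l : List V) :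
    (leadingDifferential 𝒱 m - linearCoderivation 𝒱 m.reductionOne) (word R l) ∈
      shorterThan R V l.length := by
  rw [leadingDifferential_eq, add_sub_cancel_left]
  exact coderivation_mem_shorterThan 𝒱 (coeff_onTensors_sub_eq_zero hm) l

theorem leadingDifferential_tensorOne (hm : m.PositiveAtZero) (v : V) :
    leadingDifferential 𝒱 m (tensorOne v) = tensorOne (m.reductionOne v) := by
  have h : (tensorOne v : TensorSum R V) = word R [v] := by simp
  rw [leadingDifferential_eq, LinearMap.add_apply, linearCoderivation_tensorOne, h,
    coderivation_eq_zero_of_length_le 𝒱 (coeff_onTensors_sub_eq_zero hm) (by simp), add_zero]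

theorem shiftSign_reductionOne (hm : m.HasDegree 𝒱 𝒱 2) (v : V) :
    shiftSign 𝒱 (m.reductionOne v) = -m.reductionOne (shiftSign 𝒱 v) := by
  have : shiftSign 𝒱 ∘ₗ m.reductionOne = -(m.reductionOne ∘ₗ shiftSign 𝒱) := by
    refine ext_homogeneous 𝒱 fun d v hv => ?_
    rw [LinearMap.comp_apply, LinearMap.neg_apply, LinearMap.comp_apply, shiftSign_of_mem 𝒱 hv,
      shiftSign_of_mem 𝒱 (hm.reductionOne_mem hv), map_smul, ← neg_smul]
    congr 1
    have e : ((d - 1 + 2 - 1 : ℤ) : ZMod 2) = ((d - 1 : ℤ) : ZMod 2) + 1 := by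
      push_cast
      ring
    rw [e, paritySign_add, paritySign_one, mul_neg_one]
  exact LinearMap.congr_fun this v

theorem tensorSign_coeff_tensorDifferential (hm : m.HasDegree 𝒱 𝒱 2) (g : NovExp)
    (t : TensorSum R V) :
    tensorSign 𝒱 (coderivation 𝒱 (Nov.coeffHom R V g ∘ₗ m.onTensors) t) =
      -coderivation 𝒱 (Nov.coeffHom R V g ∘ₗ m.onTensors) (tensorSign 𝒱 t) := by
  have h := (hasTensorDegree_tensorDifferential hm).tensorSign_coeff t g
  rw [tensorDifferential_coeff, tensorDifferential_coeff, Int.cast_one, paritySign_one,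
    neg_one_smul] at h
  exact h

end Differential

section BarMap

variable {f : NovFamily R V W} (hf : f.PositiveAtZero)

/-- The coalgebra map `f̂` on tensors with constant coefficients. -/
abbrev NovFamily.tensorMap (f : NovFamily R V W) (hf : f.PositiveAtZero) :
    TensorSum R V →ₗ[R] Bar R W :=
  BarSeries.sumPowers f.toBarSeries hf.toBarSeries

theorem toLin_mem_gap {l : ℝ≥0} (h : f.HasGap l) (t : TensorSum R V) :
    BarSeries.toLin f.toBarSeries t ∈ Nov.gapSubmodule R (TensorSum R W) l := by
  rw [NovFamily.toLin_toBarSeries]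
  exact Nov.map_mem_gapSubmodule _ (h t)

theorem tensorMap_mem_gap {l : ℝ≥0} (h : f.HasGap l) (t : TensorSum R V) :
    f.tensorMap hf t ∈ Nov.gapSubmodule R (TensorSum R W) l := by
  have hN : ∀ N t, BarSeries.toLin (BarSeries.power f.toBarSeries N) t ∈
      Nov.gapSubmodule R (TensorSum R W) l := by
    intro N
    induction N with
    | zero =>
      intro t
      rw [BarSeries.power, BarSeries.toLin_unit, LinearMap.comp_apply,
        LinearMap.toSpanSingleton_apply]
      exact Submodule.smul_mem _ _ (Nov.const_mem_gapSubmodule _ _)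
    | succ N ih =>
      refine mem_of_word_mem (S := (Nov.gapSubmodule R (TensorSum R W) l).comap
        (BarSeries.toLin (BarSeries.power f.toBarSeries (N + 1)))) fun w => ?_
      rw [Submodule.mem_comap, BarSeries.toLin_power_succ, convolve_word]
      exact Submodule.sum_mem _ fun i _ =>
        Nov.conv_mem_gapSubmodule _ (toLin_mem_gap h _) (ih _)
  intro g hg hl
  obtain ⟨D, hD⟩ := BarSeries.exists_sumPowers_coeff f.toBarSeries hf.toBarSeries t g.1
  rw [hD D le_rfl g le_rfl, Nov.coeff_sum]
  exact Finset.sum_eq_zero fun N _ => hN N t g hg hl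

/-- The part of energy zero of the coalgebra map `f̂`. -/
def leadingMap (f : NovFamily R V W) (hf : f.PositiveAtZero) :
    TensorSum R V →ₗ[R] TensorSum R W :=
  Nov.coeffHom R _ 0 ∘ₗ f.tensorMap hf

theorem leadingMap_eq {l : ℝ≥0} (hl : 0 < l) (h : f.HasGap l) :
    leadingMap f hf = LinearMap.toSpanSingleton R (TensorSum R W) 1 ∘ₗ counit +
      convolve (LinearMap.mul R (TensorSum R W)) (tensorOne ∘ₗ Nov.coeffHom R W 0 ∘ₗ f.onTensors)
        (leadingMap f hf) := by
  refine ext_word fun w => ?_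
  have h1 := congrArg (fun A => Nov.coeff (A (word R w)) 0)
    (BarSeries.sumPowers_eq f.toBarSeries hf.toBarSeries)
  rw [LinearMap.add_apply, Nov.coeff_add, convolve_word, Nov.coeff_sum] at h1
  refine h1.trans ?_
  rw [LinearMap.add_apply, convolve_word]
  refine congrArg₂ (· + ·) ?_ (Finset.sum_congr rfl fun i _ => ?_)
  · rw [LinearMap.comp_apply, LinearMap.comp_apply, LinearMap.toSpanSingleton_apply,
      LinearMap.toSpanSingleton_apply, Nov.coeff_smul, Nov.coeff_const, if_pos rfl]
  · rw [barMul, Nov.coeff_zero_conv _ hl (toLin_mem_gap h _), NovFamily.toLin_toBarSeries]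
    rfl

/-- A coalgebra map without constant part agrees with the map `T(f)` given by its linear part `f`
modulo shorter tensors. -/
theorem sub_map_mem_shorterThan {Q : TensorSum R V →ₗ[R] TensorSum R W}
    {φ : TensorSum R V →ₗ[R] W} (hφ : φ 1 = 0)
    (hQ : Q = LinearMap.toSpanSingleton R (TensorSum R W) 1 ∘ₗ counit +
      convolve (LinearMap.mul R (TensorSum R W)) (tensorOne ∘ₗ φ) Q) :
    (∀ v, Q (tensorOne v) = tensorOne (φ (tensorOne v))) ∧
    ∀ l : List V, (Q - map (φ ∘ₗ tensorOne)) (word R l) ∈ shorterThan R W l.length := by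
  have h1 : Q 1 = 1 := by
    rw [hQ, LinearMap.add_apply, convolve_one, LinearMap.comp_apply, LinearMap.comp_apply, hφ]
    simp
  have hcons : ∀ (v : V) (l : List V), Q (word R (v :: l)) =
      ∑ i ∈ Finset.range (l.length + 1),
        tensorOne (φ (word R (v :: l.take i))) * Q (word R (l.drop i)) := by
    intro v l
    conv_lhs => rw [hQ]
    rw [LinearMap.add_apply, LinearMap.comp_apply, word_cons, counit_cons, map_zero, zero_add,
      convolve_cons, LinearMap.comp_apply, hφ, map_zero, map_zero, LinearMap.zero_apply, zero_add,
      convolve_word]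
    rfl
  refine ⟨fun v => ?_, fun l => ?_⟩
  · have h2 := hcons v []
    simpa [h1] using h2
  · induction hn : l.length using Nat.strong_induction_on generalizing l with
    | _ n ih =>
    subst hn
    cases l with
    | nil => simp [h1]
    | cons v l =>
      rw [LinearMap.sub_apply, hcons, Finset.sum_range_succ', map_word, List.map_cons, word_cons,
        add_sub_assoc]
      refine Submodule.add_mem _ (Submodule.sum_mem _ fun i hi => ?_) ?_
      · rw [Finset.mem_range] at hi
        have h2 := ih (l.drop (i + 1)).length (by simp) (l.drop (i + 1)) rfl
        have h3 : Q (word R (l.drop (i + 1))) ∈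
            shorterThan R W ((l.drop (i + 1)).length + 1) := by
          have e : Q (word R (l.drop (i + 1))) =
              (Q - map (φ ∘ₗ tensorOne)) (word R (l.drop (i + 1))) +
                map (φ ∘ₗ tensorOne) (word R (l.drop (i + 1))) := by
            rw [LinearMap.sub_apply, sub_add_cancel]
          rw [e]
          refine Submodule.add_mem _ (shorterThan_mono (Nat.le_succ _) h2) ?_
          rw [map_word]
          exact word_mem_shorterThan (by simp)
        refine shorterThan_mono ?_ (tensorOne_mul_mem_shorterThan _ h3)
        simp
        omega
      · have h2 := ih l.length (by simp) l rfl
        have h3 := tensorOne_mul_mem_shorterThan (φ (tensorOne v)) h2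
        rw [LinearMap.sub_apply, mul_sub, map_word] at h3
        simpa using h3

theorem leadingMap_tensorOne {l : ℝ≥0} (hl : 0 < l) (h : f.HasGap l) (v : V) :
    leadingMap f hf (tensorOne v) = tensorOne (f.reductionOne v) := by
  rw [(sub_map_mem_shorterThan hf.coeff_onTensors_one (leadingMap_eq hf hl h)).1 v,
    f.reductionOne_eq]
  rfl

theorem leadingMap_sub_mem {l : ℝ≥0} (hl : 0 < l) (h : f.HasGap l) (w : List V) :
    (leadingMap f hf - map f.reductionOne) (word R w) ∈ shorterThan R W w.length := by
  have e : f.reductionOne = (Nov.coeffHom R W 0 ∘ₗ f.onTensors) ∘ₗ tensorOne :=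
    LinearMap.ext fun v => f.reductionOne_eq v
  rw [e]
  exact (sub_map_mem_shorterThan hf.coeff_onTensors_one (leadingMap_eq hf hl h)).2 w

theorem shiftSign_reductionOne_map {𝒱 : ℤ → Submodule R V} [DirectSum.Decomposition 𝒱]
    {𝒲 : ℤ → Submodule R W} [DirectSum.Decomposition 𝒲] (hd : f.HasDegree 𝒱 𝒲 1) (v : V) :
    shiftSign 𝒲 (f.reductionOne v) = f.reductionOne (shiftSign 𝒱 v) := by
  have : shiftSign 𝒲 ∘ₗ f.reductionOne = f.reductionOne ∘ₗ shiftSign 𝒱 := by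
    refine ext_homogeneous 𝒱 fun d v hv => ?_
    have h1 := hd.reductionOne_mem hv
    rw [sub_add_cancel] at h1
    rw [LinearMap.comp_apply, LinearMap.comp_apply, shiftSign_of_mem 𝒱 hv,
      shiftSign_of_mem 𝒲 h1, map_smul]
  exact LinearMap.congr_fun this v

end BarMap

end Coefficients

/-! ### Cyclic and symmetric tensors as subcomplexes -/

section Subcomplex

variable {R V W : Type*} [Field R] [AddCommGroup V] [Module R V] [AddCommGroup W] [Module R W]
  {𝒱 : ℤ → Submodule R V} [DirectSum.Decomposition 𝒱]
  {𝒲 : ℤ → Submodule R W} [DirectSum.Decomposition 𝒲]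

section

variable {m : NovFamily R V V} (hm : m.HasDegree 𝒱 𝒱 2)

include hm

theorem tensorDifferential_mem_cyclic [CharZero R] {t : TensorSum R V}
    (ht : t ∈ cyclicTensors 𝒱) :
    tensorDifferential 𝒱 m t ∈ Nov.coeffsIn (cyclicTensors 𝒱) := by
  intro g
  rw [cyclicTensors_eq] at ht ⊢
  rw [tensorDifferential_coeff]
  exact map_mem_ker_swapDefect (tensorSign_coeff_tensorDifferential hm g)
    (comul_coderivation 𝒱 _) ht

theorem tensorDifferential_mem_symmetric [CharZero R] {t : TensorSum R V}
    (ht : t ∈ symmetricTensors 𝒱) :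
    tensorDifferential 𝒱 m t ∈ Nov.coeffsIn (symmetricTensors 𝒱) := by
  intro g
  rw [symmetricTensors_eq] at ht ⊢
  rw [tensorDifferential_coeff]
  exact map_mem_ker_initialSwapDefect (tensorSign_coeff_tensorDifferential hm g)
    (comul_coderivation 𝒱 _) ht

end

variable {f : NovFamily R V W} (hf : f.PositiveAtZero)

theorem map_comul_tensorMap :
    comulBar R W ∘ₗ f.tensorMap hf =
      Nov.tensorHat (f.tensorMap hf) (f.tensorMap hf) ∘ₗ comul := by
  obtain ⟨l, hl, h⟩ := id hf
  refine map_comul_of_fixedPoint f.onTensors hl ?_ _ ?_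
  · rw [f.onTensors_one]
    exact h
  · rw [← NovFamily.toLin_toBarSeries]
    exact BarSeries.sumPowers_eq _ _

variable (hd : f.HasDegree 𝒱 𝒲 1)

include hd

theorem map_tensorSign_tensorMap (t : TensorSum R V) :
    Nov.map (tensorSign 𝒲) (f.tensorMap hf t) = f.tensorMap hf (tensorSign 𝒱 t) := by
  refine Nov.ext fun g => ?_
  have h := (hasTensorDegree_sumPowers (𝒱 := 𝒱) (𝒲 := 𝒲) hf hd).tensorSign_coeff t g
  rw [Int.cast_zero, paritySign_zero, one_smul] at h
  exact h

theorem tensorMap_mem_cyclic [CharZero R] {t : TensorSum R V} (ht : t ∈ cyclicTensors 𝒱) :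
    f.tensorMap hf t ∈ Nov.coeffsIn (cyclicTensors 𝒲) := by
  rw [cyclicTensors_eq] at ht ⊢
  exact map_mem_coeffsIn_ker_swapDefect (map_tensorSign_tensorMap hf hd) (map_comul_tensorMap hf) ht

theorem tensorMap_mem_symmetric [CharZero R] {t : TensorSum R V} (ht : t ∈ symmetricTensors 𝒱) :
    f.tensorMap hf t ∈ Nov.coeffsIn (symmetricTensors 𝒲) := by
  rw [symmetricTensors_eq] at ht ⊢
  exact map_mem_coeffsIn_ker_initialSwapDefect (map_tensorSign_tensorMap hf hd)
    (map_comul_tensorMap hf) ht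

end Subcomplex

/-! ### Mapping cones and quasi-isomorphisms -/

section Cone

variable {S M M' : Type*} [Ring S] [AddCommGroup M] [Module S M] [AddCommGroup M'] [Module S M']

theorem mem_submoduleOf_iff {p q : Submodule S M} {x : q} : x ∈ p.submoduleOf q ↔ (x : M) ∈ p :=
  Iff.rfl

/-- The differential `(x, y) ↦ (d x, f x - d' y)` of the mapping cone of `f`. -/
def coneDifferential (d : M →ₗ[S] M) (d' : M' →ₗ[S] M') (f : M →ₗ[S] M') :
    M × M' →ₗ[S] M × M' :=
  (d ∘ₗ LinearMap.fst S M M').prod (f ∘ₗ LinearMap.fst S M M' - d' ∘ₗ LinearMap.snd S M M')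

@[simp] theorem coneDifferential_apply (d : M →ₗ[S] M) (d' : M' →ₗ[S] M') (f : M →ₗ[S] M')
    (x : M × M') : coneDifferential d d' f x = (d x.1, f x.1 - d' x.2) := rfl

/-- Every cycle of `D` in the submodule `B` is the boundary of an element of `B`. -/
def IsExactOn (D : M →ₗ[S] M) (B : Submodule S M) : Prop :=
  ∀ x ∈ B, D x = 0 → ∃ z ∈ B, D z = x

variable {d : M →ₗ[S] M} {d' : M' →ₗ[S] M'} {f : M →ₗ[S] M'}

theorem coneDifferential_coneDifferential (hd : ∀ x, d (d x) = 0) (hd' : ∀ y, d' (d' y) = 0)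
    (hf : ∀ x, f (d x) = d' (f x)) (x : M × M') :
    coneDifferential d d' f (coneDifferential d d' f x) = 0 := by
  simp [hd, hd', hf]

/-- The mapping cone of a quasi-isomorphism is exact. -/
theorem InducesIsoAt.isExactOn_cone (hf : ∀ x, f (d x) = d' (f x))
    (h : InducesIsoAt d ⊤ ⊤ d' ⊤ ⊤ f) : IsExactOn (coneDifferential d d' f) ⊤ := by
  obtain ⟨h1, h2, hinj, hsurj⟩ := h
  rintro ⟨x, y⟩ - hxy
  rw [coneDifferential_apply, Prod.mk_eq_zero, sub_eq_zero] at hxy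
  obtain ⟨hx, hy⟩ := hxy
  obtain ⟨z₀, hz₀⟩ : ∃ z, d z = x := by
    have hx' : x ∈ ⊤ ⊓ LinearMap.ker d := ⟨trivial, hx⟩
    have h3 := @hinj (Submodule.Quotient.mk ⟨x, hx'⟩) 0 (by
      rw [map_zero]
      refine (Submodule.Quotient.mk_eq_zero _).2 ?_
      rw [mem_submoduleOf_iff]
      exact ⟨y, trivial, hy.symm⟩)
    rw [Submodule.Quotient.mk_eq_zero, mem_submoduleOf_iff] at h3
    obtain ⟨z, -, hz⟩ := h3
    exact ⟨z, hz⟩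
  have hcyc : f z₀ - y ∈ ⊤ ⊓ LinearMap.ker d' := by
    refine ⟨trivial, ?_⟩
    change d' (f z₀ - y) = 0
    rw [map_sub, ← hf, hz₀]
    exact sub_eq_zero.2 hy
  obtain ⟨c, hc⟩ := hsurj (Submodule.Quotient.mk ⟨f z₀ - y, hcyc⟩)
  obtain ⟨c, rfl⟩ := Submodule.Quotient.mk_surjective _ c
  have h4 := (Submodule.Quotient.eq _).1 hc
  rw [mem_submoduleOf_iff] at h4
  obtain ⟨w, -, hw⟩ := h4
  have hw' : d' w = f c - (f z₀ - y) := hw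
  refine ⟨(z₀ - c, -w), trivial, ?_⟩
  have hdc : d c = 0 := c.2.2
  rw [coneDifferential_apply]
  refine Prod.ext ?_ ?_
  · change d (z₀ - c) = x
    rw [map_sub, hz₀, hdc, sub_zero]
  · change f (z₀ - c) - d' (-w) = y
    rw [map_sub, map_neg, hw']
    abel

theorem inducesIsoAt_of_conditions {A B : Submodule S M} {A' B' : Submodule S M'}
    (hf : ∀ x, f (d x) = d' (f x)) (hA : ∀ x ∈ A, f x ∈ A') (hB : ∀ x ∈ B, f x ∈ B')
    (hinj : ∀ x ∈ B, d x = 0 → ∀ y ∈ A', f x = d' y → ∃ z ∈ A, d z = x)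
    (hsurj : ∀ y ∈ B', d' y = 0 → ∃ x ∈ B, d x = 0 ∧ ∃ w ∈ A', f x - d' w = y) :
    InducesIsoAt d A B d' A' B' f := by
  have h1 : ∀ x ∈ B ⊓ LinearMap.ker d, f x ∈ B' ⊓ LinearMap.ker d' := fun x hx =>
    ⟨hB x hx.1, by
      change d' (f x) = 0
      rw [← hf, (hx.2 : d x = 0), map_zero]⟩
  refine ⟨h1, ?_, ?_, ?_⟩
  · rintro ⟨x, hx⟩ hxA
    rw [mem_submoduleOf_iff] at hxA
    obtain ⟨a, ha, hax⟩ := hxA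
    rw [Submodule.mem_comap, mem_submoduleOf_iff]
    refine ⟨f a, hA a ha, ?_⟩
    rw [← hf, hax]
    rfl
  · rw [← LinearMap.ker_eq_bot, LinearMap.ker_eq_bot']
    intro q hq
    obtain ⟨⟨x, hx⟩, rfl⟩ := Submodule.Quotient.mk_surjective _ q
    have h2 := (Submodule.Quotient.mk_eq_zero _).1 hq
    rw [mem_submoduleOf_iff] at h2
    obtain ⟨y, hy, hyx⟩ := h2
    obtain ⟨z, hz, hzx⟩ := hinj x hx.1 hx.2 y hy hyx.symm
    rw [Submodule.Quotient.mk_eq_zero, mem_submoduleOf_iff]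
    exact ⟨z, hz, hzx⟩
  · intro q
    obtain ⟨⟨y, hy⟩, rfl⟩ := Submodule.Quotient.mk_surjective _ q
    obtain ⟨x, hx, hdx, w, hw, hxw⟩ := hsurj y hy.1 hy.2
    refine ⟨Submodule.Quotient.mk ⟨x, hx, hdx⟩, ?_⟩
    refine (Submodule.Quotient.eq _).2 ?_
    rw [mem_submoduleOf_iff]
    refine ⟨w, hw, ?_⟩
    change d' w = f x - y
    rw [← hxw]
    abel

end Cone

/-! ### Contracting homotopies -/

section Homotopy

variable {R V W : Type*} [Field R] [AddCommGroup V] [Module R V] [AddCommGroup W] [Module R W]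

/-- Over a field, an exact complex has a contracting homotopy. -/
theorem IsExactOn.exists_homotopy {D : V →ₗ[R] V} (hDD : ∀ x, D (D x) = 0)
    (h : IsExactOn D ⊤) : ∃ s : V →ₗ[R] V, ∀ x, D (s x) + s (D x) = x := by
  obtain ⟨g, hg⟩ := LinearMap.exists_rightInverse_of_surjective D.rangeRestrict
    D.range_rangeRestrict
  obtain ⟨s, hs⟩ := LinearMap.exists_extend g
  have hDs : ∀ y, D y = 0 → D (s y) = y := by
    intro y hy
    obtain ⟨z, -, rfl⟩ := h y trivial hy
    have h1 := LinearMap.congr_fun hs (D.rangeRestrict z)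
    have h2 := LinearMap.congr_fun hg (D.rangeRestrict z)
    rw [LinearMap.comp_apply] at h1 h2
    have h3 : s (D z) = g (D.rangeRestrict z) := h1
    rw [h3]
    exact congrArg Subtype.val h2
  -- `s` inverts `D` on cycles; `1 - s D` maps into the cycles.
  refine ⟨s ∘ₗ (LinearMap.id - s ∘ₗ D), fun x => ?_⟩
  simp only [LinearMap.comp_apply, LinearMap.sub_apply, LinearMap.id_apply, hDD, map_zero,
    sub_zero]
  rw [hDs _ (by rw [map_sub, hDs _ (hDD x), sub_self])]
  abel

/-- The contracting homotopy can be chosen to anticommute with an involution that anticommutes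
with the differential. -/
theorem exists_homotopy_anticommute [CharZero R] {D s : V →ₗ[R] V}
    (h : ∀ x, D (s x) + s (D x) = x) {τ : V →ₗ[R] V} (hτ : ∀ x, τ (τ x) = x)
    (hD : ∀ x, τ (D x) = -D (τ x)) :
    ∃ s' : V →ₗ[R] V, (∀ x, D (s' x) + s' (D x) = x) ∧ ∀ x, τ (s' x) = -s' (τ x) := by
  have h2 : (2 : R) ≠ 0 := two_ne_zero
  have hD' : ∀ x, D (τ x) = -τ (D x) := fun x => by rw [hD, neg_neg]
  -- Average the contracting homotopies `s` and `-τ s τ`.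
  refine ⟨(2 : R)⁻¹ • (s - τ ∘ₗ s ∘ₗ τ), fun x => ?_, fun x => ?_⟩
  · have h3 := congrArg τ (h (τ x))
    rw [map_add, hτ, hD', hD, map_neg, map_neg] at h3
    simp only [LinearMap.smul_apply, LinearMap.sub_apply, LinearMap.comp_apply, map_smul, map_sub,
      ← smul_add]
    rw [inv_smul_eq_iff₀ h2, two_smul]
    calc D (s x) - D (τ (s (τ x))) + (s (D x) - τ (s (τ (D x)))) =
        (D (s x) + s (D x)) + (-D (τ (s (τ x))) + -τ (s (τ (D x)))) := by abel
      _ = x + x := by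
        rw [h x]
        congr 1
  · simp only [LinearMap.smul_apply, LinearMap.sub_apply, LinearMap.comp_apply, map_smul, map_sub,
      hτ, ← smul_neg]
    congr 1
    abel

/-- The data of a homotopy equivalence, extracted from a contracting homotopy of the cone. -/
theorem exists_homotopyInverse [CharZero R] {d : V →ₗ[R] V} {d' : W →ₗ[R] W} {f : V →ₗ[R] W}
    (hd : ∀ x, d (d x) = 0) (hd' : ∀ y, d' (d' y) = 0) (hf : ∀ x, f (d x) = d' (f x))
    (h : IsExactOn (coneDifferential d d' f) ⊤) {τ : V →ₗ[R] V} {τ' : W →ₗ[R] W}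
    (hτ : ∀ x, τ (τ x) = x) (hτ' : ∀ x, τ' (τ' x) = x) (hτd : ∀ x, τ (d x) = -d (τ x))
    (hτd' : ∀ x, τ' (d' x) = -d' (τ' x)) (hτf : ∀ x, τ' (f x) = f (τ x)) :
    ∃ (g : W →ₗ[R] V) (k : V →ₗ[R] V) (k' : W →ₗ[R] W),
      (∀ x, g (d' x) = d (g x)) ∧ (∀ x, τ (g x) = g (τ' x)) ∧
      (∀ x, d (k x) + k (d x) = x - g (f x)) ∧ (∀ x, τ (k x) = -k (τ x)) ∧
      (∀ x, d' (k' x) + k' (d' x) = x - f (g x)) ∧ (∀ x, τ' (k' x) = -k' (τ' x)) := by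
  obtain ⟨s₀, hs₀⟩ := h.exists_homotopy (coneDifferential_coneDifferential hd hd' hf)
  obtain ⟨s, hs, hsτ⟩ := exists_homotopy_anticommute hs₀ (τ := LinearMap.prodMap τ (-τ'))
    (fun x => by simp [hτ, hτ'])
    (fun x => by
      refine Prod.ext ?_ ?_
      · simp [hτd]
      · simp [hτd', hτf])
  have h1 : ∀ v, (d (s (v, 0)).1 + (s (d v, f v)).1 = v) := fun v => by
    simpa using congrArg Prod.fst (hs (v, 0))
  have h2 : ∀ w, (d (s (0, w)).1 + (s (0, -d' w)).1 = 0) := fun w => by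
    simpa using congrArg Prod.fst (hs (0, w))
  have h3 : ∀ w, (f (s (0, w)).1 - d' (s (0, w)).2 + (s (0, -d' w)).2 = w) := fun w => by
    simpa using congrArg Prod.snd (hs (0, w))
  have e1 : ∀ v w, s (v, w) = s (v, 0) + s (0, w) := fun v w => by rw [← map_add]; simp
  have e2 : ∀ w, s (0, -w) = -s (0, w) := fun w => by rw [← map_neg]; simp
  have e3 : ∀ v, s (-v, 0) = -s (v, 0) := fun w => by rw [← map_neg]; simp
  -- The inverse and the homotopies are the matrix entries of `s`.
  refine ⟨LinearMap.fst R V W ∘ₗ s ∘ₗ LinearMap.inr R V W,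
    LinearMap.fst R V W ∘ₗ s ∘ₗ LinearMap.inl R V W,
    -(LinearMap.snd R V W ∘ₗ s ∘ₗ LinearMap.inr R V W), ?_, ?_, ?_, ?_, ?_, ?_⟩
  · intro x
    have := h2 x
    rw [e2] at this
    exact (sub_eq_zero.1 ((sub_eq_add_neg _ _).trans this)).symm
  · intro x
    have := congrArg Prod.fst (hsτ (0, x))
    simpa [e2] using this
  · intro x
    have := h1 x
    rw [e1 (d x)] at this
    change d (s (x, 0)).1 + (s (d x, 0)).1 = x - (s (0, f x)).1
    rw [eq_sub_iff_add_eq, add_assoc]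
    exact this
  · intro x
    have := congrArg Prod.fst (hsτ (x, 0))
    simpa using this
  · intro x
    have := h3 x
    rw [e2] at this
    change d' (-(s (0, x)).2) + -(s (0, d' x)).2 = x - f (s (0, x)).1
    rw [map_neg, eq_sub_iff_add_eq]
    refine Eq.trans ?_ this
    change _ = f (s (0, x)).1 - d' (s (0, x)).2 + -(s (0, d' x)).2
    abel
  · intro x
    have := congrArg Prod.snd (hsτ (0, x))
    simp only [LinearMap.prodMap_apply, map_zero, LinearMap.neg_apply, e2, neg_neg] at this
    change τ' (-(s (0, x)).2) = -(-(s (0, τ' x)).2)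
    rw [map_neg, this, neg_neg]

end Homotopy

/-! ### The homotopy on tensors -/

namespace TensorSum

section Homotopy

variable {R V W : Type*} [CommRing R] [AddCommGroup V] [Module R V] [AddCommGroup W] [Module R W]

/-- The step of the recursion `homotopy (v ⊗ t) = k v ⊗ T(a) t + σ v ⊗ homotopy t`, on pairs
`(T(a) t, homotopy t)`. -/
def homotopyStep (σ k a : V →ₗ[R] V) :
    V →ₗ[R] (TensorSum R V × TensorSum R V) →ₗ[R] TensorSum R V × TensorSum R V :=
  LinearMap.mk₂ R
    (fun v y => (tensorOne (a v) * y.1, tensorOne (k v) * y.1 + tensorOne (σ v) * y.2))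
    (fun v w y => by
      refine Prod.ext ?_ ?_
      · simp [add_mul]
      · simp only [map_add, add_mul, Prod.snd_add]
        abel)
    (fun r v y => by
      refine Prod.ext ?_ ?_
      · simp
      · simp [smul_add])
    (fun v y z => by
      refine Prod.ext ?_ ?_
      · simp [mul_add]
      · simp only [mul_add, Prod.snd_add, Prod.fst_add]
        abel)
    (fun r v y => by
      refine Prod.ext ?_ ?_
      · simp
      · simp [smul_add])

theorem homotopyStep_apply (σ k a : V →ₗ[R] V) (v : V) (y : TensorSum R V × TensorSum R V) :
    homotopyStep σ k a v y =
      (tensorOne (a v) * y.1, tensorOne (k v) * y.1 + tensorOne (σ v) * y.2) := rfl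

/-- The homotopy `x₁ ⊗ ⋯ ⊗ xₙ ↦ ∑ᵢ σ x₁ ⊗ ⋯ ⊗ σ x_{i-1} ⊗ k xᵢ ⊗ a x_{i+1} ⊗ ⋯ ⊗ a xₙ`. -/
def homotopy (σ k a : V →ₗ[R] V) : TensorSum R V →ₗ[R] TensorSum R V :=
  LinearMap.snd R _ _ ∘ₗ fold (homotopyStep σ k a) (1, 0)

theorem homotopy_one (σ k a : V →ₗ[R] V) : homotopy σ k a 1 = 0 := by
  rw [homotopy, LinearMap.comp_apply, fold_one]
  rfl

theorem homotopy_cons (σ k a : V →ₗ[R] V) (v : V) (t : TensorSum R V) :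
    homotopy σ k a (tensorOne v * t) =
      tensorOne (k v) * map a t + tensorOne (σ v) * homotopy σ k a t := by
  have h1 : LinearMap.fst R _ _ ∘ₗ fold (homotopyStep σ k a) (1, 0) = map a := by
    refine ext_rec ?_ fun v t ht => ?_
    · rw [LinearMap.comp_apply, fold_one, map_one]
      rfl
    · rw [LinearMap.comp_apply] at ht ⊢
      rw [fold_mul, homotopyStep_apply, map_cons, ← ht]
      rfl
  rw [homotopy, LinearMap.comp_apply, fold_mul, homotopyStep_apply, ← h1]
  rfl

variable {𝒱 : ℤ → Submodule R V} [DirectSum.Decomposition 𝒱]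

/-- If `k` is a homotopy between the identity and `a`, then the induced map is a homotopy between
the identity and `T(a)`. -/
theorem linearCoderivation_homotopy {d k a : V →ₗ[R] V}
    (hd : ∀ v, shiftSign 𝒱 (d v) = -d (shiftSign 𝒱 v))
    (hk : ∀ v, shiftSign 𝒱 (k v) = -k (shiftSign 𝒱 v))
    (ha : ∀ v, shiftSign 𝒱 (a v) = a (shiftSign 𝒱 v)) (had : ∀ v, a (d v) = d (a v))
    (h : ∀ v, d (k v) + k (d v) = v - a v) (t : TensorSum R V) :
    linearCoderivation 𝒱 d (homotopy (shiftSign 𝒱) k a t) +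
      homotopy (shiftSign 𝒱) k a (linearCoderivation 𝒱 d t) = t - map a t := by
  have : linearCoderivation 𝒱 d ∘ₗ homotopy (shiftSign 𝒱) k a +
      homotopy (shiftSign 𝒱) k a ∘ₗ linearCoderivation 𝒱 d = LinearMap.id - map a := by
    refine ext_rec ?_ fun v t ht => ?_
    · simp [linearCoderivation_one, homotopy_one]
    · simp only [LinearMap.comp_apply, LinearMap.add_apply, LinearMap.sub_apply,
        LinearMap.id_apply] at ht ⊢
      have e1 : tensorOne (d (k v)) = tensorOne (v - a v) - tensorOne (R := R) (k (d v)) := by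
        rw [← h v, map_add, add_sub_cancel_right]
      have e2 : linearCoderivation 𝒱 d (homotopy (shiftSign 𝒱) k a t) = t - map a t -
          homotopy (shiftSign 𝒱) k a (linearCoderivation 𝒱 d t) := by
        rw [← ht, add_sub_cancel_right]
      rw [homotopy_cons, map_add, linearCoderivation_cons, linearCoderivation_cons,
        linearCoderivation_cons, map_add, homotopy_cons, homotopy_cons, e1, e2, hk, hd,
        shiftSign_shiftSign, map_cons, map_linearCoderivation ha had]
      simp only [map_neg, neg_mul_tensor, map_sub, sub_mul, mul_sub]
      abel
  exact LinearMap.congr_fun this t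

end Homotopy

/-- A homotopy equivalence has an exact mapping cone. -/
theorem _root_.isExactOn_cone_of_homotopies {R M N : Type*} [Ring R] [AddCommGroup M] [Module R M]
    [AddCommGroup N] [Module R N] {d : M →ₗ[R] M} {d' : N →ₗ[R] N} {F : M →ₗ[R] N}
    {G : N →ₗ[R] M} {k : M →ₗ[R] M} {k' : N →ₗ[R] N} (hd' : ∀ y, d' (d' y) = 0)
    (hF : ∀ x, F (d x) = d' (F x)) (hG : ∀ y, G (d' y) = d (G y))
    (hk : ∀ x, d (k x) + k (d x) = x - G (F x))
    (hk' : ∀ y, d' (k' y) + k' (d' y) = y - F (G y)) :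
    IsExactOn (coneDifferential d d' F) ⊤ := by
  rintro ⟨x, y⟩ - hxy
  rw [coneDifferential_apply, Prod.mk_eq_zero, sub_eq_zero] at hxy
  obtain ⟨hx, hy⟩ := hxy
  dsimp only at hx hy
  have h1 : d (k x) = x - G (F x) := by
    rw [← hk x, hx, map_zero, add_zero]
  have hFx : d' (F x) = 0 := by rw [hy, hd']
  obtain ⟨u, hu⟩ : ∃ u, u = F (k x) - k' (F x) := ⟨_, rfl⟩
  have hFGF := hk' (F x)
  rw [hFx, map_zero, add_zero] at hFGF
  have hdu : d' u = 0 := by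
    rw [hu, map_sub, ← hF, h1, hFGF, map_sub, sub_self]
  have hu' := hk' u
  rw [hdu, map_zero, add_zero] at hu'
  have hy' := hk' y
  rw [← hy] at hy'
  -- A first approximation is `(k x + G y, -k' y)`; its error in the second component is the cycle
  -- `u`, which is homologous to `F (G u)`.
  refine ⟨(k x + G y - G u, k' u - k' y), trivial, ?_⟩
  refine Prod.ext ?_ ?_
  · change d (k x + G y - G u) = x
    rw [map_sub, map_add, h1, ← hG, ← hG, hdu, ← hy, map_zero, sub_add_cancel, sub_zero]
  · change F (k x + G y - G u) - d' (k' u - k' y) = y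
    have e1 : F (k x) = u + k' (F x) := by rw [hu, sub_add_cancel]
    have e2 : d' (k' y) = y - F (G y) - k' (F x) := by rw [← hy', add_sub_cancel_right]
    rw [map_sub, map_sub, map_add, hu', e1, e2]
    abel

end TensorSum

/-! ### Exactness from leading terms -/

section Filtration

variable {R M : Type*} [Ring R] [AddCommGroup M] [Module R M]

/-- Exactness passes from a graded differential `D'` to a differential `D` that agrees with `D'`
modulo lower terms of an exhaustive filtration: cancel the top component of a cycle and induct. -/
theorem IsExactOn.of_filtration {D D' : M →ₗ[R] M} {S : Submodule R M} (h : IsExactOn D' S)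
    (F : ℕ → Submodule R M) (p : ℕ → M →ₗ[R] M) (hF₀ : ∀ x ∈ F 0, x = 0)
    (hF : ∀ x, ∃ n, x ∈ F n) (hp : ∀ n, ∀ x ∈ F (n + 1), x - p n x ∈ F n)
    (hpF : ∀ n x, p n x ∈ F (n + 1)) (hpF₀ : ∀ n, ∀ x ∈ F n, p n x = 0)
    (hpS : ∀ n, ∀ x ∈ S, p n x ∈ S) (hpp : ∀ n x, p n (p n x) = p n x)
    (hpD : ∀ n x, D' (p n x) = p n (D' x)) (hD : ∀ n, ∀ x ∈ F (n + 1), D x - D' x ∈ F n)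
    (hDS : ∀ x ∈ S, D x ∈ S) (hDD : ∀ x, D (D x) = 0) : IsExactOn D S := by
  have key : ∀ n, ∀ x ∈ S, x ∈ F n → D x = 0 → ∃ z ∈ S, D z = x := by
    intro n
    induction n with
    | zero =>
      intro x _ hx0 _
      exact ⟨0, S.zero_mem, by rw [map_zero, hF₀ x hx0]⟩
    | succ n ih =>
      intro x hx hxF hDx
      -- The top component of the cycle `x` is a cycle of `D'`.
      obtain ⟨z, hz, hDz⟩ := h (p n x) (hpS n x hx) (by
        have h1 := hpF₀ n _ (hD n x hxF)
        rw [hDx, zero_sub, map_neg, neg_eq_zero] at h1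
        rw [hpD, h1])
      have hDz' : D' (p n z) = p n x := by rw [hpD, hDz, hpp]
      obtain ⟨w, hw, hDw⟩ := ih (x - D (p n z)) (S.sub_mem hx (hDS _ (hpS n z hz))) (by
        have e : x - D (p n z) = (x - p n x) - (D (p n z) - D' (p n z)) := by
          rw [hDz']
          abel
        rw [e]
        exact (F n).sub_mem (hp n x hxF) (hD n _ (hpF n z))) (by
        rw [map_sub, hDx, hDD, sub_zero])
      refine ⟨w + p n z, S.add_mem hw (hpS n z hz), ?_⟩
      rw [map_add, hDw, sub_add_cancel]
  intro x hx hDx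
  obtain ⟨n, hn⟩ := hF x
  exact key n x hx hn hDx

end Filtration

namespace Nov

section Completeness

variable {R M N P : Type*} [CommRing R] [AddCommGroup M] [Module R M] [AddCommGroup N]
  [Module R N] [AddCommGroup P] [Module R P]

theorem exists_nat_mul_gt {l : ℝ≥0} (hl : 0 < l) (E : ℝ≥0) : ∃ K : ℕ, E < K * l := by
  obtain ⟨K, hK⟩ := exists_nat_gt (E / l)
  exact ⟨K, by rwa [div_lt_iff₀ hl] at hK⟩

theorem coeff_eq_zero_of_lt {x : Nov R M} {E : ℝ≥0} (hx : x ∈ energy R M E) {g : NovExp}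
    (hg : g.1 < E) : x.coeff g = 0 := by
  by_contra h
  exact absurd (hx g h) (not_le.2 hg)

/-- Series of increasing energy can be summed. -/
theorem exists_tendsto_sum {l : ℝ≥0} (hl : 0 < l) (z : ℕ → Nov R M)
    (hz : ∀ k : ℕ, z k ∈ energy R M (k * l)) :
    ∃ Z : Nov R M, ∀ K : ℕ, Z - ∑ k ∈ Finset.range K, z k ∈ energy R M (K * l) := by
  have hzero : ∀ (g : NovExp) (K k : ℕ), g.1 < K * l → K ≤ k → (z k).coeff g = 0 := by
    intro g K k hg hk
    exact coeff_eq_zero_of_lt (hz k) (hg.trans_le (by gcongr))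
  let u : ℕ → R →ₗ[R] Nov R M := fun k => LinearMap.toSpanSingleton R (Nov R M) (z k)
  have hu : ∀ x : R, ∀ E : ℝ≥0, ∃ D : ℕ, ∀ n, D ≤ n → ∀ g : NovExp, g.1 ≤ E →
      (u n x).coeff g = 0 := by
    intro x E
    obtain ⟨K, hK⟩ := exists_nat_mul_gt hl E
    refine ⟨K, fun n hn g hg => ?_⟩
    rw [LinearMap.toSpanSingleton_apply, coeff_smul, hzero g K n (hg.trans_lt hK) hn, smul_zero]
  refine ⟨sumMap u hu 1, fun K g hg => ?_⟩
  by_contra hlt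
  rw [not_le] at hlt
  refine hg ?_
  have h1 : (sumMap u hu 1).coeff g = ∑ᶠ k, (u k 1).coeff g := rfl
  rw [coeff_sub, coeff_sum, h1, finsum_eq_sum_of_support_subset (s := Finset.range K), sub_eq_zero]
  · refine Finset.sum_congr rfl fun k _ => ?_
    rw [LinearMap.toSpanSingleton_apply, one_smul]
  · intro k hk
    by_contra hk'
    refine hk ?_
    change (u k 1).coeff g = 0
    rw [LinearMap.toSpanSingleton_apply, one_smul, hzero g K k hlt (by simpa using hk')]

/-- Exactness of a completed complex follows from exactness of its part of energy zero, if there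
is an energy gap: cycles are cancelled energy by energy. -/
theorem isExactOn_lift {Φ : M →ₗ[R] Nov R M} {l : ℝ≥0} (hl : 0 < l)
    (hgap : ∀ v, Φ v ∈ gapSubmodule R M l) {S : Submodule R M}
    (hS : ∀ v ∈ S, Φ v ∈ coeffsIn S) (hΦ : ∀ x, lift Φ (lift Φ x) = 0)
    (h : IsExactOn (coeffHom R M 0 ∘ₗ Φ) S) : IsExactOn (lift Φ) (coeffsIn S) := by
  -- A choice of preimages under the part of energy zero, with `0` chosen for `0`, so that
  -- coefficientwise application preserves the finiteness condition of Novikov series.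
  have hc : ∀ v : M, ∃ w : M, (v ∈ S → (Φ v).coeff 0 = 0 → w ∈ S ∧ (Φ w).coeff 0 = v) ∧
      (v = 0 → w = 0) := by
    intro v
    by_cases h0 : v = 0
    · exact ⟨0, fun _ _ => ⟨S.zero_mem, by rw [map_zero, h0]; rfl⟩, fun _ => rfl⟩
    by_cases h1 : v ∈ S ∧ (Φ v).coeff 0 = 0
    · obtain ⟨w, hw, hw'⟩ := h v h1.1 h1.2
      exact ⟨w, fun _ _ => ⟨hw, hw'⟩, fun h => absurd h h0⟩
    · exact ⟨0, fun h h' => absurd ⟨h, h'⟩ h1, fun _ => rfl⟩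
  choose c hc hc0 using hc
  -- A cycle of energy at least `E` is homologous to one of energy at least `E + l`.
  have step : ∀ (E : ℝ≥0) (x : Nov R M), ∃ z : Nov R M, x ∈ coeffsIn S → x ∈ energy R M E →
      lift Φ x = 0 → z ∈ coeffsIn S ∧ z ∈ energy R M E ∧ x - lift Φ z ∈ energy R M (E + l) := by
    intro E x
    let z : Nov R M := ⟨fun g => if g.1 < E + l then c (x.coeff g) else 0, fun E' => by
      refine (x.finite_coeff E').subset ?_
      rintro g ⟨hg, h'⟩
      refine ⟨hg, fun h2 => h' ?_⟩
      change (if g.1 < E + l then c (x.coeff g) else 0) = 0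
      rw [h2, hc0 0 rfl, ite_self]⟩
    have hz : ∀ g, z.coeff g = if g.1 < E + l then c (x.coeff g) else 0 := fun g => rfl
    refine ⟨z, fun hxS hxE hx => ?_⟩
    have hcyc : ∀ g : NovExp, g.1 < E + l →
        c (x.coeff g) ∈ S ∧ (Φ (c (x.coeff g))).coeff 0 = x.coeff g := by
      intro g hg
      refine hc _ (hxS g) ?_
      rw [← coeff_lift_of_gap hgap hxE hg, hx]
      rfl
    have hzE : z ∈ energy R M E := by
      intro g hg
      refine hxE g fun h0 => hg ?_
      rw [hz, h0, hc0 0 rfl, ite_self]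
    refine ⟨fun g => ?_, hzE, fun g hg => ?_⟩
    · rw [hz]
      split_ifs with hg
      · exact (hcyc g hg).1
      · exact S.zero_mem
    · by_contra hlt
      rw [not_le] at hlt
      refine hg ?_
      rw [coeff_sub, coeff_lift_of_gap hgap hzE hlt, hz, if_pos hlt, (hcyc g hlt).2, sub_self]
  choose z hz using step
  -- Iterate: `xs k` is homologous to `x` and has energy at least `k l`.
  intro x hxS hx
  let xs : ℕ → Nov R M := fun k => Nat.rec x (fun k y => y - lift Φ (z (k * l) y)) k
  have hxs : ∀ k, xs (k + 1) = xs k - lift Φ (z (k * l) (xs k)) := fun k => rfl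
  have hinv : ∀ k, xs k ∈ coeffsIn S ∧ xs k ∈ energy R M (k * l) ∧ lift Φ (xs k) = 0 := by
    intro k
    induction k with
    | zero => exact ⟨hxS, by simpa using mem_energy_zero _, hx⟩
    | succ k ih =>
      obtain ⟨h1, h2, h3⟩ := hz _ _ ih.1 ih.2.1 ih.2.2
      rw [hxs]
      refine ⟨Submodule.sub_mem _ ih.1 (lift_mem_coeffsIn hS h1), ?_, ?_⟩
      · have e : ((k + 1 : ℕ) : ℝ≥0) * l = k * l + l := by
          push_cast
          ring
        rw [e]
        exact h3
      · rw [map_sub, ih.2.2, hΦ, sub_zero]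
  have hzk := fun k => hz _ _ (hinv k).1 (hinv k).2.1 (hinv k).2.2
  obtain ⟨Z, hZ⟩ := exists_tendsto_sum hl (fun k => z (k * l) (xs k)) fun k => (hzk k).2.1
  have hpart : ∀ K : ℕ, x - lift Φ (∑ k ∈ Finset.range K, z (k * l) (xs k)) = xs K := by
    intro K
    induction K with
    | zero =>
      rw [Finset.sum_range_zero, map_zero, sub_zero]
      rfl
    | succ K ih => rw [Finset.sum_range_succ, map_add, ← sub_sub, ih, hxs]
  refine ⟨Z, fun g => ?_, ?_⟩
  · obtain ⟨K, hK⟩ := exists_nat_mul_gt hl g.1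
    have h1 := coeff_eq_zero_of_lt (hZ K) hK
    rw [coeff_sub, sub_eq_zero] at h1
    rw [h1, coeff_sum]
    exact S.sum_mem fun k _ => (hzk k).1 g
  · refine (sub_eq_zero.1 (Nov.ext fun g => ?_)).symm
    obtain ⟨K, hK⟩ := exists_nat_mul_gt hl g.1
    have e : x - lift Φ Z = xs K - lift Φ (Z - ∑ k ∈ Finset.range K, z (k * l) (xs k)) := by
      rw [← hpart K, map_sub]
      abel
    rw [e, coeff_zero]
    exact coeff_eq_zero_of_lt
      (Submodule.sub_mem _ (hinv K).2.1 (lift_mem_energy Φ (hZ K))) hK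

theorem lift_map (φ : N →ₗ[R] Nov R P) (h : M →ₗ[R] N) (x : Nov R M) :
    lift φ (map h x) = lift (φ ∘ₗ h) x := by
  refine Nov.ext fun g => ?_
  change (liftR φ (map h x)).coeff g = _
  rw [coeff_liftR_eq φ _ g (x.supp g.1), coeff_lift]
  · refine Finset.sum_congr rfl fun a ha => ?_
    rw [if_pos (mem_supp.1 ha).1]
    rfl
  · intro a ha
    rw [mem_supp] at ha ⊢
    refine ⟨ha.1, fun h0 => ha.2 ?_⟩
    rw [coeff_map, h0, map_zero]

theorem map_lift (h : N →ₗ[R] P) (φ : M →ₗ[R] Nov R N) (x : Nov R M) :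
    map h (lift φ x) = lift (map h ∘ₗ φ) x := by
  refine Nov.ext fun g => ?_
  rw [coeff_map, coeff_lift, coeff_lift, map_sum]
  rfl

theorem lift_sub_hom (φ ψ : M →ₗ[R] Nov R N) (x : Nov R M) :
    lift (φ - ψ) x = lift φ x - lift ψ x := by
  refine Nov.ext fun g => ?_
  rw [coeff_sub, coeff_lift, coeff_lift, coeff_lift, ← Finset.sum_sub_distrib]
  rfl

theorem coeff_zero_lift_of_gap {φ : M →ₗ[R] Nov R N} {l : ℝ≥0} (hl : 0 < l)
    (hφ : ∀ v, φ v ∈ gapSubmodule R N l) (x : Nov R M) :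
    (lift φ x).coeff 0 = (φ (x.coeff 0)).coeff 0 :=
  coeff_lift_of_gap hφ (mem_energy_zero x) (by simpa using hl)

end Completeness

section Cone

variable {R M N : Type*} [CommRing R] [AddCommGroup M] [Module R M] [AddCommGroup N]
  [Module R N]

/-- The differential of the mapping cone before completion. -/
def coneSeries (d : M →ₗ[R] Nov R M) (d' : N →ₗ[R] Nov R N) (f : M →ₗ[R] Nov R N) :
    M × N →ₗ[R] Nov R (M × N) :=
  map (LinearMap.inl R M N) ∘ₗ d ∘ₗ LinearMap.fst R M N +
    map (LinearMap.inr R M N) ∘ₗ (f ∘ₗ LinearMap.fst R M N - d' ∘ₗ LinearMap.snd R M N)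

variable (d : M →ₗ[R] Nov R M) (d' : N →ₗ[R] Nov R N) (f : M →ₗ[R] Nov R N)

theorem coeff_coneSeries (v : M × N) (g : NovExp) :
    (coneSeries d d' f v).coeff g = ((d v.1).coeff g, (f v.1).coeff g - (d' v.2).coeff g) := by
  change ((d v.1).coeff g, 0) + (0, (f v.1 - d' v.2).coeff g) = _
  simp

theorem map_fst_lift_coneSeries (x : Nov R (M × N)) :
    map (LinearMap.fst R M N) (lift (coneSeries d d' f) x) =
      lift d (map (LinearMap.fst R M N) x) := by
  rw [map_lift, lift_map]
  congr 2
  refine LinearMap.ext fun v => Nov.ext fun g => ?_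
  change ((coneSeries d d' f v).coeff g).1 = _
  rw [coeff_coneSeries]
  rfl

theorem map_snd_lift_coneSeries (x : Nov R (M × N)) :
    map (LinearMap.snd R M N) (lift (coneSeries d d' f) x) =
      lift f (map (LinearMap.fst R M N) x) - lift d' (map (LinearMap.snd R M N) x) := by
  rw [map_lift, lift_map, lift_map, ← lift_sub_hom]
  congr 2
  refine LinearMap.ext fun v => Nov.ext fun g => ?_
  change ((coneSeries d d' f v).coeff g).2 = _
  rw [coeff_coneSeries]
  rfl

theorem ext_prod {x y : Nov R (M × N)}
    (h : map (LinearMap.fst R M N) x = map (LinearMap.fst R M N) y)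
    (h' : map (LinearMap.snd R M N) x = map (LinearMap.snd R M N) y) : x = y :=
  Nov.ext fun g => Prod.ext (congrArg (fun z => coeff z g) h) (congrArg (fun z => coeff z g) h')

variable {d d' f}

/-- The completed mapping cone is exact if its part of energy zero is. -/
theorem isExactOn_cone {l : ℝ≥0} (hl : 0 < l) (hd : ∀ v, d v ∈ gapSubmodule R M l)
    (hd' : ∀ v, d' v ∈ gapSubmodule R N l) (hf : ∀ v, f v ∈ gapSubmodule R N l)
    {S : Submodule R M} {S' : Submodule R N} (hdS : ∀ v ∈ S, d v ∈ coeffsIn S)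
    (hdS' : ∀ v ∈ S', d' v ∈ coeffsIn S') (hfS : ∀ v ∈ S, f v ∈ coeffsIn S')
    (hdd : ∀ x, lift d (lift d x) = 0) (hdd' : ∀ x, lift d' (lift d' x) = 0)
    (hfd : ∀ x, lift f (lift d x) = lift d' (lift f x))
    (h : IsExactOn (coneDifferential (coeffHom R M 0 ∘ₗ d) (coeffHom R N 0 ∘ₗ d')
      (coeffHom R N 0 ∘ₗ f)) (S.prod S')) :
    ∀ x ∈ coeffsIn S, ∀ y ∈ coeffsIn S', lift d x = 0 → lift f x = lift d' y →
      ∃ z ∈ coeffsIn S, ∃ w ∈ coeffsIn S', lift d z = x ∧ lift f z - lift d' w = y := by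
  have h1 : IsExactOn (lift (coneSeries d d' f)) (coeffsIn (S.prod S')) := by
    refine isExactOn_lift hl ?_ ?_ ?_ ?_
    · intro v g hg hl
      rw [coeff_coneSeries, hd _ g hg hl, hf _ g hg hl, hd' _ g hg hl, sub_zero]
      rfl
    · intro v hv g
      rw [coeff_coneSeries]
      exact ⟨hdS _ hv.1 g, S'.sub_mem (hfS _ hv.1 g) (hdS' _ hv.2 g)⟩
    · intro x
      refine ext_prod ?_ ?_
      · rw [map_fst_lift_coneSeries, map_fst_lift_coneSeries, hdd, map_zero]
      · rw [map_snd_lift_coneSeries, map_snd_lift_coneSeries, map_fst_lift_coneSeries, map_sub,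
          hfd, hdd', sub_zero, sub_self, map_zero]
    · have e : coeffHom R (M × N) 0 ∘ₗ coneSeries d d' f =
          coneDifferential (coeffHom R M 0 ∘ₗ d) (coeffHom R N 0 ∘ₗ d')
            (coeffHom R N 0 ∘ₗ f) :=
        LinearMap.ext fun v => coeff_coneSeries d d' f v 0
      rw [e]
      exact h
  intro x hx y hy hdx hfx
  obtain ⟨X, hX1, hX2⟩ : ∃ X : Nov R (M × N), map (LinearMap.fst R M N) X = x ∧
      map (LinearMap.snd R M N) X = y := by
    refine ⟨map (LinearMap.inl R M N) x + map (LinearMap.inr R M N) y, Nov.ext fun g => ?_,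
      Nov.ext fun g => ?_⟩ <;> simp
  obtain ⟨Z, hZ, hZX⟩ := h1 X
    (fun g => ⟨by rw [← hX1] at hx; exact hx g, by rw [← hX2] at hy; exact hy g⟩) (by
      refine ext_prod ?_ ?_
      · rw [map_fst_lift_coneSeries, hX1, hdx, map_zero]
      · rw [map_snd_lift_coneSeries, hX1, hX2, hfx, sub_self, map_zero])
  refine ⟨map (LinearMap.fst R M N) Z, fun g => (hZ g).1, map (LinearMap.snd R M N) Z,
    fun g => (hZ g).2, ?_, ?_⟩
  · rw [← map_fst_lift_coneSeries d d' f, hZX, hX1]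
  · rw [← map_snd_lift_coneSeries d d' f, hZX, hX2]

end Cone

end Nov

/-! ### Projections to the degree parts of the completed bar construction -/

section BarProj

variable {R V W : Type*} [CommRing R] [AddCommGroup V] [Module R V] [AddCommGroup W] [Module R W]
  (𝒱 : ℤ → Submodule R V) [DirectSum.Decomposition 𝒱]

/-- The projection to the part of degree `p`. It is only `R`-linear, as `e` has degree `2`. -/
def barProj (p : ℤ) : Bar R V →ₗ[R] Bar R V where
  toFun x := ⟨fun g => degreeProj 𝒱 (p - 2 * g.2) (x.coeff g), fun E => by
    refine (x.finite_coeff E).subset ?_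
    rintro g ⟨hg, h⟩
    refine ⟨hg, fun h0 => h ?_⟩
    change degreeProj 𝒱 (p - 2 * g.2) (x.coeff g) = 0
    rw [h0, map_zero]⟩
  map_add' x y := Nov.ext fun g => map_add (degreeProj 𝒱 (p - 2 * g.2)) (x.coeff g) (y.coeff g)
  map_smul' r x := Nov.ext fun g => map_smul (degreeProj 𝒱 (p - 2 * g.2)) r (x.coeff g)

theorem coeff_barProj (p : ℤ) (x : Bar R V) (g : NovExp) :
    (barProj 𝒱 p x).coeff g = degreeProj 𝒱 (p - 2 * g.2) (x.coeff g) := rfl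

theorem barProj_mem (p : ℤ) (x : Bar R V) : barProj 𝒱 p x ∈ barDegree 𝒱 p :=
  fun _ => degreeProj_mem 𝒱 _ _

variable {𝒱}

theorem barProj_of_mem {p : ℤ} {x : Bar R V} (hx : x ∈ barDegree 𝒱 p) : barProj 𝒱 p x = x :=
  Nov.ext fun g => by rw [coeff_barProj, degreeProj_of_mem 𝒱 (hx g), if_pos rfl]

theorem TensorSum.HasTensorDegree.lift_barProj {𝒲 : ℤ → Submodule R W} [DirectSum.Decomposition 𝒲]
    {A : TensorSum R V →ₗ[R] Bar R W} {r : ℤ} (hA : HasTensorDegree 𝒱 𝒲 A r) (p : ℤ)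
    (x : Bar R V) : Nov.lift A (barProj 𝒱 p x) = barProj 𝒲 (p + r) (Nov.lift A x) := by
  refine Nov.ext fun g => ?_
  change (Nov.liftR A (barProj 𝒱 p x)).coeff g = _
  rw [Nov.coeff_liftR_eq A _ g (x.supp g.1), coeff_barProj, Nov.coeff_lift, map_sum]
  · refine Finset.sum_congr rfl fun a ha => ?_
    rw [if_pos (Nov.mem_supp.1 ha).1, coeff_barProj, ← hA.degreeProj_coeff]
    congr 2
    change p - 2 * a.2 + r - 2 * (g.2 - a.2) = p + r - 2 * g.2
    ring
  · intro a ha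
    rw [Nov.mem_supp] at ha ⊢
    refine ⟨ha.1, fun h0 => ha.2 ?_⟩
    rw [coeff_barProj, h0, map_zero]

end BarProj

/-! ### The quasi-isomorphism of bar complexes -/

section Equations

variable {R V W : Type*} [CommRing R] [AddCommGroup V] [Module R V] [AddCommGroup W] [Module R W]
  {𝒱 : ℤ → Submodule R V} [DirectSum.Decomposition 𝒱]
  {𝒲 : ℤ → Submodule R W} [DirectSum.Decomposition 𝒲]
  {C₁ : FilteredAInfAlgebra 𝒱} {C₂ : FilteredAInfAlgebra 𝒲}

theorem FilteredAInfAlgebra.lift_lift (C : FilteredAInfAlgebra 𝒱) (x : Bar R V) :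
    Nov.lift (tensorDifferential 𝒱 C.m) (Nov.lift (tensorDifferential 𝒱 C.m) x) = 0 := by
  have h := LinearMap.congr_fun C.d_comp_d x
  rw [barDifferential_eq] at h
  exact h

theorem FilteredAInfHom.lift_comm (f : FilteredAInfHom C₁ C₂) (x : Bar R V) :
    Nov.lift (f.f.tensorMap f.positive) (Nov.lift (tensorDifferential 𝒱 C₁.m) x) =
      Nov.lift (tensorDifferential 𝒲 C₂.m) (Nov.lift (f.f.tensorMap f.positive) x) := by
  have h := LinearMap.congr_fun f.comm x
  rw [FilteredAInfAlgebra.d, FilteredAInfAlgebra.d, barDifferential_eq, barDifferential_eq] at h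
  exact h.symm

theorem Nov.coeff_lift_const_of_gap {M N P : Type*} [AddCommGroup M] [Module R M]
    [AddCommGroup N] [Module R N] [AddCommGroup P] [Module R P] {φ : N →ₗ[R] Nov R P}
    {ψ : M →ₗ[R] Nov R N} {l : ℝ≥0} (hl : 0 < l) (hφ : ∀ v, φ v ∈ Nov.gapSubmodule R P l)
    (v : M) : (Nov.lift φ (Nov.lift ψ (Nov.const v))).coeff 0 =
      (Nov.coeffHom R P 0 ∘ₗ φ) ((Nov.coeffHom R N 0 ∘ₗ ψ) v) := by
  rw [Nov.coeff_zero_lift_of_gap hl hφ, Nov.lift_const]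
  rfl

theorem Nov.coeffsIn_top {M : Type*} [AddCommGroup M] [Module R M] :
    Nov.coeffsIn (⊤ : Submodule R M) = ⊤ :=
  eq_top_iff.2 fun _ _ _ => trivial

theorem TensorSum.sub_proj_mem_shorterThan {n : ℕ} {t : TensorSum R V}
    (ht : t ∈ shorterThan R V (n + 1)) : t - proj R V n t ∈ shorterThan R V n := by
  intro m hm
  rw [map_sub, proj_proj]
  split_ifs with hmn
  · rw [hmn, sub_self]
  · rw [ht m (by omega), sub_zero]

end Equations

section QuasiIso

variable {R V W : Type*} [Field R] [AddCommGroup V] [Module R V]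
  [AddCommGroup W] [Module R W]
  {𝒱 : ℤ → Submodule R V} [DirectSum.Decomposition 𝒱]
  {𝒲 : ℤ → Submodule R W} [DirectSum.Decomposition 𝒲]

theorem isPermEquivariant_linearCoderivation [CharZero R] {d : V →ₗ[R] V}
    (hd : ∀ v, shiftSign 𝒱 (d v) = -d (shiftSign 𝒱 v)) :
    IsPermEquivariant 𝒱 𝒱 (linearCoderivation 𝒱 d) :=
  isPermEquivariant_of_derivation (tensorSign_linearCoderivation 𝒱 d hd) (comul_coderivation 𝒱 _)
    (linearCoderivation_mul 𝒱 d) (proj_linearCoderivation 𝒱 d)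

variable {d : V →ₗ[R] V} {d' : W →ₗ[R] W} {f : V →ₗ[R] W}

/-- If the cone of a chain map `f : V → W` is exact, so is the cone of the induced map `T(f)` of
tensor coalgebras: homotopies between `f` and an inverse up to homotopy extend to tensors. The
cone of the map on invariant tensors is exact as well, by averaging. -/
theorem isExactOn_cone_map [CharZero R] (hd : ∀ v, d (d v) = 0) (hd' : ∀ v, d' (d' v) = 0)
    (hf : ∀ v, f (d v) = d' (f v)) (h : IsExactOn (coneDifferential d d' f) ⊤)
    (hdσ : ∀ v, shiftSign 𝒱 (d v) = -d (shiftSign 𝒱 v))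
    (hdσ' : ∀ v, shiftSign 𝒲 (d' v) = -d' (shiftSign 𝒲 v))
    (hf₀ : ∀ p, ∀ v ∈ 𝒱 p, f v ∈ 𝒲 p)
    (hfσ : ∀ v, shiftSign 𝒲 (f v) = f (shiftSign 𝒱 v)) (H : ∀ n, Subgroup (Equiv.Perm (Fin n))) :
    IsExactOn (coneDifferential (linearCoderivation 𝒱 d) (linearCoderivation 𝒲 d') (map f))
      ((fixedTensors 𝒱 H).prod (fixedTensors 𝒲 H)) := by
  obtain ⟨g, k, k', hg, hgσ, hk, hkσ, hk', hkσ'⟩ := exists_homotopyInverse hd hd' hf h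
    (shiftSign_shiftSign 𝒱) (shiftSign_shiftSign 𝒲) hdσ hdσ' hfσ
  have h1 : IsExactOn
      (coneDifferential (linearCoderivation 𝒱 d) (linearCoderivation 𝒲 d') (map f)) ⊤ := by
    refine isExactOn_cone_of_homotopies (G := map g)
      (k := homotopy (shiftSign 𝒱) k (g ∘ₗ f)) (k' := homotopy (shiftSign 𝒲) k' (f ∘ₗ g))
      (linearCoderivation_linearCoderivation hdσ' hd') (map_linearCoderivation hfσ hf)
      (map_linearCoderivation hgσ hg) (fun t => ?_) (fun t => ?_)
    · rw [map_map]
      exact linearCoderivation_homotopy hdσ hkσ (fun v => by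
        rw [LinearMap.comp_apply, hgσ, hfσ]
        rfl) (fun v => by
        rw [LinearMap.comp_apply, hf, hg]
        rfl) hk t
    · rw [map_map]
      exact linearCoderivation_homotopy hdσ' hkσ' (fun v => by
        rw [LinearMap.comp_apply, hfσ, hgσ]
        rfl) (fun v => by
        rw [LinearMap.comp_apply, hg, hf]
        rfl) hk' t
  have e₁ := isPermEquivariant_linearCoderivation hdσ
  have e₂ := isPermEquivariant_linearCoderivation hdσ'
  have e₃ := isPermEquivariant_map (𝒱 := 𝒱) (𝒲 := 𝒲) hf₀
  rintro ⟨x, y⟩ ⟨hx, hy⟩ hxy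
  obtain ⟨⟨z, w⟩, -, hzw⟩ := h1 (x, y) trivial hxy
  rw [coneDifferential_apply, Prod.mk.injEq] at hzw
  obtain ⟨hz, hw⟩ := hzw
  refine ⟨(average 𝒱 H z, average 𝒲 H w), ⟨average_mem z, average_mem w⟩, ?_⟩
  rw [coneDifferential_apply]
  dsimp only at hz hw ⊢
  rw [e₁.average, e₂.average, e₃.average, ← map_sub, hz, hw, average_of_mem hx, average_of_mem hy]

/-- The filtration by length shows that the cone of the energy zero part of `f̂` is exact. -/
theorem isExactOn_cone_of_leading {D : TensorSum R V →ₗ[R] TensorSum R V}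
    {D' : TensorSum R W →ₗ[R] TensorSum R W} {F : TensorSum R V →ₗ[R] TensorSum R W}
    (hD : ∀ l, (D - linearCoderivation 𝒱 d) (word R l) ∈ shorterThan R V l.length)
    (hD' : ∀ l, (D' - linearCoderivation 𝒲 d') (word R l) ∈ shorterThan R W l.length)
    (hF : ∀ l, (F - map f) (word R l) ∈ shorterThan R W l.length)
    (hDD : ∀ t, D (D t) = 0) (hDD' : ∀ t, D' (D' t) = 0) (hFD : ∀ t, F (D t) = D' (F t))
    {H : ∀ n, Subgroup (Equiv.Perm (Fin n))}
    (hDH : ∀ t ∈ fixedTensors 𝒱 H, D t ∈ fixedTensors 𝒱 H)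
    (hDH' : ∀ t ∈ fixedTensors 𝒲 H, D' t ∈ fixedTensors 𝒲 H)
    (hFH : ∀ t ∈ fixedTensors 𝒱 H, F t ∈ fixedTensors 𝒲 H)
    (h : IsExactOn (coneDifferential (linearCoderivation 𝒱 d) (linearCoderivation 𝒲 d') (map f))
      ((fixedTensors 𝒱 H).prod (fixedTensors 𝒲 H))) :
    IsExactOn (coneDifferential D D' F) ((fixedTensors 𝒱 H).prod (fixedTensors 𝒲 H)) := by
  refine h.of_filtration (fun n => (shorterThan R V n).prod (shorterThan R W n))
    (fun n => LinearMap.prodMap (proj R V n) (proj R W n)) ?_ ?_ ?_ ?_ ?_ ?_ ?_ ?_ ?_ ?_ ?_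
  · rintro ⟨x, y⟩ ⟨hx, hy⟩
    refine Prod.ext (ext_proj fun n => ?_) (ext_proj fun n => ?_)
    · rw [hx n n.zero_le]
      exact (map_zero _).symm
    · rw [hy n n.zero_le]
      exact (map_zero _).symm
  · rintro ⟨x, y⟩
    obtain ⟨N, hN⟩ := exists_forall_proj_eq_zero x
    obtain ⟨N', hN'⟩ := exists_forall_proj_eq_zero y
    exact ⟨max N N', fun n hn => hN n ((le_max_left _ _).trans hn),
      fun n hn => hN' n ((le_max_right _ _).trans hn)⟩
  · rintro n ⟨x, y⟩ ⟨hx, hy⟩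
    exact ⟨sub_proj_mem_shorterThan hx, sub_proj_mem_shorterThan hy⟩
  · rintro n ⟨x, y⟩
    refine ⟨fun m hm => ?_, fun m hm => ?_⟩
    · exact (proj_proj m n x).trans (if_neg (by omega))
    · exact (proj_proj m n y).trans (if_neg (by omega))
  · rintro n ⟨x, y⟩ ⟨hx, hy⟩
    exact Prod.ext (hx n le_rfl) (hy n le_rfl)
  · rintro n ⟨x, y⟩ ⟨hx, hy⟩
    exact ⟨proj_mem_fixedTensors hx n, proj_mem_fixedTensors hy n⟩
  · rintro n ⟨x, y⟩
    refine Prod.ext ?_ ?_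
    · exact (proj_proj n n x).trans (if_pos rfl)
    · exact (proj_proj n n y).trans (if_pos rfl)
  · rintro n ⟨x, y⟩
    refine Prod.ext (proj_linearCoderivation 𝒱 d n x) ?_
    change map f (proj R V n x) - linearCoderivation 𝒲 d' (proj R W n y) =
      proj R W n (map f x - linearCoderivation 𝒲 d' y)
    rw [map_sub, proj_map, proj_linearCoderivation]
  · rintro n ⟨x, y⟩ ⟨hx, hy⟩
    refine ⟨map_mem_shorterThan (k := 1) hD hx, ?_⟩
    have h1 := Submodule.sub_mem _ (map_mem_shorterThan (k := 1) hF hx)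
      (map_mem_shorterThan (k := 1) hD' hy)
    have e : F x - D' y - (map f x - linearCoderivation 𝒲 d' y) =
        (F - map f) x - (D' - linearCoderivation 𝒲 d') y := by
      rw [LinearMap.sub_apply, LinearMap.sub_apply]
      abel
    rw [← e] at h1
    exact h1
  · rintro ⟨x, y⟩ ⟨hx, hy⟩
    exact ⟨hDH x hx, Submodule.sub_mem _ (hFH x hx) (hDH' y hy)⟩
  · exact coneDifferential_coneDifferential hDD hDD' hFD

variable {C₁ : FilteredAInfAlgebra 𝒱} {C₂ : FilteredAInfAlgebra 𝒲}

namespace FilteredAInfHom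

/-- The cone of `f̂` is exact on the series of invariant tensors. -/
theorem exists_of_cycle [CharZero R] (f : FilteredAInfHom C₁ C₂)
    (hC₁ : C₁.m.IsGapped) (hC₂ : C₂.m.IsGapped) (hf : f.f.IsGapped) (hq : f.IsQuasiIso)
    (H : ∀ n, Subgroup (Equiv.Perm (Fin n)))
    (h₁ : ∀ t ∈ fixedTensors 𝒱 H,
      tensorDifferential 𝒱 C₁.m t ∈ Nov.coeffsIn (fixedTensors 𝒱 H))
    (h₂ : ∀ t ∈ fixedTensors 𝒲 H,
      tensorDifferential 𝒲 C₂.m t ∈ Nov.coeffsIn (fixedTensors 𝒲 H))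
    (h₃ : ∀ t ∈ fixedTensors 𝒱 H,
      f.f.tensorMap f.positive t ∈ Nov.coeffsIn (fixedTensors 𝒲 H)) :
    ∀ x ∈ Nov.coeffsIn (fixedTensors 𝒱 H), ∀ y ∈ Nov.coeffsIn (fixedTensors 𝒲 H),
      C₁.d x = 0 → f.hat x = C₂.d y →
        ∃ z ∈ Nov.coeffsIn (fixedTensors 𝒱 H), ∃ w ∈ Nov.coeffsIn (fixedTensors 𝒲 H),
          C₁.d z = x ∧ f.hat z - C₂.d w = y := by
  obtain ⟨l₁, hl₁, hg₁⟩ := hC₁.exists_hasGap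
  obtain ⟨l₂, hl₂, hg₂⟩ := hC₂.exists_hasGap
  obtain ⟨l₃, hl₃, hg₃⟩ := hf.exists_hasGap
  obtain ⟨l, hl, hg₁, hg₂, hg₃⟩ : ∃ l > 0, C₁.m.HasGap l ∧ C₂.m.HasGap l ∧ f.f.HasGap l :=
    ⟨min l₁ (min l₂ l₃), lt_min hl₁ (lt_min hl₂ hl₃), hg₁.anti (min_le_left _ _),
      hg₂.anti ((min_le_right _ _).trans (min_le_left _ _)),
      hg₃.anti ((min_le_right _ _).trans (min_le_right _ _))⟩
  have hδ₁ := tensorDifferential_mem_gap (𝒱 := 𝒱) hg₁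
  have hδ₂ := tensorDifferential_mem_gap (𝒱 := 𝒲) hg₂
  have hδ₃ := tensorMap_mem_gap f.positive hg₃
  -- The equations of the parts of energy zero.
  have hDD₁ : ∀ t, leadingDifferential 𝒱 C₁.m (leadingDifferential 𝒱 C₁.m t) = 0 := fun t =>
    (Nov.coeff_lift_const_of_gap hl hδ₁ t).symm.trans
      (congrArg (fun x => Nov.coeff x 0) (C₁.lift_lift (Nov.const t)))
  have hDD₂ : ∀ t, leadingDifferential 𝒲 C₂.m (leadingDifferential 𝒲 C₂.m t) = 0 := fun t =>
    (Nov.coeff_lift_const_of_gap hl hδ₂ t).symm.trans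
      (congrArg (fun x => Nov.coeff x 0) (C₂.lift_lift (Nov.const t)))
  have hFD : ∀ t, leadingMap f.f f.positive (leadingDifferential 𝒱 C₁.m t) =
      leadingDifferential 𝒲 C₂.m (leadingMap f.f f.positive t) := fun t =>
    (Nov.coeff_lift_const_of_gap hl hδ₃ t).symm.trans
      ((congrArg (fun x => Nov.coeff x 0) (f.lift_comm (Nov.const t))).trans
        (Nov.coeff_lift_const_of_gap hl hδ₂ t))
  -- Their linear parts are the equations of `m̄₁` and `f̄₁`.
  have hdd₁ : ∀ v, C₁.m.reductionOne (C₁.m.reductionOne v) = 0 := fun v =>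
    tensorOne_injective (R := R) <| by
      rw [← leadingDifferential_tensorOne (𝒱 := 𝒱) C₁.positive,
        ← leadingDifferential_tensorOne (𝒱 := 𝒱) C₁.positive, hDD₁, map_zero]
  have hdd₂ : ∀ v, C₂.m.reductionOne (C₂.m.reductionOne v) = 0 := fun v =>
    tensorOne_injective (R := R) <| by
      rw [← leadingDifferential_tensorOne (𝒱 := 𝒲) C₂.positive,
        ← leadingDifferential_tensorOne (𝒱 := 𝒲) C₂.positive, hDD₂, map_zero]
  have hfd : ∀ v, f.f.reductionOne (C₁.m.reductionOne v) =
      C₂.m.reductionOne (f.f.reductionOne v) := fun v =>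
    tensorOne_injective (R := R) <| by
      rw [← leadingMap_tensorOne f.positive hl hg₃,
        ← leadingDifferential_tensorOne (𝒱 := 𝒱) C₁.positive, hFD,
        leadingMap_tensorOne f.positive hl hg₃, leadingDifferential_tensorOne C₂.positive]
  have hexact := isExactOn_cone_of_leading (leadingDifferential_sub_mem C₁.positive)
    (leadingDifferential_sub_mem C₂.positive) (leadingMap_sub_mem f.positive hl hg₃)
    hDD₁ hDD₂ hFD (fun t ht => h₁ t ht 0) (fun t ht => h₂ t ht 0) (fun t ht => h₃ t ht 0)
    (isExactOn_cone_map hdd₁ hdd₂ hfd (InducesIsoAt.isExactOn_cone hfd hq)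
      (shiftSign_reductionOne C₁.degree) (shiftSign_reductionOne C₂.degree)
      (fun p v hv => by simpa using f.degree.reductionOne_mem hv)
      (shiftSign_reductionOne_map f.degree) H)
  have h := Nov.isExactOn_cone hl hδ₁ hδ₂ hδ₃ h₁ h₂ h₃ C₁.lift_lift C₂.lift_lift f.lift_comm hexact
  rw [FilteredAInfAlgebra.d, FilteredAInfAlgebra.d, barDifferential_eq, barDifferential_eq]
  exact h

theorem inducesIsoOn_fixedTensors [CharZero R] (f : FilteredAInfHom C₁ C₂)
    (hC₁ : C₁.m.IsGapped) (hC₂ : C₂.m.IsGapped) (hf : f.f.IsGapped) (hq : f.IsQuasiIso)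
    (H : ∀ n, Subgroup (Equiv.Perm (Fin n)))
    (h₁ : ∀ t ∈ fixedTensors 𝒱 H,
      tensorDifferential 𝒱 C₁.m t ∈ Nov.coeffsIn (fixedTensors 𝒱 H))
    (h₂ : ∀ t ∈ fixedTensors 𝒲 H,
      tensorDifferential 𝒲 C₂.m t ∈ Nov.coeffsIn (fixedTensors 𝒲 H))
    (h₃ : ∀ t ∈ fixedTensors 𝒱 H,
      f.f.tensorMap f.positive t ∈ Nov.coeffsIn (fixedTensors 𝒲 H)) :
    f.InducesIsoOn (Nov.coeffsIn (fixedTensors 𝒱 H)) (Nov.coeffsIn (fixedTensors 𝒲 H)) := by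
  have hd₁ : C₁.d = Nov.lift (tensorDifferential 𝒱 C₁.m) := barDifferential_eq 𝒱 C₁.m
  have hd₂ : C₂.d = Nov.lift (tensorDifferential 𝒲 C₂.m) := barDifferential_eq 𝒲 C₂.m
  have hfh : f.hat = Nov.lift (f.f.tensorMap f.positive) := rfl
  have hcomm : ∀ x, f.hat (C₁.d x) = C₂.d (f.hat x) := fun x =>
    (LinearMap.congr_fun f.comm x).symm
  have hS₁ : ∀ x ∈ Nov.coeffsIn (fixedTensors 𝒱 H), C₁.d x ∈ Nov.coeffsIn (fixedTensors 𝒱 H) :=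
    fun x hx => by
      rw [hd₁]
      exact Nov.lift_mem_coeffsIn h₁ hx
  have hS₂ : ∀ x ∈ Nov.coeffsIn (fixedTensors 𝒲 H), C₂.d x ∈ Nov.coeffsIn (fixedTensors 𝒲 H) :=
    fun x hx => by
      rw [hd₂]
      exact Nov.lift_mem_coeffsIn h₂ hx
  have hS₃ : ∀ x ∈ Nov.coeffsIn (fixedTensors 𝒱 H), f.hat x ∈ Nov.coeffsIn (fixedTensors 𝒲 H) :=
    fun x hx => Nov.lift_mem_coeffsIn h₃ hx
  have key := f.exists_of_cycle hC₁ hC₂ hf hq H h₁ h₂ h₃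
  refine ⟨hS₁, hS₂, hS₃, inducesIsoAt_of_conditions hcomm hS₃ hS₃ ?_ ?_, fun p => ?_⟩
  · intro x hx hdx y hy hfx
    obtain ⟨z, hz, -, -, hdz, -⟩ := key x hx y hy hdx hfx
    exact ⟨z, hz, hdz⟩
  · intro y hy hdy
    obtain ⟨z, hz, w, hw, hdz, hzw⟩ := key 0 (Submodule.zero_mem _) y hy (map_zero _)
      (by rw [map_zero, hdy])
    exact ⟨z, hz, hdz, w, hw, hzw⟩
  have hp₁ : ∀ q x, C₁.d (barProj 𝒱 q x) = barProj 𝒱 (q + 1) (C₁.d x) := by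
    rw [hd₁]
    exact (hasTensorDegree_tensorDifferential C₁.degree).lift_barProj
  have hp₂ : ∀ q x, C₂.d (barProj 𝒲 q x) = barProj 𝒲 (q + 1) (C₂.d x) := by
    rw [hd₂]
    exact (hasTensorDegree_tensorDifferential C₂.degree).lift_barProj
  have hp₃ : ∀ q x, f.hat (barProj 𝒱 q x) = barProj 𝒲 q (f.hat x) := by
    intro q x
    have h := (hasTensorDegree_sumPowers f.positive f.degree).lift_barProj q x
    rwa [add_zero] at h
  have hm₁ : ∀ q, ∀ x ∈ Nov.coeffsIn (fixedTensors 𝒱 H),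
      barProj 𝒱 q x ∈ Nov.coeffsIn (fixedTensors 𝒱 H) := fun q x hx g =>
    (isPermEquivariant_degreeProj _).map_mem (hx g)
  have hm₂ : ∀ q, ∀ x ∈ Nov.coeffsIn (fixedTensors 𝒲 H),
      barProj 𝒲 q x ∈ Nov.coeffsIn (fixedTensors 𝒲 H) := fun q x hx g =>
    (isPermEquivariant_degreeProj _).map_mem (hx g)
  have hdeg : ∀ q, ∀ x ∈ (Nov.coeffsIn (fixedTensors 𝒱 H)).restrictScalars R ⊓ barDegree 𝒱 q,
      f.hat x ∈ (Nov.coeffsIn (fixedTensors 𝒲 H)).restrictScalars R ⊓ barDegree 𝒲 q := by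
    rintro q x ⟨hx, hxq⟩
    refine ⟨hS₃ x hx, ?_⟩
    rw [← barProj_of_mem hxq, hp₃]
    exact barProj_mem 𝒲 _ _
  -- Exactness in each degree follows by projecting the solutions to the right degrees.
  refine inducesIsoAt_of_conditions hcomm (hdeg (p - 1)) (hdeg p) ?_ ?_
  · rintro x ⟨hx, hxp⟩ hdx y ⟨hy, -⟩ hfx
    obtain ⟨z, hz, -, -, hdz, -⟩ := key x hx y hy hdx hfx
    refine ⟨barProj 𝒱 (p - 1) z, ⟨hm₁ _ z hz, barProj_mem 𝒱 _ _⟩, ?_⟩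
    rw [LinearMap.restrictScalars_apply, hp₁, hdz, sub_add_cancel, barProj_of_mem hxp]
  · rintro y ⟨hy, hyp⟩ hdy
    rw [LinearMap.restrictScalars_apply] at hdy
    obtain ⟨z, hz, w, hw, hdz, hzw⟩ := key 0 (Submodule.zero_mem _) y hy (map_zero _)
      (by rw [map_zero, hdy])
    refine ⟨barProj 𝒱 p z, ⟨hm₁ _ z hz, barProj_mem 𝒱 _ _⟩, ?_, barProj 𝒲 (p - 1) w,
      ⟨hm₂ _ w hw, barProj_mem 𝒲 _ _⟩, ?_⟩
    · rw [LinearMap.restrictScalars_apply, hp₁, hdz, map_zero]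
    · rw [LinearMap.restrictScalars_apply, LinearMap.restrictScalars_apply, hp₂, hp₃,
        sub_add_cancel, ← map_sub, hzw, barProj_of_mem hyp]

end FilteredAInfHom

end QuasiIso

end

theorem mainTheorem5 {R V W : Type*} [Field R] [CharZero R]
    [AddCommGroup V] [Module R V] [AddCommGroup W] [Module R W]
    (𝒱 : ℤ → Submodule R V) [DirectSum.Decomposition 𝒱]
    (𝒲 : ℤ → Submodule R W) [DirectSum.Decomposition 𝒲]
    (C₁ : FilteredAInfAlgebra 𝒱) (C₂ : FilteredAInfAlgebra 𝒲)
    (hC₁ : C₁.m.IsGapped) (hC₂ : C₂.m.IsGapped)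
    (f : FilteredAInfHom C₁ C₂) (hf : f.f.IsGapped) (hq : f.IsQuasiIso) :
    f.InducesIsoOn ⊤ ⊤ ∧
      f.InducesIsoOn (cyclicBar 𝒱) (cyclicBar 𝒲) ∧
      f.InducesIsoOn (symmetricBar 𝒱) (symmetricBar 𝒲) := by
  refine ⟨?_, ?_, ?_⟩
  · have h := f.inducesIsoOn_fixedTensors hC₁ hC₂ hf hq fun _ => ⊥
    rw [TensorSum.fixedTensors_bot, TensorSum.fixedTensors_bot, Nov.coeffsIn_top,
      Nov.coeffsIn_top] at h
    exact h (fun _ _ => trivial) (fun _ _ => trivial) fun _ _ => trivial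
  · have h := f.inducesIsoOn_fixedTensors hC₁ hC₂ hf hq fun n => Subgroup.zpowers (finRotate n)
    rw [TensorSum.fixedTensors_zpowers, TensorSum.fixedTensors_zpowers] at h
    exact h (fun _ => tensorDifferential_mem_cyclic C₁.degree)
      (fun _ => tensorDifferential_mem_cyclic C₂.degree)
      fun _ => tensorMap_mem_cyclic f.positive f.degree
  · have h := f.inducesIsoOn_fixedTensors hC₁ hC₂ hf hq fun _ => ⊤
    rw [TensorSum.fixedTensors_top, TensorSum.fixedTensors_top] at h
    exact h (fun _ => tensorDifferential_mem_symmetric C₁.degree)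
      (fun _ => tensorDifferential_mem_symmetric C₂.degree)
      fun _ => tensorMap_mem_symmetric f.positive f.degree
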